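/- Let $\frac13<\alpha<\frac12$, $p=\frac1\alpha$, $q=\frac p2$. All vector norms are Euclidean, linear and multilinear maps carry operator norms, and $\mathbb R^m\otimes\mathbb R^m$ carries the projective norm. For a path $y$ put $y_{s,t}=y_t-y_s$; for $r\ge 1$ let $|||y|||_{r\text{-var},[a,b]}=\big(\sup\sum_i\|y_{t_i,t_{i+1}}\|^r\big)^{1/r}$ and, for a two-parameter map $R$, $|||R|||_{r\text{-var},[a,b]}=\big(\sup\sum_i\|R_{t_i,t_{i+1}}\|^r\big)^{1/r}$, the suprema being over finite partitions of $[a,b]$. A rough path on $[a,b]$ is a pair $\mathbf x=(x,\mathbb X)$ with $x:[a,b]\to\mathbb R^m$ $\alpha$-Hölder, $\|\mathbb X_{s,t}\|\le C|t-s|^{2\alpha}$ and $\mathbb X_{s,t}-\mathbb X_{s,u}-\mathbb X_{u,t}=x_{s,u}\otimes x_{u,t}$ for $a\le s\le u\le t\le b$; put $|||\mathbf x|||_{p\text{-var}}=(|||x|||_{p\text{-var}}^p+|||\mathbb X|||_{q\text{-var}}^q)^{1/p}$. A pair $(y,y')$ is controlled by $x$ if $y,y'$ are $\alpha$-Hölder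 and $R^y_{s,t}=y_{s,t}-y'_sx_{s,t}$ satisfies $\|R^y_{s,t}\|\le C|t-s|^{2\alpha}$. The rough integral is $\int_s^t y_u\,dx_u=\lim\sum_{[u,v]}(y_ux_{u,v}+y'_u\mathbb X_{u,v})$, the limit being over partitions of $[s,t]$ with mesh tending to $0$. A constant $C_p>1$ is called admissible (for $m,d$) if for all rough paths $\mathbf x$ in $\mathbb R^m$ on an interval, all controlled $(y,y')$ with $y_u\in L(\mathbb R^m,\mathbb R^d)$, and all $s\le t$ in the interval for which the integral exists, $$\Big\|\int_s^t y_u\,dx_u-y_sx_{s,t}-y'_s\mathbb X_{s,t}\Big\|\le C_p\big(|||x|||_{p\text{-var},[s,t]}|||R^y|||_{q\text{-var},[s,t]}+|||y'|||_{p\text{-var},[s,t]}|||\mathbb X|||_{q\text{-var},[s,t]}\big).$$ For $g\in C^3_b(\mathbb R^d,L(\mathbb R^m,\mathbb R^d))$ (that is, $g$ is $C^3$ and $g,Dg,D^2g,D^3g$ are bounded) let $$C_g=\max\Big\{\|Dg\|_\infty,\sqrt{\|Dg\|_\infty\|g\|_\infty},\sqrt{\|D^2g\|_\infty\|g\|_\infty},\sqrt{\|D^3g\|_\infty\|g\|_\infty},(\|D^2g\|_\infty\|g\|_\infty^2)^{1/3},(\|D^3g\|_\infty\|g\|_\infty^2)^{1/3}\Big\}.$$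 A solution of $d\phi=g(\phi)\,dx$ on $[a,b]$ is a path $\phi$ controlled by $x$ with derivative $\phi'=g(\phi)$ such that $\phi_t=\phi_a+\int_a^tg(\phi_u)\,dx_u$ for $t\in[a,b]$, where $g(\phi)$ has the derivative $[g(\phi)]'=Dg(\phi)g(\phi)$; so $R^\phi_{s,t}=\phi_{s,t}-g(\phi_s)x_{s,t}$. Theorem. There is a constant $C_p>1$, depending only on $\alpha$, that is admissible for all $m,d$. Moreover let $C_p>1$ be any admissible constant for $m,d$, let $g\in C^3_b$, let $\mathbf x$ be a rough path on $[a,b]$, $a\le b$, and suppose that $\lambda:=C_pC_g|||\mathbf x|||_{p\text{-var},[a,b]}\le\frac18$. All seminorms below are on $[a,b]$. (i) Every solution $\phi$ satisfies $$|||\phi|||_{p\text{-var}}\le2(\|g\|_\infty|||x|||_{p\text{-var}}+\lambda^2),\qquad|||R^\phi|||_{p\text{-var}}\le2\lambda^2,\qquad|||R^\phi|||_{q\text{-var}}\le2\lambda^2,$$ and, if $g(0)=0$, $$|||\phi|||_{p\text{-var}}\le2\lambda\|\phi_a\|,\qquad|||R^\phi|||_{p\text{-var}}\le2\lambda^2\|\phi_a\|,\qquad|||R^\phi|||_{q\text{-var}}\le2\lambda^2\|\phi_a\|.$$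 (ii) For every $\phi_a\in\mathbb R^d$ there is exactly one solution $\phi_\cdot(\mathbf x,\phi_a)$ on $[a,b]$ starting at $\phi_a$; for every $t\in[a,b]$ the map $\phi_a\mapsto\phi_t(\mathbf x,\phi_a)$ is differentiable on $\mathbb R^d$ with invertible derivative, and $$\Big\|\frac{\partial\phi}{\partial\phi_a}(t,\mathbf x,\phi_a)-I\Big\|\le4\lambda,\qquad\Big\|\Big[\frac{\partial\phi}{\partial\phi_a}(t,\mathbf x,\phi_a)\Big]^{-1}-I\Big\|\le4\lambda .$$ -/

import Mathlib

open scoped TensorProduct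

noncomputable section

/-- `ℝⁿ` with its Euclidean norm. -/
abbrev Euc (n : ℕ) : Type := EuclideanSpace ℝ (Fin n)

/-! ### Partitions and variation -/

/-- `a = τ 0 < τ 1 < ⋯ < τ n = b`. Only the values `τ 0, …, τ n` matter; if `a = b`, then `n = 0`. -/
def IsPartition (a b : ℝ) (n : ℕ) (τ : ℕ → ℝ) : Prop :=
  τ 0 = a ∧ τ n = b ∧ ∀ i < n, τ i < τ (i + 1)

/-- `r`-variation on `[a,b]` of a two-parameter object whose increment over `[s,t]` has size
`N s t`: the supremum over all finite partitions of `∑ N (τ i) (τ (i+1)) ^ r`, to the power `1/r`.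
It is applied only to objects with `N s t ≤ C * (t - s) ^ (1/r)`, for which the supremum is
finite (see `variation_bddAbove`). -/
def variation (r : ℝ) (N : ℝ → ℝ → ℝ) (a b : ℝ) : ℝ :=
  (sSup {S : ℝ | ∃ (n : ℕ) (τ : ℕ → ℝ), IsPartition a b n τ ∧
    S = ∑ i ∈ Finset.range n, N (τ i) (τ (i + 1)) ^ r}) ^ (1 / r)

/-- `r`-variation of a path `y`. -/
def pathVar {W : Type*} [NormedAddCommGroup W] (r : ℝ) (y : ℝ → W) (a b : ℝ) : ℝ :=
  variation r (fun s t => ‖y t - y s‖) a b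

/-- `r`-variation of a two-parameter map `R`. -/
def twoVar {W : Type*} [NormedAddCommGroup W] (r : ℝ) (R : ℝ → ℝ → W) (a b : ℝ) : ℝ :=
  variation r (fun s t => ‖R s t‖) a b

/-- A two-parameter object of increment size `N` is Hölder of exponent `β` on `a ≤ s ≤ t ≤ b`. -/
def HolderOnSimplex (β : ℝ) (N : ℝ → ℝ → ℝ) (a b : ℝ) : Prop :=
  ∃ C : ℝ, ∀ s t : ℝ, a ≤ s → s ≤ t → t ≤ b → N s t ≤ C * (t - s) ^ β

theorem IsPartition.mem {a b : ℝ} {n : ℕ} {τ : ℕ → ℝ} (h : IsPartition a b n τ) :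
    ∀ i ≤ n, a ≤ τ i ∧ τ i ≤ b := by
  obtain ⟨h0, hn, hs⟩ := h
  have up : ∀ i ≤ n, a ≤ τ i := by
    intro i
    induction i with
    | zero => intro _; exact h0.ge
    | succ k ih => intro hk; exact (ih (by omega)).trans (hs k (by omega)).le
  have down : ∀ j ≤ n, τ (n - j) ≤ b := by
    intro j
    induction j with
    | zero => intro _; simpa using hn.le
    | succ k ih =>
      intro hk
      have h1 := hs (n - (k + 1)) (by omega)
      have h2 : n - (k + 1) + 1 = n - k := by omega
      rw [h2] at h1
      exact h1.le.trans (ih (by omega))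
  intro i hi
  refine ⟨up i hi, ?_⟩
  have := down (n - i) (by omega)
  rwa [Nat.sub_sub_self hi] at this

/-- The supremum in `variation` is finite for Hölder objects of the matching exponent. -/
theorem variation_bddAbove {r : ℝ} (hr : 0 < r) {N : ℝ → ℝ → ℝ} {a b : ℝ}
    (hN : ∀ s t, 0 ≤ N s t) (h : HolderOnSimplex (1 / r) N a b) :
    BddAbove {S : ℝ | ∃ (n : ℕ) (τ : ℕ → ℝ), IsPartition a b n τ ∧
      S = ∑ i ∈ Finset.range n, N (τ i) (τ (i + 1)) ^ r} := by
  obtain ⟨C, hC⟩ := h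
  refine ⟨|C| ^ r * (b - a), ?_⟩
  rintro S ⟨n, τ, hτ, rfl⟩
  have key : ∀ i ∈ Finset.range n,
      N (τ i) (τ (i + 1)) ^ r ≤ |C| ^ r * (τ (i + 1) - τ i) := by
    intro i hi
    rw [Finset.mem_range] at hi
    have hlt := hτ.2.2 i hi
    have h1 := hC (τ i) (τ (i + 1)) (hτ.mem i hi.le).1 hlt.le (hτ.mem (i + 1) hi).2
    have h0 : 0 ≤ τ (i + 1) - τ i := by linarith
    have h2 : N (τ i) (τ (i + 1)) ≤ |C| * (τ (i + 1) - τ i) ^ (1 / r) :=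
      h1.trans (mul_le_mul_of_nonneg_right (le_abs_self C) (Real.rpow_nonneg h0 _))
    calc N (τ i) (τ (i + 1)) ^ r ≤ (|C| * (τ (i + 1) - τ i) ^ (1 / r)) ^ r :=
          Real.rpow_le_rpow (hN _ _) h2 hr.le
      _ = |C| ^ r * (τ (i + 1) - τ i) := by
          rw [Real.mul_rpow (abs_nonneg C) (Real.rpow_nonneg h0 _), ← Real.rpow_mul h0,
            one_div_mul_cancel hr.ne', Real.rpow_one]
  calc _ ≤ ∑ i ∈ Finset.range n, |C| ^ r * (τ (i + 1) - τ i) := Finset.sum_le_sum key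
    _ = |C| ^ r * (b - a) := by
        rw [← Finset.mul_sum, Finset.sum_range_sub, hτ.1, hτ.2.1]

/-! ### Rough paths -/

/-- The projective norm on `ℝᵐ ⊗ ℝᵐ`. -/
def tensorNorm {m : ℕ} (T : Euc m ⊗[ℝ] Euc m) : ℝ :=
  sInf {c : ℝ | ∃ (k : ℕ) (v w : Fin k → Euc m),
    T = ∑ i, v i ⊗ₜ[ℝ] w i ∧ c = ∑ i, ‖v i‖ * ‖w i‖}

/-- `(x, X)` is an `α`-Hölder rough path on `[a,b]`: Hölder bounds and Chen's relation. -/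
structure IsRoughPath {m : ℕ} (α a b : ℝ) (x : ℝ → Euc m)
    (X : ℝ → ℝ → Euc m ⊗[ℝ] Euc m) : Prop where
  holder_path : HolderOnSimplex α (fun s t => ‖x t - x s‖) a b
  holder_area : HolderOnSimplex (2 * α) (fun s t => tensorNorm (X s t)) a b
  chen : ∀ s u t : ℝ, a ≤ s → s ≤ u → u ≤ t → t ≤ b →
    X s t - X s u - X u t = (x u - x s) ⊗ₜ[ℝ] (x t - x u)

/-- `q`-variation of the second level `X`. -/
def areaVar {m : ℕ} (q : ℝ) (X : ℝ → ℝ → Euc m ⊗[ℝ] Euc m) (a b : ℝ) : ℝ :=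
  variation q (fun s t => tensorNorm (X s t)) a b

/-- The `p`-variation seminorm of the rough path `(x, X)`, with `q = p / 2`. -/
def roughVar {m : ℕ} (p : ℝ) (x : ℝ → Euc m) (X : ℝ → ℝ → Euc m ⊗[ℝ] Euc m) (a b : ℝ) : ℝ :=
  (pathVar p x a b ^ p + areaVar (p / 2) X a b ^ (p / 2)) ^ (1 / p)

/-! ### Controlled paths and the rough integral -/

/-- The remainder `R_{s,t} = y_t - y_s - y'_s (x_t - x_s)`. -/
def remainder {m : ℕ} {W : Type*} [NormedAddCommGroup W] [NormedSpace ℝ W]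
    (x : ℝ → Euc m) (y : ℝ → W) (y' : ℝ → Euc m →L[ℝ] W) (s t : ℝ) : W :=
  y t - y s - y' s (x t - x s)

/-- `(y, y')` is controlled by `x` on `[a,b]`, with Gubinelli derivative `y'`. -/
structure IsControlled {m : ℕ} {W : Type*} [NormedAddCommGroup W] [NormedSpace ℝ W]
    (α a b : ℝ) (x : ℝ → Euc m) (y : ℝ → W) (y' : ℝ → Euc m →L[ℝ] W) : Prop where
  holder_path : HolderOnSimplex α (fun s t => ‖y t - y s‖) a b
  holder_deriv : HolderOnSimplex α (fun s t => ‖y' t - y' s‖) a b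
  holder_remainder : HolderOnSimplex (2 * α) (fun s t => ‖remainder x y y' s t‖) a b

/-- The action of `A ∈ L(ℝᵐ, L(ℝᵐ, W))` on `ℝᵐ ⊗ ℝᵐ`, determined by `v ⊗ w ↦ A v w`. -/
def contract {m : ℕ} {W : Type*} [NormedAddCommGroup W] [NormedSpace ℝ W]
    (A : Euc m →L[ℝ] Euc m →L[ℝ] W) (T : Euc m ⊗[ℝ] Euc m) : W :=
  TensorProduct.lift (ContinuousLinearMap.toLinearMap₁₂ A) T

/-- `y_u (x_v - x_u) + y'_u X_{u,v}`. -/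
def localIncrement {m : ℕ} {W : Type*} [NormedAddCommGroup W] [NormedSpace ℝ W]
    (x : ℝ → Euc m) (X : ℝ → ℝ → Euc m ⊗[ℝ] Euc m)
    (y : ℝ → Euc m →L[ℝ] W) (y' : ℝ → Euc m →L[ℝ] Euc m →L[ℝ] W) (u v : ℝ) : W :=
  y u (x v - x u) + contract (y' u) (X u v)

/-- `∫_s^t y dx` exists, as the limit of the compensated Riemann sums over partitions of `[s,t]`
whose mesh tends to `0`, and equals `I`. -/
def HasRoughIntegral {m : ℕ} {W : Type*} [NormedAddCommGroup W] [NormedSpace ℝ W]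
    (x : ℝ → Euc m) (X : ℝ → ℝ → Euc m ⊗[ℝ] Euc m)
    (y : ℝ → Euc m →L[ℝ] W) (y' : ℝ → Euc m →L[ℝ] Euc m →L[ℝ] W) (s t : ℝ) (I : W) : Prop :=
  ∀ ε > 0, ∃ δ > 0, ∀ (n : ℕ) (τ : ℕ → ℝ), IsPartition s t n τ →
    (∀ i < n, τ (i + 1) - τ i ≤ δ) →
    ‖∑ i ∈ Finset.range n, localIncrement x X y y' (τ i) (τ (i + 1)) - I‖ ≤ ε

/-- `C` is an admissible constant in the basic estimate for rough integrals (with values in `ℝᵈ`,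
against `α`-Hölder rough paths in `ℝᵐ`), in `p`- and `q`-variation with `p = 1/α`, `q = p/2`. -/
def IsRoughIntegralConstant (α : ℝ) (m d : ℕ) (C : ℝ) : Prop :=
  ∀ (a b : ℝ) (x : ℝ → Euc m) (X : ℝ → ℝ → Euc m ⊗[ℝ] Euc m), IsRoughPath α a b x X →
  ∀ (y : ℝ → Euc m →L[ℝ] Euc d) (y' : ℝ → Euc m →L[ℝ] Euc m →L[ℝ] Euc d),
    IsControlled α a b x y y' →
  ∀ (s t : ℝ), a ≤ s → s ≤ t → t ≤ b →
  ∀ I : Euc d, HasRoughIntegral x X y y' s t I →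
    ‖I - y s (x t - x s) - contract (y' s) (X s t)‖ ≤
      C * (pathVar (1 / α) x s t * twoVar (1 / α / 2) (remainder x y y') s t +
        pathVar (1 / α) y' s t * areaVar (1 / α / 2) X s t)

/-! ### The coefficient `g` and the pure rough differential equation -/

/-- `g ∈ C³_b`: three times continuously differentiable, `g` and its derivatives up to order three
bounded. -/
def IsCb3 {m d : ℕ} (g : Euc d → Euc m →L[ℝ] Euc d) : Prop :=
  ContDiff ℝ 3 g ∧ ∀ k ≤ 3, ∃ C : ℝ, ∀ y, ‖iteratedFDeriv ℝ k g y‖ ≤ C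

/-- `‖Dᵏ g‖_∞` (the case `k = 0` is `‖g‖_∞`), with operator norms. -/
def supD {m d : ℕ} (g : Euc d → Euc m →L[ℝ] Euc d) (k : ℕ) : ℝ :=
  ⨆ y, ‖iteratedFDeriv ℝ k g y‖

/-- The constant `C_g`. -/
def Cg {m d : ℕ} (g : Euc d → Euc m →L[ℝ] Euc d) : ℝ :=
  max (supD g 1) <| max (√(supD g 1 * supD g 0)) <| max (√(supD g 2 * supD g 0)) <|
    max (√(supD g 3 * supD g 0)) <|
      max ((supD g 2 * supD g 0 ^ 2) ^ (1 / 3 : ℝ)) ((supD g 3 * supD g 0 ^ 2) ^ (1 / 3 : ℝ))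

/-- The Gubinelli derivative `Dg(φ) g(φ)` of `g(φ)`, that is `v ↦ Dg(φ)[g(φ) v]`. -/
def gDeriv {m d : ℕ} (g : Euc d → Euc m →L[ℝ] Euc d) (φ : ℝ → Euc d) (u : ℝ) :
    Euc m →L[ℝ] Euc m →L[ℝ] Euc d :=
  (fderiv ℝ g (φ u)).comp (g (φ u))

/-- `φ` solves `dφ = g(φ) dx` on `[a,b]`: it is controlled by `x` with Gubinelli derivative
`g(φ)`, and `φ_t = φ_a + ∫_a^t g(φ_u) dx_u` for all `t ∈ [a,b]`. -/
structure IsPureSolution {m d : ℕ} (α a b : ℝ) (x : ℝ → Euc m)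
    (X : ℝ → ℝ → Euc m ⊗[ℝ] Euc m) (g : Euc d → Euc m →L[ℝ] Euc d) (φ : ℝ → Euc d) : Prop where
  controlled : IsControlled α a b x φ (fun u => g (φ u))
  integral_eq : ∀ t ∈ Set.Icc a b,
    HasRoughIntegral x X (fun u => g (φ u)) (gDeriv g φ) a t (φ t - φ a)

end

section

set_option maxSynthPendingDepth 3

/-! ### Partitions -/

/-! Everything rests on second-order local expansions whose additivity defect has order 1/p + 1/q =
3α > 1.

Admissible constants: deleting the points of a partition one by one, always where the defect is at
most average, bounds the compensated Riemann sums by a convergent series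
(`norm_sum_sub_le_of_varLE`, `exists_isRoughIntegralConstant`).

A priori bounds: the basic estimate, applied to g(φ) on every subinterval and summed in q-variation
(`IsRoughIntegralConstant.varLE_remainder`), bounds the variation of R^φ by a main term of order λ²
plus a small multiple of itself. That variation is finite by the Hölder hypothesis, so for λ ≤ 1/8
it can be absorbed. Since C_g controls only certain products of the norms of g and its derivatives,
the estimate is proved with a weight k (`IsPureSolution.mul_twoVar_remainder_le`).

Comparison: the same scheme for the difference of two solutions shows that its p-variation is at
most 8/3·λ times the initial distance, and that its second-order expansion has an error cubic in λ
(`IsPureSolution.norm_sub_sub_le`). Uniqueness follows at once.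

Existence: the second-order Euler step is a flow up to an error of order 3α. Discrete sewing
controls its trajectories on finite sets of times uniformly, and compactness yields a path with a
3α-expansion, which is a solution (`IsAlmostFlow.exists_path`, `isPureSolution_of_norm_sub_le`).

Differentiability: rescaled differences of solutions are bounded and satisfy a uniform 3α-expansion,
so each limit along an ultrafilter solves the linearized equation
(`IsPureSolution.exists_linearized_limit`). Such a solution is determined by its initial value
(`eq_zero_of_linear_almost_flow`), so all limits agree and depend linearly on the direction; this
gives a Fréchet derivative J. By the comparison ‖J - I‖ ≤ 8/3·λ ≤ 1/3, whence J is invertible and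
‖J⁻¹ - I‖ ≤ 3/2 · 8/3·λ = 4λ. -/

theorem isPartition_refl (a : ℝ) : IsPartition a a 0 (fun _ => a) :=
  ⟨rfl, rfl, fun i hi => absurd hi (Nat.not_lt_zero i)⟩

theorem isPartition_pair {a b : ℝ} (h : a < b) :
    IsPartition a b 1 (fun i => if i = 0 then a else b) := by
  refine ⟨by simp, by simp, fun i hi => ?_⟩
  obtain rfl : i = 0 := by omega
  simpa using h

theorem IsPartition.append {a u b : ℝ} {n₁ n₂ : ℕ} {τ₁ τ₂ : ℕ → ℝ} (h₁ : IsPartition a u n₁ τ₁)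
    (h₂ : IsPartition u b n₂ τ₂) :
    ∃ τ, IsPartition a b (n₁ + n₂) τ ∧ (∀ i ≤ n₁, τ i = τ₁ i) ∧ ∀ i, τ (n₁ + i) = τ₂ i := by
  have hl : ∀ i ≤ n₁, (fun i => if i < n₁ then τ₁ i else τ₂ (i - n₁)) i = τ₁ i := by
    intro i hi
    rcases hi.lt_or_eq with h | rfl
    · simp [h]
    · simp [h₁.2.1, h₂.1]
  have hr : ∀ i, (fun i => if i < n₁ then τ₁ i else τ₂ (i - n₁)) (n₁ + i) = τ₂ i := by
    intro i; simp
  refine ⟨fun i => if i < n₁ then τ₁ i else τ₂ (i - n₁), ⟨?_, ?_, ?_⟩, hl, hr⟩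
  · rw [hl 0 (Nat.zero_le _), h₁.1]
  · rw [hr, h₂.2.1]
  · intro i hi
    rcases lt_or_ge i n₁ with h | h
    · rw [hl i h.le, hl (i + 1) h]; exact h₁.2.2 i h
    · obtain ⟨j, rfl⟩ := Nat.exists_eq_add_of_le h
      rw [hr j, add_assoc, hr (j + 1)]; exact h₂.2.2 j (by omega)

/-- A single concatenation serves all mesh bounds and all summands at once. -/
theorem IsPartition.append_sum {W : Type*} [AddCommMonoid W] {a u b : ℝ} {n₁ n₂ : ℕ}
    {τ₁ τ₂ : ℕ → ℝ} (h₁ : IsPartition a u n₁ τ₁) (h₂ : IsPartition u b n₂ τ₂) :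
    ∃ τ, IsPartition a b (n₁ + n₂) τ ∧
      (∀ δ, (∀ i < n₁, τ₁ (i + 1) - τ₁ i ≤ δ) → (∀ i < n₂, τ₂ (i + 1) - τ₂ i ≤ δ) →
        ∀ i < n₁ + n₂, τ (i + 1) - τ i ≤ δ) ∧
      ∀ f : ℝ → ℝ → W, ∑ i ∈ Finset.range (n₁ + n₂), f (τ i) (τ (i + 1)) =
        ∑ i ∈ Finset.range n₁, f (τ₁ i) (τ₁ (i + 1)) +
          ∑ i ∈ Finset.range n₂, f (τ₂ i) (τ₂ (i + 1)) := by
  obtain ⟨τ, hτ, hl, hr⟩ := h₁.append h₂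
  refine ⟨τ, hτ, ?_, ?_⟩
  · intro δ h h' i hi
    rcases lt_or_ge i n₁ with hi' | hi'
    · rw [hl i hi'.le, hl (i + 1) hi']; exact h i hi'
    · obtain ⟨j, rfl⟩ := Nat.exists_eq_add_of_le hi'
      rw [hr j, add_assoc, hr (j + 1)]; exact h' j (by omega)
  · intro f
    rw [Finset.sum_range_add]
    congr 1
    · refine Finset.sum_congr rfl fun i hi => ?_
      rw [Finset.mem_range] at hi
      rw [hl i hi.le, hl (i + 1) hi]
    · refine Finset.sum_congr rfl fun i _ => ?_
      rw [add_assoc, hr i, hr (i + 1)]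

theorem exists_isPartition_mesh_le {a b δ : ℝ} (hab : a ≤ b) (hδ : 0 < δ) :
    ∃ n τ, IsPartition a b n τ ∧ ∀ i < n, τ (i + 1) - τ i ≤ δ := by
  rcases hab.eq_or_lt with rfl | hab
  · exact ⟨0, _, isPartition_refl a, fun i hi => absurd hi (Nat.not_lt_zero i)⟩
  have hn : 0 < ⌈(b - a) / δ⌉₊ := Nat.ceil_pos.2 (div_pos (sub_pos.2 hab) hδ)
  have hn' : (0 : ℝ) < ⌈(b - a) / δ⌉₊ := Nat.cast_pos.2 hn
  have hstep : ∀ i : ℕ, (a + (i + 1 : ℕ) * ((b - a) / ⌈(b - a) / δ⌉₊)) -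
      (a + i * ((b - a) / ⌈(b - a) / δ⌉₊)) = (b - a) / ⌈(b - a) / δ⌉₊ := by
    intro i; push_cast; ring
  refine ⟨⌈(b - a) / δ⌉₊, fun i => a + i * ((b - a) / ⌈(b - a) / δ⌉₊), ⟨by simp, ?_, ?_⟩, ?_⟩
  · field_simp; ring
  · intro i _
    have := hstep i
    have h2 : 0 < (b - a) / ⌈(b - a) / δ⌉₊ := div_pos (sub_pos.2 hab) hn'
    dsimp only; linarith
  · intro i _
    rw [hstep, div_le_iff₀ hn']
    have := Nat.le_ceil ((b - a) / δ)
    rw [div_le_iff₀ hδ] at this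
    linarith

/-! ### Bounds for the variation -/

/-- `N` has `r`-variation at most `B` on `[a,b]`. -/
structure VarLE (r : ℝ) (N : ℝ → ℝ → ℝ) (a b B : ℝ) : Prop where
  nonneg : ∀ s t, 0 ≤ N s t
  bound_nonneg : 0 ≤ B
  sum_le : ∀ n τ, IsPartition a b n τ → ∑ i ∈ Finset.range n, N (τ i) (τ (i + 1)) ^ r ≤ B ^ r

theorem variation_nonneg {r : ℝ} {N : ℝ → ℝ → ℝ} (hN : ∀ s t, 0 ≤ N s t) (a b : ℝ) :
    0 ≤ variation r N a b := by
  refine Real.rpow_nonneg (Real.sSup_nonneg ?_) _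
  rintro S ⟨n, τ, _, rfl⟩
  exact Finset.sum_nonneg fun i _ => Real.rpow_nonneg (hN _ _) _

namespace VarLE

variable {r a b B B' : ℝ} {N N' : ℝ → ℝ → ℝ}

theorem mono_bound (hr : 0 < r) (h : VarLE r N a b B) (hB : B ≤ B') : VarLE r N a b B' :=
  ⟨h.nonneg, h.bound_nonneg.trans hB, fun n τ hτ =>
    (h.sum_le n τ hτ).trans (Real.rpow_le_rpow h.bound_nonneg hB hr.le)⟩

theorem mono (hr : 0 < r) (h : VarLE r N a b B) (hN' : ∀ s t, 0 ≤ N' s t)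
    (hle : ∀ s t, a ≤ s → s < t → t ≤ b → N' s t ≤ N s t) : VarLE r N' a b B := by
  refine ⟨hN', h.bound_nonneg, fun n τ hτ => le_trans ?_ (h.sum_le n τ hτ)⟩
  refine Finset.sum_le_sum fun i hi => Real.rpow_le_rpow (hN' _ _) ?_ hr.le
  rw [Finset.mem_range] at hi
  exact hle _ _ (hτ.mem i hi.le).1 (hτ.2.2 i hi) (hτ.mem (i + 1) hi).2

theorem const_mul (h : VarLE r N a b B) {c : ℝ} (hc : 0 ≤ c) :
    VarLE r (fun s t => c * N s t) a b (c * B) := by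
  refine ⟨fun s t => mul_nonneg hc (h.nonneg s t), mul_nonneg hc h.bound_nonneg,
    fun n τ hτ => ?_⟩
  rw [Real.mul_rpow hc h.bound_nonneg]
  simp_rw [fun s t => Real.mul_rpow hc (h.nonneg s t) (z := r)]
  rw [← Finset.mul_sum]
  exact mul_le_mul_of_nonneg_left (h.sum_le n τ hτ) (Real.rpow_nonneg hc _)

/-- Minkowski's inequality on each partition. -/
theorem add (hr : 1 ≤ r) (h : VarLE r N a b B) (h' : VarLE r N' a b B') :
    VarLE r (fun s t => N s t + N' s t) a b (B + B') := by
  have hr0 : 0 < r := by linarith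
  refine ⟨fun s t => add_nonneg (h.nonneg s t) (h'.nonneg s t),
    add_nonneg h.bound_nonneg h'.bound_nonneg, fun n τ hτ => ?_⟩
  have key := Real.Lp_add_le_of_nonneg (Finset.range n) (f := fun i => N (τ i) (τ (i + 1)))
    (g := fun i => N' (τ i) (τ (i + 1))) hr (fun i _ => h.nonneg _ _) (fun i _ => h'.nonneg _ _)
  have root : ∀ {M : ℝ → ℝ → ℝ} {D : ℝ}, VarLE r M a b D →
      (∑ i ∈ Finset.range n, M (τ i) (τ (i + 1)) ^ r) ^ (1 / r) ≤ D := by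
    intro M D hM
    have h1 := Real.rpow_le_rpow (Finset.sum_nonneg fun i _ => Real.rpow_nonneg (hM.nonneg _ _) _)
      (hM.sum_le n τ hτ) (one_div_nonneg.2 hr0.le)
    rwa [← Real.rpow_mul hM.bound_nonneg, mul_one_div_cancel hr0.ne', Real.rpow_one] at h1
  have h2 := key.trans (add_le_add (root h) (root h'))
  have hS : 0 ≤ ∑ i ∈ Finset.range n, (N (τ i) (τ (i + 1)) + N' (τ i) (τ (i + 1))) ^ r :=
    Finset.sum_nonneg fun i _ => Real.rpow_nonneg (add_nonneg (h.nonneg _ _) (h'.nonneg _ _)) _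
  have h3 := Real.rpow_le_rpow (Real.rpow_nonneg hS _) h2 hr0.le
  rwa [← Real.rpow_mul hS, one_div_mul_cancel hr0.ne', Real.rpow_one] at h3

/-- Cauchy–Schwarz for the powers with exponent p/2: products of two first-order objects are of
second order. -/
theorem mul {p : ℝ} (h : VarLE p N a b B) (h' : VarLE p N' a b B') :
    VarLE (p / 2) (fun s t => N s t * N' s t) a b (B * B') := by
  refine ⟨fun s t => mul_nonneg (h.nonneg s t) (h'.nonneg s t),
    mul_nonneg h.bound_nonneg h'.bound_nonneg, fun n τ hτ => ?_⟩
  have sq : ∀ z : ℝ, 0 ≤ z → (z ^ (p / 2)) ^ 2 = z ^ p := by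
    intro z hz
    rw [← Real.rpow_natCast, ← Real.rpow_mul hz]; norm_num
  simp_rw [fun s t => Real.mul_rpow (h.nonneg s t) (h'.nonneg s t) (z := p / 2)]
  rw [Real.mul_rpow h.bound_nonneg h'.bound_nonneg]
  have key := Finset.sum_mul_sq_le_sq_mul_sq (Finset.range n)
    (fun i => N (τ i) (τ (i + 1)) ^ (p / 2)) (fun i => N' (τ i) (τ (i + 1)) ^ (p / 2))
  simp_rw [fun s t => sq _ (h.nonneg s t), fun s t => sq _ (h'.nonneg s t)] at key
  have hB := Real.rpow_nonneg h.bound_nonneg (p / 2)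
  have hB' := Real.rpow_nonneg h'.bound_nonneg (p / 2)
  refine abs_le_of_sq_le_sq' (a := _) ?_ (mul_nonneg hB hB') |>.2
  rw [mul_pow, sq _ h.bound_nonneg, sq _ h'.bound_nonneg]
  refine key.trans (mul_le_mul (h.sum_le n τ hτ) (h'.sum_le n τ hτ)
    (Finset.sum_nonneg fun i _ => Real.rpow_nonneg (h'.nonneg _ _) _)
    (Real.rpow_nonneg h.bound_nonneg _))

/-- Complete [s,t] to a partition of [a,b] and drop the other terms. -/
theorem le (hr : 0 < r) (h : VarLE r N a b B) {s t : ℝ} (has : a ≤ s) (hst : s < t)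
    (htb : t ≤ b) : N s t ≤ B := by
  obtain ⟨n₁, τ₁, h₁, -⟩ := exists_isPartition_mesh_le has one_pos
  obtain ⟨n₂, τ₂, h₂, -⟩ := exists_isPartition_mesh_le htb one_pos
  obtain ⟨τ₃, h₃, -, e₃⟩ := h₁.append_sum (W := ℝ) (isPartition_pair hst)
  obtain ⟨τ₄, h₄, -, e₄⟩ := h₃.append_sum (W := ℝ) h₂
  have key := h.sum_le _ _ h₄
  rw [e₄ (fun s t => N s t ^ r), e₃ (fun s t => N s t ^ r)] at key
  have n1 : 0 ≤ ∑ i ∈ Finset.range n₁, N (τ₁ i) (τ₁ (i + 1)) ^ r :=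
    Finset.sum_nonneg fun i _ => Real.rpow_nonneg (h.nonneg _ _) _
  have n2 : 0 ≤ ∑ i ∈ Finset.range n₂, N (τ₂ i) (τ₂ (i + 1)) ^ r :=
    Finset.sum_nonneg fun i _ => Real.rpow_nonneg (h.nonneg _ _) _
  simp only [Finset.sum_range_one, if_true, Nat.zero_add, one_ne_zero, if_false] at key
  refine (Real.rpow_le_rpow_iff (h.nonneg s t) h.bound_nonneg hr).1 (by linarith)

theorem restrict (h : VarLE r N a b B) {s t : ℝ} (has : a ≤ s)
    (htb : t ≤ b) : VarLE r N s t B := by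
  refine ⟨h.nonneg, h.bound_nonneg, fun n τ hτ => ?_⟩
  obtain ⟨n₁, τ₁, h₁, -⟩ := exists_isPartition_mesh_le has one_pos
  obtain ⟨n₂, τ₂, h₂, -⟩ := exists_isPartition_mesh_le htb one_pos
  obtain ⟨τ₃, h₃, -, e₃⟩ := h₁.append_sum (W := ℝ) hτ
  obtain ⟨τ₄, h₄, -, e₄⟩ := h₃.append_sum (W := ℝ) h₂
  have key := h.sum_le _ _ h₄
  rw [e₄ (fun s t => N s t ^ r), e₃ (fun s t => N s t ^ r)] at key
  have n1 : 0 ≤ ∑ i ∈ Finset.range n₁, N (τ₁ i) (τ₁ (i + 1)) ^ r :=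
    Finset.sum_nonneg fun i _ => Real.rpow_nonneg (h.nonneg _ _) _
  have n2 : 0 ≤ ∑ i ∈ Finset.range n₂, N (τ₂ i) (τ₂ (i + 1)) ^ r :=
    Finset.sum_nonneg fun i _ => Real.rpow_nonneg (h.nonneg _ _) _
  linarith

/-- Each increment z is at most B, so z^q ≤ z^r B^(q-r). -/
theorem exponent {q : ℝ} (hr : 0 < r) (hrq : r ≤ q) (h : VarLE r N a b B) : VarLE q N a b B := by
  refine ⟨h.nonneg, h.bound_nonneg, fun n τ hτ => ?_⟩
  have split : ∀ z : ℝ, 0 ≤ z → z ^ q = z ^ r * z ^ (q - r) := by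
    intro z hz
    rw [← Real.rpow_add_of_nonneg hz hr.le (sub_nonneg.2 hrq)]; congr 1; ring
  calc ∑ i ∈ Finset.range n, N (τ i) (τ (i + 1)) ^ q
      ≤ ∑ i ∈ Finset.range n, N (τ i) (τ (i + 1)) ^ r * B ^ (q - r) := by
        refine Finset.sum_le_sum fun i hi => ?_
        rw [Finset.mem_range] at hi
        rw [split _ (h.nonneg _ _)]
        refine mul_le_mul_of_nonneg_left (Real.rpow_le_rpow (h.nonneg _ _) ?_ (sub_nonneg.2 hrq))
          (Real.rpow_nonneg (h.nonneg _ _) _)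
        exact h.le hr (hτ.mem i hi.le).1 (hτ.2.2 i hi) (hτ.mem (i + 1) hi).2
    _ ≤ B ^ r * B ^ (q - r) := by
        rw [← Finset.sum_mul]
        exact mul_le_mul_of_nonneg_right (h.sum_le n τ hτ) (Real.rpow_nonneg h.bound_nonneg _)
    _ = B ^ q := (split B h.bound_nonneg).symm

theorem bddAbove (h : VarLE r N a b B) : BddAbove {S : ℝ | ∃ (n : ℕ) (τ : ℕ → ℝ),
    IsPartition a b n τ ∧ S = ∑ i ∈ Finset.range n, N (τ i) (τ (i + 1)) ^ r} := by
  refine ⟨B ^ r, ?_⟩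
  rintro S ⟨n, τ, hτ, rfl⟩
  exact h.sum_le n τ hτ

theorem variation_rpow (hr : 0 < r) (hN : ∀ s t, 0 ≤ N s t) (a b : ℝ) :
    variation r N a b ^ r = sSup {S : ℝ | ∃ (n : ℕ) (τ : ℕ → ℝ),
      IsPartition a b n τ ∧ S = ∑ i ∈ Finset.range n, N (τ i) (τ (i + 1)) ^ r} := by
  unfold variation
  rw [← Real.rpow_mul, one_div_mul_cancel hr.ne', Real.rpow_one]
  refine Real.sSup_nonneg ?_
  rintro S ⟨n, τ, _, rfl⟩
  exact Finset.sum_nonneg fun i _ => Real.rpow_nonneg (hN _ _) _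

theorem variation_le (hr : 0 < r) (h : VarLE r N a b B) : variation r N a b ≤ B := by
  rw [← Real.rpow_le_rpow_iff (variation_nonneg h.nonneg a b) h.bound_nonneg hr,
    variation_rpow hr h.nonneg]
  refine Real.sSup_le ?_ (Real.rpow_nonneg h.bound_nonneg _)
  rintro S ⟨n, τ, hτ, rfl⟩
  exact h.sum_le n τ hτ

theorem self (hr : 0 < r) (h : VarLE r N a b B) : VarLE r N a b (variation r N a b) := by
  refine ⟨h.nonneg, variation_nonneg h.nonneg a b, fun n τ hτ => ?_⟩
  rw [variation_rpow hr h.nonneg]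
  exact le_csSup h.bddAbove ⟨n, τ, hτ, rfl⟩

theorem variation_add_le (hr : 0 < r) (h : VarLE r N a b B) {u : ℝ} (hau : a ≤ u) (hub : u ≤ b) :
    variation r N a u ^ r + variation r N u b ^ r ≤ variation r N a b ^ r := by
  have hab := (h.self hr)
  have nonempty : ∀ {s t : ℝ}, s ≤ t → {S : ℝ | ∃ (n : ℕ) (τ : ℕ → ℝ),
      IsPartition s t n τ ∧ S = ∑ i ∈ Finset.range n, N (τ i) (τ (i + 1)) ^ r}.Nonempty := by
    intro s t hst
    obtain ⟨n, τ, hτ, -⟩ := exists_isPartition_mesh_le hst one_pos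
    exact ⟨_, n, τ, hτ, rfl⟩
  have h1 : variation r N a u ^ r ≤ variation r N a b ^ r - variation r N u b ^ r := by
    rw [variation_rpow hr h.nonneg a u]
    refine csSup_le (nonempty hau) ?_
    rintro _ ⟨n₁, τ₁, h₁, rfl⟩
    rw [le_sub_comm, variation_rpow hr h.nonneg u b]
    refine csSup_le (nonempty hub) ?_
    rintro _ ⟨n₂, τ₂, h₂, rfl⟩
    obtain ⟨τ, hτ, -, e⟩ := h₁.append_sum (W := ℝ) h₂
    have := hab.sum_le _ _ hτ
    rw [e (fun s t => N s t ^ r)] at this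
    linarith
  linarith

/-- The r-th power of the variation is superadditive in the interval. This turns an estimate by
local variations on each [s,t] into a variation bound on [a,b]. -/
theorem superadd (hr : 0 < r) (h : VarLE r N a b B) :
    VarLE r (fun s t => variation r N s t) a b B := by
  refine ⟨fun s t => variation_nonneg h.nonneg s t, h.bound_nonneg, fun n τ hτ => ?_⟩
  have key : ∀ k ≤ n, ∑ i ∈ Finset.range k, variation r N (τ i) (τ (i + 1)) ^ r ≤
      variation r N (τ 0) (τ k) ^ r := by
    intro k
    induction k with
    | zero => intro _; simpa using Real.rpow_nonneg (variation_nonneg h.nonneg _ _) _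
    | succ k ih =>
      intro hk
      have hτk := hτ.mem k (by omega)
      rw [Finset.sum_range_succ]
      have h1 := ih (by omega)
      have h2 := (h.restrict (s := τ 0) (t := τ (k + 1)) hτ.1.ge (hτ.mem (k + 1) hk).2).variation_add_le
        hr (u := τ k) (hτ.1.le.trans hτk.1) (hτ.2.2 k (by omega)).le
      linarith
  refine (key n le_rfl).trans ?_
  rw [hτ.1, hτ.2.1]
  exact Real.rpow_le_rpow (variation_nonneg h.nonneg a b) (h.variation_le hr) hr.le

theorem of_holder (hr : 0 < r) (hN : ∀ s t, 0 ≤ N s t) {C : ℝ} (hC : 0 ≤ C) (hab : a ≤ b)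
    (h : ∀ s t : ℝ, a ≤ s → s ≤ t → t ≤ b → N s t ≤ C * (t - s) ^ (1 / r)) :
    VarLE r N a b (C * (b - a) ^ (1 / r)) := by
  have pw : ∀ z : ℝ, 0 ≤ z → (C * z ^ (1 / r)) ^ r = C ^ r * z := by
    intro z hz
    rw [Real.mul_rpow hC (Real.rpow_nonneg hz _), ← Real.rpow_mul hz, one_div_mul_cancel hr.ne',
      Real.rpow_one]
  refine ⟨hN, mul_nonneg hC (Real.rpow_nonneg (sub_nonneg.2 hab) _), fun n τ hτ => ?_⟩
  rw [pw _ (sub_nonneg.2 hab)]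
  calc ∑ i ∈ Finset.range n, N (τ i) (τ (i + 1)) ^ r
      ≤ ∑ i ∈ Finset.range n, C ^ r * (τ (i + 1) - τ i) := by
        refine Finset.sum_le_sum fun i hi => ?_
        rw [Finset.mem_range] at hi
        have hlt := (hτ.2.2 i hi).le
        rw [← pw _ (sub_nonneg.2 hlt)]
        exact Real.rpow_le_rpow (hN _ _)
          (h _ _ (hτ.mem i hi.le).1 hlt (hτ.mem (i + 1) hi).2) hr.le
    _ = C ^ r * (b - a) := by rw [← Finset.mul_sum, Finset.sum_range_sub, hτ.1, hτ.2.1]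

end VarLE

/-! ### Hölder objects -/

namespace HolderOnSimplex

variable {β γ a b : ℝ} {N N' : ℝ → ℝ → ℝ}

theorem exists_pos (h : HolderOnSimplex β N a b) :
    ∃ C, 0 < C ∧ ∀ s t : ℝ, a ≤ s → s ≤ t → t ≤ b → N s t ≤ C * (t - s) ^ β := by
  obtain ⟨C, hC⟩ := h
  refine ⟨|C| + 1, by positivity, fun s t has hst htb => (hC s t has hst htb).trans ?_⟩
  exact mul_le_mul_of_nonneg_right (by linarith [le_abs_self C])
    (Real.rpow_nonneg (sub_nonneg.2 hst) _)

theorem varLE {r : ℝ} (hr : 0 < r) (hN : ∀ s t, 0 ≤ N s t) (hab : a ≤ b)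
    (h : HolderOnSimplex (1 / r) N a b) : ∃ B, VarLE r N a b B := by
  obtain ⟨C, hC, h⟩ := h.exists_pos
  exact ⟨_, VarLE.of_holder hr hN hC.le hab h⟩

theorem restrict (h : HolderOnSimplex β N a b) {s t : ℝ} (has : a ≤ s) (htb : t ≤ b) :
    HolderOnSimplex β N s t := by
  obtain ⟨C, hC⟩ := h
  exact ⟨C, fun u v hu huv hv => hC u v (has.trans hu) huv (hv.trans htb)⟩

theorem mono (h : HolderOnSimplex β N a b)
    (hle : ∀ s t, a ≤ s → s ≤ t → t ≤ b → N' s t ≤ N s t) : HolderOnSimplex β N' a b := by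
  obtain ⟨C, hC⟩ := h
  exact ⟨C, fun s t has hst htb => (hle s t has hst htb).trans (hC s t has hst htb)⟩

theorem add (h : HolderOnSimplex β N a b) (h' : HolderOnSimplex β N' a b) :
    HolderOnSimplex β (fun s t => N s t + N' s t) a b := by
  obtain ⟨C, hC⟩ := h
  obtain ⟨C', hC'⟩ := h'
  exact ⟨C + C', fun s t has hst htb => by
    rw [add_mul]; exact add_le_add (hC s t has hst htb) (hC' s t has hst htb)⟩

theorem const_mul (h : HolderOnSimplex β N a b) {c : ℝ} (hc : 0 ≤ c) :
    HolderOnSimplex β (fun s t => c * N s t) a b := by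
  obtain ⟨C, hC⟩ := h
  exact ⟨c * C, fun s t has hst htb => by
    rw [mul_assoc]; exact mul_le_mul_of_nonneg_left (hC s t has hst htb) hc⟩

theorem mul (h : HolderOnSimplex β N a b) (h' : HolderOnSimplex β N' a b) (hβ : 0 < β)
    (hN' : ∀ s t, 0 ≤ N' s t) :
    HolderOnSimplex (2 * β) (fun s t => N s t * N' s t) a b := by
  obtain ⟨C, hC, h⟩ := h.exists_pos
  obtain ⟨C', _, h'⟩ := h'.exists_pos
  refine ⟨C * C', fun s t has hst htb => ?_⟩
  have h0 := sub_nonneg.2 hst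
  calc N s t * N' s t ≤ (C * (t - s) ^ β) * (C' * (t - s) ^ β) :=
        mul_le_mul (h s t has hst htb) (h' s t has hst htb) (hN' s t)
          (mul_nonneg hC.le (Real.rpow_nonneg h0 _))
    _ = C * C' * (t - s) ^ (2 * β) := by
        rw [two_mul, Real.rpow_add_of_nonneg h0 hβ.le hβ.le]; ring

end HolderOnSimplex

/-! ### The projective norm -/

theorem tensorNorm_nonneg {m : ℕ} (T : Euc m ⊗[ℝ] Euc m) : 0 ≤ tensorNorm T := by
  refine Real.sInf_nonneg ?_
  rintro c ⟨k, v, w, _, rfl⟩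
  positivity

section contract

variable {m : ℕ} {W : Type*} [NormedAddCommGroup W] [NormedSpace ℝ W]

theorem contract_tmul (A : Euc m →L[ℝ] Euc m →L[ℝ] W) (v w : Euc m) :
    contract A (v ⊗ₜ[ℝ] w) = A v w := by
  simp [contract]

theorem contract_add_right (A : Euc m →L[ℝ] Euc m →L[ℝ] W) (S T : Euc m ⊗[ℝ] Euc m) :
    contract A (S + T) = contract A S + contract A T := map_add _ _ _

theorem contract_add_left (A A' : Euc m →L[ℝ] Euc m →L[ℝ] W) (T : Euc m ⊗[ℝ] Euc m) :
    contract (A + A') T = contract A T + contract A' T := by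
  induction T with
  | zero => simp [contract]
  | tmul v w => simp [contract_tmul]
  | add S T hS hT => simp only [contract_add_right, hS, hT]; abel

theorem contract_smul_left (c : ℝ) (A : Euc m →L[ℝ] Euc m →L[ℝ] W) (T : Euc m ⊗[ℝ] Euc m) :
    contract (c • A) T = c • contract A T := by
  induction T with
  | zero => simp [contract]
  | tmul v w => simp [contract_tmul]
  | add S T hS hT => simp only [contract_add_right, hS, hT, smul_add]

theorem contract_sub_left (A A' : Euc m →L[ℝ] Euc m →L[ℝ] W) (T : Euc m ⊗[ℝ] Euc m) :
    contract (A - A') T = contract A T - contract A' T := by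
  rw [eq_sub_iff_add_eq, ← contract_add_left, sub_add_cancel]

theorem exists_tensor_representation (T : Euc m ⊗[ℝ] Euc m) :
    ∃ (k : ℕ) (v w : Fin k → Euc m), T = ∑ i, v i ⊗ₜ[ℝ] w i := by
  induction T with
  | zero => exact ⟨0, 0, 0, by simp⟩
  | tmul v w => exact ⟨1, fun _ => v, fun _ => w, by simp⟩
  | add S T hS hT =>
    obtain ⟨k, v, w, rfl⟩ := hS
    obtain ⟨k', v', w', rfl⟩ := hT
    exact ⟨k + k', Fin.append v v', Fin.append w w', by simp [Fin.sum_univ_add]⟩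

/-- Every representation of T as a sum of pure tensors gives such a bound; the infimum over them is
the projective norm. The case ‖A‖ = 0 is separate because the passage to the infimum divides by ‖A‖.
-/
theorem norm_contract_le (A : Euc m →L[ℝ] Euc m →L[ℝ] W) (T : Euc m ⊗[ℝ] Euc m) :
    ‖contract A T‖ ≤ ‖A‖ * tensorNorm T := by
  have key : ∀ c ∈ {c : ℝ | ∃ (k : ℕ) (v w : Fin k → Euc m),
      T = ∑ i, v i ⊗ₜ[ℝ] w i ∧ c = ∑ i, ‖v i‖ * ‖w i‖}, ‖contract A T‖ ≤ ‖A‖ * c := by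
    rintro c ⟨k, v, w, rfl, rfl⟩
    have : contract A (∑ i, v i ⊗ₜ[ℝ] w i) = ∑ i, A (v i) (w i) := by
      simp [contract, map_sum]
    rw [this, Finset.mul_sum]
    refine (norm_sum_le _ _).trans (Finset.sum_le_sum fun i _ => ?_)
    rw [← mul_assoc]
    exact A.le_opNorm₂ _ _
  obtain ⟨k, v, w, hT⟩ := exists_tensor_representation T
  rcases (norm_nonneg A).eq_or_lt with h0 | h0
  · have := key _ ⟨k, v, w, hT, rfl⟩
    rw [← h0, zero_mul] at this ⊢
    exact this
  · rw [← div_le_iff₀' h0]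
    refine le_csInf ⟨_, k, v, w, hT, rfl⟩ fun c hc => ?_
    rw [div_le_iff₀' h0]
    exact key c hc

end contract

/-! ### The basic estimate for rough integrals -/

section sewing

variable {W : Type*} [NormedAddCommGroup W]

/-- The interior point `τ (j + 1)` is deleted; the sum changes by the additivity defect of Ξ there.
-/
theorem IsPartition.remove {s t : ℝ} {n j : ℕ} {τ : ℕ → ℝ} (h : IsPartition s t (n + 2) τ)
    (hj : j ≤ n) (Ξ : ℝ → ℝ → W) :
    ∃ τ', IsPartition s t (n + 1) τ' ∧
      ∑ i ∈ Finset.range (n + 2), Ξ (τ i) (τ (i + 1)) =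
        ∑ i ∈ Finset.range (n + 1), Ξ (τ' i) (τ' (i + 1)) -
          (Ξ (τ j) (τ (j + 2)) - Ξ (τ j) (τ (j + 1)) - Ξ (τ (j + 1)) (τ (j + 2))) := by
  obtain ⟨l, rfl⟩ := Nat.exists_eq_add_of_le hj
  have lo : ∀ i ≤ j, (fun i => if i ≤ j then τ i else τ (i + 1)) i = τ i := by
    intro i hi; simp [hi]
  have hi' : ∀ i, j < i → (fun i => if i ≤ j then τ i else τ (i + 1)) i = τ (i + 1) := by
    intro i hi; simp [not_le.2 hi]
  refine ⟨fun i => if i ≤ j then τ i else τ (i + 1), ⟨?_, ?_, ?_⟩, ?_⟩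
  · rw [lo 0 (Nat.zero_le _), h.1]
  · rw [hi' _ (by omega), h.2.1]
  · intro i hi
    rcases lt_trichotomy i j with hij | rfl | hij
    · rw [lo i hij.le, lo (i + 1) hij]; exact h.2.2 i (by omega)
    · rw [lo i le_rfl, hi' (i + 1) (by omega)]
      exact (h.2.2 i (by omega)).trans (h.2.2 (i + 1) (by omega))
    · rw [hi' i hij, hi' (i + 1) (by omega)]; exact h.2.2 (i + 1) (by omega)
  · rw [show j + l + 2 = j + 1 + 1 + l by ring, show j + l + 1 = j + 1 + l by ring,
      Finset.sum_range_add, Finset.sum_range_succ, Finset.sum_range_succ, Finset.sum_range_add,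
      Finset.sum_range_succ]
    have e1 : ∑ i ∈ Finset.range j, Ξ ((fun i => if i ≤ j then τ i else τ (i + 1)) i)
        ((fun i => if i ≤ j then τ i else τ (i + 1)) (i + 1)) =
        ∑ i ∈ Finset.range j, Ξ (τ i) (τ (i + 1)) := by
      refine Finset.sum_congr rfl fun i hi => ?_
      rw [Finset.mem_range] at hi
      rw [lo i hi.le, lo (i + 1) hi]
    have e2 : ∑ i ∈ Finset.range l,
        Ξ ((fun i => if i ≤ j then τ i else τ (i + 1)) (j + 1 + i))
          ((fun i => if i ≤ j then τ i else τ (i + 1)) (j + 1 + i + 1)) =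
        ∑ i ∈ Finset.range l, Ξ (τ (j + 1 + 1 + i)) (τ (j + 1 + 1 + i + 1)) := by
      refine Finset.sum_congr rfl fun i hi => ?_
      rw [hi' _ (by omega), hi' _ (by omega), show j + 1 + i + 1 = j + 1 + 1 + i by ring]
    rw [e1, e2, lo j le_rfl, hi' (j + 1) (by omega)]
    abel

/-- For A = 0 the quotient is zero by convention and says nothing; N ≤ A covers that case. -/
theorem le_mul_rpow_of_div_le {r N A κ : ℝ} (hr : 0 < r) (hN : 0 ≤ N) (hNA : N ≤ A) (hκ : 0 ≤ κ)
    (h : N ^ r / A ^ r ≤ κ) : N ≤ A * κ ^ (1 / r) := by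
  have hA : 0 ≤ A := hN.trans hNA
  rcases hA.eq_or_lt with rfl | hA'
  · simpa using hNA
  · rw [div_le_iff₀ (Real.rpow_pos_of_pos hA' _)] at h
    have := Real.rpow_le_rpow (Real.rpow_nonneg hN _) h (one_div_nonneg.2 hr.le)
    rw [← Real.rpow_mul hN, Real.mul_rpow hκ (Real.rpow_nonneg hA _), ← Real.rpow_mul hA,
      mul_one_div_cancel hr.ne', Real.rpow_one, Real.rpow_one] at this
    linarith

/-- Young's estimate for the Riemann sums of an almost additive two-parameter function. -/
theorem norm_sum_sub_le_of_varLE {p q s t A B A' B' : ℝ} (hp : 0 < p) (hq : 0 < q)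
    {N₁ N₂ N₃ N₄ : ℝ → ℝ → ℝ} (h₁ : VarLE p N₁ s t A) (h₂ : VarLE q N₂ s t B)
    (h₃ : VarLE p N₃ s t A') (h₄ : VarLE q N₄ s t B') {Ξ : ℝ → ℝ → W}
    (hΞ : ∀ u v w : ℝ, s ≤ u → u < v → v < w → w ≤ t →
      ‖Ξ u w - Ξ u v - Ξ v w‖ ≤ N₂ u v * N₁ v w + N₃ u v * N₄ v w) :
    ∀ (n : ℕ) (τ : ℕ → ℝ), IsPartition s t (n + 1) τ →
      ‖∑ i ∈ Finset.range (n + 1), Ξ (τ i) (τ (i + 1)) - Ξ s t‖ ≤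
        (∑ k ∈ Finset.range n, (4 / (k + 1 : ℝ)) ^ (1 / p + 1 / q)) * (A * B + A' * B') := by
  intro n
  induction n with
  | zero =>
    intro τ hτ
    have h0 := hτ.1
    have h1 := hτ.2.1
    simp only [zero_add] at h1
    simp [h0, h1]
  | succ n ih =>
    intro τ hτ
    set κ : ℝ := 4 / (n + 1 : ℝ) with hκ
    have hκ0 : 0 < κ := by positivity
    have shift : ∀ (N : ℝ → ℝ → ℝ) (r D : ℝ), VarLE r N s t D →
        ∑ j ∈ Finset.range (n + 1), N (τ j) (τ (j + 1)) ^ r / D ^ r ≤ 1 ∧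
        ∑ j ∈ Finset.range (n + 1), N (τ (j + 1)) (τ (j + 2)) ^ r / D ^ r ≤ 1 := by
      intro N r D hN
      have hs := hN.sum_le _ _ hτ
      have hD := Real.rpow_nonneg hN.bound_nonneg r
      have h1 := hs
      rw [Finset.sum_range_succ] at h1
      have h2 := hs
      rw [Finset.sum_range_succ'] at h2
      have p1 := Real.rpow_nonneg (hN.nonneg (τ (n + 1)) (τ (n + 1 + 1))) r
      have p2 := Real.rpow_nonneg (hN.nonneg (τ 0) (τ (0 + 1))) r
      rw [← Finset.sum_div, ← Finset.sum_div]
      exact ⟨div_le_one_of_le₀ (by linarith) hD, div_le_one_of_le₀ (by linarith) hD⟩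
    -- Each of the four normalized sums is at most 1, so at one of the n + 1 interior points their
    -- joint contribution is at most the average 4/(n + 1). The four factors are then small at the
    -- same point.
    obtain ⟨j, hj, hjκ⟩ := Finset.exists_le_of_sum_le (s := Finset.range (n + 1))
      (f := fun j => N₁ (τ (j + 1)) (τ (j + 2)) ^ p / A ^ p + N₂ (τ j) (τ (j + 1)) ^ q / B ^ q +
        N₃ (τ j) (τ (j + 1)) ^ p / A' ^ p + N₄ (τ (j + 1)) (τ (j + 2)) ^ q / B' ^ q)
      (g := fun _ => κ) ⟨0, by simp⟩ (by
        rw [Finset.sum_add_distrib, Finset.sum_add_distrib, Finset.sum_add_distrib]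
        have e : ∑ _j ∈ Finset.range (n + 1), κ = 4 := by
          rw [Finset.sum_const, Finset.card_range, nsmul_eq_mul, hκ]; push_cast; field_simp
        rw [e]
        linarith [(shift _ _ _ h₁).2, (shift _ _ _ h₂).1, (shift _ _ _ h₃).1, (shift _ _ _ h₄).2])
    rw [Finset.mem_range] at hj
    obtain ⟨τ', hτ', hsum⟩ := hτ.remove (j := j) (by omega) Ξ
    have m0 := hτ.mem j (by omega)
    have m2 := hτ.mem (j + 2) (by omega)
    have l0 := hτ.2.2 j (by omega)
    have l1 := hτ.2.2 (j + 1) (by omega)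
    have m1 := hτ.mem (j + 1) (by omega)
    have q1 : 0 ≤ N₁ (τ (j + 1)) (τ (j + 2)) ^ p / A ^ p :=
      div_nonneg (Real.rpow_nonneg (h₁.nonneg _ _) _) (Real.rpow_nonneg h₁.bound_nonneg _)
    have q2 : 0 ≤ N₂ (τ j) (τ (j + 1)) ^ q / B ^ q :=
      div_nonneg (Real.rpow_nonneg (h₂.nonneg _ _) _) (Real.rpow_nonneg h₂.bound_nonneg _)
    have q3 : 0 ≤ N₃ (τ j) (τ (j + 1)) ^ p / A' ^ p :=
      div_nonneg (Real.rpow_nonneg (h₃.nonneg _ _) _) (Real.rpow_nonneg h₃.bound_nonneg _)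
    have q4 : 0 ≤ N₄ (τ (j + 1)) (τ (j + 2)) ^ q / B' ^ q :=
      div_nonneg (Real.rpow_nonneg (h₄.nonneg _ _) _) (Real.rpow_nonneg h₄.bound_nonneg _)
    have b1 := le_mul_rpow_of_div_le hp (h₁.nonneg _ _) (h₁.le hp m1.1 l1 m2.2) hκ0.le
      (by linarith)
    have b2 := le_mul_rpow_of_div_le hq (h₂.nonneg _ _) (h₂.le hq m0.1 l0 m1.2) hκ0.le
      (by linarith)
    have b3 := le_mul_rpow_of_div_le hp (h₃.nonneg _ _) (h₃.le hp m0.1 l0 m1.2) hκ0.le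
      (by linarith)
    have b4 := le_mul_rpow_of_div_le hq (h₄.nonneg _ _) (h₄.le hq m1.1 l1 m2.2) hκ0.le
      (by linarith)
    have hB := h₂.bound_nonneg
    have hA' := h₃.bound_nonneg
    have step : ‖Ξ (τ j) (τ (j + 2)) - Ξ (τ j) (τ (j + 1)) - Ξ (τ (j + 1)) (τ (j + 2))‖ ≤
        κ ^ (1 / p + 1 / q) * (A * B + A' * B') := by
      refine (hΞ _ _ _ m0.1 l0 l1 m2.2).trans ?_
      have c1 := mul_le_mul b2 b1 (h₁.nonneg _ _) (mul_nonneg hB (Real.rpow_nonneg hκ0.le _))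
      have c2 := mul_le_mul b3 b4 (h₄.nonneg _ _) (mul_nonneg hA' (Real.rpow_nonneg hκ0.le _))
      refine (add_le_add c1 c2).trans (le_of_eq ?_)
      rw [Real.rpow_add hκ0]; ring
    have hrec := ih τ' hτ'
    rw [hsum, Finset.sum_range_succ (fun k : ℕ => (4 / (k + 1 : ℝ)) ^ (1 / p + 1 / q)), add_mul]
    calc _ = ‖(∑ i ∈ Finset.range (n + 1), Ξ (τ' i) (τ' (i + 1)) - Ξ s t) -
          (Ξ (τ j) (τ (j + 2)) - Ξ (τ j) (τ (j + 1)) - Ξ (τ (j + 1)) (τ (j + 2)))‖ := by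
            congr 1; abel
      _ ≤ _ := (norm_sub_le _ _).trans (add_le_add hrec step)

end sewing

namespace IsRoughPath

variable {m : ℕ} {α a b : ℝ} {x : ℝ → Euc m} {X : ℝ → ℝ → Euc m ⊗[ℝ] Euc m}

theorem restrict (h : IsRoughPath α a b x X) {s t : ℝ} (has : a ≤ s) (htb : t ≤ b) :
    IsRoughPath α s t x X :=
  ⟨h.holder_path.restrict has htb, h.holder_area.restrict has htb,
    fun u v w hu huv hvw hw => h.chen u v w (has.trans hu) huv hvw (hw.trans htb)⟩

theorem area_self (h : IsRoughPath α a b x X) {s : ℝ} (has : a ≤ s) (hsb : s ≤ b) : X s s = 0 := by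
  have := h.chen s s s has le_rfl le_rfl hsb
  simpa using this

theorem area_eq (h : IsRoughPath α a b x X) {s u t : ℝ} (has : a ≤ s) (hsu : s ≤ u) (hut : u ≤ t)
    (htb : t ≤ b) : X s t = X s u + X u t + (x u - x s) ⊗ₜ[ℝ] (x t - x u) := by
  rw [← h.chen s u t has hsu hut htb]; abel

variable {W : Type*} [NormedAddCommGroup W] [NormedSpace ℝ W]

theorem localIncrement_self (h : IsRoughPath α a b x X) {s : ℝ} (has : a ≤ s) (hsb : s ≤ b)
    (y : ℝ → Euc m →L[ℝ] W) (y' : ℝ → Euc m →L[ℝ] Euc m →L[ℝ] W) :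
    localIncrement x X y y' s s = 0 := by
  simp [localIncrement, h.area_self has hsb, contract]

/-- The cross term in Chen's relation contributes y'_s x_{s,u} x_{u,t}, exactly what completes y_u -
y_s to the remainder of y. -/
theorem localIncrement_sub (h : IsRoughPath α a b x X) {s u t : ℝ} (has : a ≤ s) (hsu : s ≤ u)
    (hut : u ≤ t) (htb : t ≤ b) (y : ℝ → Euc m →L[ℝ] W)
    (y' : ℝ → Euc m →L[ℝ] Euc m →L[ℝ] W) :
    localIncrement x X y y' s t - localIncrement x X y y' s u - localIncrement x X y y' u t =
      -(remainder x y y' s u (x t - x u) + contract (y' u - y' s) (X u t)) := by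
  simp only [localIncrement, remainder, h.area_eq has hsu hut htb, contract_add_right,
    contract_tmul, contract_sub_left, sub_apply]
  have : x t - x s = (x t - x u) + (x u - x s) := by abel
  rw [this, map_add]
  abel

theorem norm_localIncrement_sub_le (h : IsRoughPath α a b x X) {s u t : ℝ} (has : a ≤ s)
    (hsu : s ≤ u) (hut : u ≤ t) (htb : t ≤ b) (y : ℝ → Euc m →L[ℝ] W)
    (y' : ℝ → Euc m →L[ℝ] Euc m →L[ℝ] W) :
    ‖localIncrement x X y y' s t - localIncrement x X y y' s u - localIncrement x X y y' u t‖ ≤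
      ‖remainder x y y' s u‖ * ‖x t - x u‖ + ‖y' u - y' s‖ * tensorNorm (X u t) := by
  rw [h.localIncrement_sub has hsu hut htb, norm_neg]
  exact (norm_add_le _ _).trans
    (add_le_add (ContinuousLinearMap.le_opNorm _ _) (norm_contract_le _ _))

end IsRoughPath

theorem one_div_half_inv {α : ℝ} : 1 / (1 / α / 2) = 2 * α := by
  simp

theorem HolderOnSimplex.exists_varLE {α a b : ℝ} (hα : 0 < α) {N : ℝ → ℝ → ℝ}
    (hN : ∀ s t, 0 ≤ N s t) (hab : a ≤ b) (h : HolderOnSimplex α N a b) :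
    ∃ B, VarLE (1 / α) N a b B :=
  HolderOnSimplex.varLE (by positivity) hN hab (by rwa [one_div_one_div])

theorem HolderOnSimplex.exists_varLE_half {α a b : ℝ} (hα : 0 < α) {N : ℝ → ℝ → ℝ}
    (hN : ∀ s t, 0 ≤ N s t) (hab : a ≤ b) (h : HolderOnSimplex (2 * α) N a b) :
    ∃ B, VarLE (1 / α / 2) N a b B :=
  HolderOnSimplex.varLE (by positivity) hN hab (by rwa [one_div_half_inv])

theorem summable_young {θ : ℝ} (hθ : 1 < θ) : Summable fun k : ℕ => (4 / (k + 1 : ℝ)) ^ θ := by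
  have h := (summable_nat_add_iff 1).2 (Real.summable_one_div_nat_rpow.2 hθ)
  refine (h.mul_left ((4 : ℝ) ^ θ)).congr fun k => ?_
  rw [Real.div_rpow (by norm_num) (by positivity)]
  push_cast
  ring

theorem exists_isRoughIntegralConstant {α : ℝ} (hα : 1 / 3 < α) :
    ∃ C : ℝ, 1 < C ∧ ∀ m d : ℕ, IsRoughIntegralConstant α m d C := by
  have hα0 : 0 < α := by linarith
  have hp : 0 < 1 / α := by positivity
  have hq : 0 < 1 / α / 2 := by positivity
  -- The exponent is α + 2α; it exceeds 1 because α > 1/3.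
  have hθ : 1 < 1 / (1 / α) + 1 / (1 / α / 2) := by
    rw [one_div_half_inv, one_div_one_div]; linarith
  set Z := ∑' k : ℕ, (4 / (k + 1 : ℝ)) ^ (1 / (1 / α) + 1 / (1 / α / 2)) with hZ
  have hZ0 : 0 ≤ Z := tsum_nonneg fun k => by positivity
  -- The estimate itself holds with Z; the summand 2 only secures a constant above 1.
  refine ⟨Z + 2, by linarith, ?_⟩
  intro m d a b x X hX y y' hy s t has hst htb I hI
  obtain ⟨_, v1⟩ := (hX.holder_path.restrict has htb).exists_varLE hα0
    (fun _ _ => norm_nonneg _) hst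
  obtain ⟨_, v2⟩ := (hy.holder_remainder.restrict has htb).exists_varLE_half hα0
    (fun _ _ => norm_nonneg _) hst
  obtain ⟨_, v3⟩ := (hy.holder_deriv.restrict has htb).exists_varLE hα0
    (fun _ _ => norm_nonneg _) hst
  obtain ⟨_, v4⟩ := (hX.holder_area.restrict has htb).exists_varLE_half hα0
    (fun _ _ => tensorNorm_nonneg _) hst
  have key := norm_sum_sub_le_of_varLE hp hq (v1.self hp) (v2.self hq) (v3.self hp) (v4.self hq)
    (Ξ := localIncrement x X y y') (fun u v w hu huv hvw hw =>
      hX.norm_localIncrement_sub_le (has.trans hu) huv.le hvw.le (hw.trans htb) y y')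
  change _ ≤ (Z + 2) * (variation _ _ _ _ * variation _ _ _ _ +
    variation _ _ _ _ * variation _ _ _ _)
  have hV : 0 ≤ variation (1 / α) (fun s t => ‖x t - x s‖) s t *
      variation (1 / α / 2) (fun s t => ‖remainder x y y' s t‖) s t +
      variation (1 / α) (fun s t => ‖y' t - y' s‖) s t *
        variation (1 / α / 2) (fun s t => tensorNorm (X s t)) s t :=
    add_nonneg (mul_nonneg (v1.self hp).bound_nonneg (v2.self hq).bound_nonneg)
      (mul_nonneg (v3.self hp).bound_nonneg (v4.self hq).bound_nonneg)
  set V := variation (1 / α) (fun s t => ‖x t - x s‖) s t *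
      variation (1 / α / 2) (fun s t => ‖remainder x y y' s t‖) s t +
      variation (1 / α) (fun s t => ‖y' t - y' s‖) s t *
        variation (1 / α / 2) (fun s t => tensorNorm (X s t)) s t
  refine le_of_forall_pos_le_add fun ε hε => ?_
  -- Young's bound does not depend on the partition, so one Riemann sum within ε of the integral
  -- suffices.
  obtain ⟨δ, hδ, hI⟩ := hI ε hε
  obtain ⟨n, τ, hτ, hmesh⟩ := exists_isPartition_mesh_le hst hδ
  have hsum : ‖∑ i ∈ Finset.range n, localIncrement x X y y' (τ i) (τ (i + 1)) -
      localIncrement x X y y' s t‖ ≤ Z * V := by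
    rcases n with - | n
    · have : s = t := hτ.1.symm.trans hτ.2.1
      subst this
      simpa [hX.localIncrement_self has htb] using mul_nonneg hZ0 hV
    · exact (key n τ hτ).trans (mul_le_mul_of_nonneg_right
        ((summable_young hθ).sum_le_tsum _ fun k _ => by positivity) hV)
  have e : I - y s (x t - x s) - contract (y' s) (X s t) =
      (∑ i ∈ Finset.range n, localIncrement x X y y' (τ i) (τ (i + 1)) -
        localIncrement x X y y' s t) -
      (∑ i ∈ Finset.range n, localIncrement x X y y' (τ i) (τ (i + 1)) - I) := by
    simp only [localIncrement]; abel
  rw [e]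
  refine (norm_sub_le _ _).trans ((add_le_add hsum (hI n τ hτ hmesh)).trans ?_)
  linarith [add_mul Z 2 V]

/-! ### Taylor estimates -/

section taylor

variable {E F : Type*} [NormedAddCommGroup E] [NormedSpace ℝ E] [NormedAddCommGroup F]
  [NormedSpace ℝ F] {f : E → F} {L₁ L₂ L₃ : ℝ}

theorem norm_sub_le_of_norm_hasDerivAt_le {G : ℝ → F} {G' : ℝ → F} {C : ℝ}
    (hG : ∀ η, HasDerivAt G (G' η) η) (hC : ∀ η, 0 ≤ η → η ≤ 1 → ‖G' η‖ ≤ C) :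
    ‖G 1 - G 0‖ ≤ C :=
  norm_image_sub_le_of_norm_deriv_le_segment_01' (fun η _ => (hG η).hasDerivWithinAt)
    fun η hη => hC η hη.1 hη.2.le

theorem hasDerivAt_comp_line (hf : Differentiable ℝ f) (y v : E) (η : ℝ) :
    HasDerivAt (fun η : ℝ => f (y + η • v)) (fderiv ℝ f (y + η • v) v) η := by
  have h1 : HasDerivAt (fun η : ℝ => y + η • v) v η := by
    simpa using ((hasDerivAt_id η).smul_const v).const_add y
  exact (hf (y + η • v)).hasFDerivAt.comp_hasDerivAt η h1

theorem norm_smul_le_of_le_one {η : ℝ} (h0 : 0 ≤ η) (h1 : η ≤ 1) (v : E) : ‖η • v‖ ≤ ‖v‖ := by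
  rw [norm_smul, Real.norm_of_nonneg h0]
  exact mul_le_of_le_one_left (norm_nonneg v) h1

theorem norm_apply_le {A : E →L[ℝ] F} {c : ℝ} (h : ‖A‖ ≤ c) (v : E) : ‖A v‖ ≤ c * ‖v‖ :=
  A.le_of_opNorm_le h v

theorem norm_sub_le_of_norm_fderiv_le (hf : Differentiable ℝ f) (h₁ : ∀ y, ‖fderiv ℝ f y‖ ≤ L₁)
    (y z : E) : ‖f y - f z‖ ≤ L₁ * ‖y - z‖ :=
  convex_univ.norm_image_sub_le_of_norm_fderiv_le (fun w _ => hf w) (fun w _ => h₁ w)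
    (Set.mem_univ z) (Set.mem_univ y)

/-- Here w replaces the true increment v in the linear term. For v = φ_{s,t} and w = g(φ_s) x_{s,t}
the difference v - w is R^φ. -/
theorem norm_taylor_le (hf : Differentiable ℝ f) (h₁ : ∀ y, ‖fderiv ℝ f y‖ ≤ L₁)
    (h₂ : ∀ y z, ‖fderiv ℝ f y - fderiv ℝ f z‖ ≤ L₂ * ‖y - z‖) (hL₂ : 0 ≤ L₂) (y v w : E) :
    ‖f (y + v) - f y - fderiv ℝ f y w‖ ≤ L₁ * ‖v - w‖ + L₂ * ‖v‖ * ‖w‖ := by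
  have hG : ∀ η : ℝ, HasDerivAt (fun η : ℝ => f (y + η • v) - η • fderiv ℝ f y w)
      (fderiv ℝ f (y + η • v) (v - w) + (fderiv ℝ f (y + η • v) - fderiv ℝ f y) w) η := by
    intro η
    have h := (hasDerivAt_comp_line hf y v η).sub ((hasDerivAt_id η).smul_const (fderiv ℝ f y w))
    refine h.congr_deriv ?_
    simp only [map_sub, sub_apply, one_smul]
    abel
  have key := norm_sub_le_of_norm_hasDerivAt_le (C := L₁ * ‖v - w‖ + L₂ * ‖v‖ * ‖w‖) hG (by
    intro η h0 h1
    refine (norm_add_le _ _).trans (add_le_add (norm_apply_le (h₁ _) _) (norm_apply_le ?_ _))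
    refine (h₂ _ _).trans (mul_le_mul_of_nonneg_left ?_ hL₂)
    rw [add_sub_cancel_left]
    exact norm_smul_le_of_le_one h0 h1 v)
  simp only [one_smul, zero_smul, add_zero, sub_zero] at key
  rwa [sub_right_comm]

/-- Move along the segments from y₁ to z₁ and from y₂ to z₂ simultaneously and compare the
derivatives. -/
theorem norm_four_point_le (hf : Differentiable ℝ f) (h₁ : ∀ y, ‖fderiv ℝ f y‖ ≤ L₁)
    (h₂ : ∀ y z, ‖fderiv ℝ f y - fderiv ℝ f z‖ ≤ L₂ * ‖y - z‖) (hL₂ : 0 ≤ L₂)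
    (y₁ y₂ z₁ z₂ : E) :
    ‖(f z₂ - f y₂) - (f z₁ - f y₁)‖ ≤ L₁ * ‖(z₂ - y₂) - (z₁ - y₁)‖ +
      L₂ * (‖y₂ - y₁‖ + ‖z₂ - z₁‖) * ‖z₁ - y₁‖ := by
  have hG : ∀ η : ℝ, HasDerivAt
      (fun η : ℝ => f (y₂ + η • (z₂ - y₂)) - f (y₁ + η • (z₁ - y₁)))
      (fderiv ℝ f (y₂ + η • (z₂ - y₂)) ((z₂ - y₂) - (z₁ - y₁)) +
        (fderiv ℝ f (y₂ + η • (z₂ - y₂)) - fderiv ℝ f (y₁ + η • (z₁ - y₁))) (z₁ - y₁)) η := by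
    intro η
    refine ((hasDerivAt_comp_line hf y₂ _ η).sub (hasDerivAt_comp_line hf y₁ _ η)).congr_deriv ?_
    rw [map_sub (fderiv ℝ f (y₂ + η • (z₂ - y₂))) (z₂ - y₂) (z₁ - y₁), sub_apply]
    abel
  have key := norm_sub_le_of_norm_hasDerivAt_le (C := L₁ * ‖(z₂ - y₂) - (z₁ - y₁)‖ +
      L₂ * (‖y₂ - y₁‖ + ‖z₂ - z₁‖) * ‖z₁ - y₁‖) hG (by
    intro η h0 h1
    refine (norm_add_le _ _).trans (add_le_add (norm_apply_le (h₁ _) _) (norm_apply_le ?_ _))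
    refine (h₂ _ _).trans (mul_le_mul_of_nonneg_left ?_ hL₂)
    have e : y₂ + η • (z₂ - y₂) - (y₁ + η • (z₁ - y₁)) =
        (1 - η) • (y₂ - y₁) + η • (z₂ - z₁) := by module
    rw [e]
    exact (norm_add_le _ _).trans (add_le_add
      (norm_smul_le_of_le_one (by linarith) (by linarith) _) (norm_smul_le_of_le_one h0 h1 _)))
  simp only [one_smul, zero_smul, add_zero, add_sub_cancel] at key
  rwa [sub_sub_sub_comm]

/-- Compares the expansions of `norm_taylor_le` at two base points. The two bounds by M at the
endpoints pass to the whole segment by convexity. -/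
theorem norm_taylor_sub_taylor_le (hf : Differentiable ℝ f) (hf' : Differentiable ℝ (fderiv ℝ f))
    (h₁ : ∀ y, ‖fderiv ℝ f y‖ ≤ L₁) (h₂ : ∀ y, ‖fderiv ℝ (fderiv ℝ f) y‖ ≤ L₂)
    (h₃ : ∀ y z, ‖fderiv ℝ (fderiv ℝ f) y - fderiv ℝ (fderiv ℝ f) z‖ ≤ L₃ * ‖y - z‖)
    (hL₂ : 0 ≤ L₂) (hL₃ : 0 ≤ L₃) (y v w z u t : E) {M : ℝ} (hM : ‖z - y‖ ≤ M)
    (hM' : ‖(z + u) - (y + v)‖ ≤ M) :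
    ‖(f (z + u) - f z - fderiv ℝ f z t) - (f (y + v) - f y - fderiv ℝ f y w)‖ ≤
      L₁ * ‖(u - t) - (v - w)‖ + L₂ * M * ‖v - w‖ + L₂ * ‖u‖ * ‖t - w‖ +
        (L₂ * ‖u - v‖ + L₃ * (‖v‖ + ‖u‖) * M) * ‖w‖ := by
  have hG : ∀ η : ℝ, HasDerivAt
      (fun η : ℝ => (f (z + η • u) - η • fderiv ℝ f z t) - (f (y + η • v) - η • fderiv ℝ f y w))
      (fderiv ℝ f (z + η • u) ((u - t) - (v - w)) +
        (fderiv ℝ f (z + η • u) - fderiv ℝ f (y + η • v)) (v - w) +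
        (fderiv ℝ f (z + η • u) - fderiv ℝ f z) (t - w) +
        ((fderiv ℝ f (z + η • u) - fderiv ℝ f (y + η • v)) - (fderiv ℝ f z - fderiv ℝ f y)) w)
      η := by
    intro η
    refine (((hasDerivAt_comp_line hf z u η).sub
      ((hasDerivAt_id η).smul_const (fderiv ℝ f z t))).sub
      ((hasDerivAt_comp_line hf y v η).sub
      ((hasDerivAt_id η).smul_const (fderiv ℝ f y w)))).congr_deriv ?_
    simp only [map_sub, sub_apply, one_smul]
    abel
  have lip := norm_sub_le_of_norm_fderiv_le hf' h₂
  have key := norm_sub_le_of_norm_hasDerivAt_le (C := L₁ * ‖(u - t) - (v - w)‖ +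
      L₂ * M * ‖v - w‖ + L₂ * ‖u‖ * ‖t - w‖ +
        (L₂ * ‖u - v‖ + L₃ * (‖v‖ + ‖u‖) * M) * ‖w‖) hG (by
    intro η h0 h1
    have hM0 : 0 ≤ M := (norm_nonneg _).trans hM
    refine (norm_add_le _ _).trans (add_le_add ((norm_add_le _ _).trans (add_le_add
      ((norm_add_le _ _).trans (add_le_add (norm_apply_le (h₁ _) _) (norm_apply_le ?_ _)))
      (norm_apply_le ?_ _))) (norm_apply_le ?_ _))
    · refine (lip _ _).trans (mul_le_mul_of_nonneg_left ?_ hL₂)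
      have e : z + η • u - (y + η • v) =
          (1 - η) • (z - y) + η • ((z + u) - (y + v)) := by module
      rw [e]
      refine (norm_add_le _ _).trans ?_
      rw [norm_smul, norm_smul, Real.norm_of_nonneg h0, Real.norm_of_nonneg (by linarith)]
      nlinarith
    · refine (lip _ _).trans (mul_le_mul_of_nonneg_left ?_ hL₂)
      rw [add_sub_cancel_left]
      exact norm_smul_le_of_le_one h0 h1 u
    · refine (norm_four_point_le hf' h₂ h₃ hL₃ _ _ _ _).trans (add_le_add
        (mul_le_mul_of_nonneg_left ?_ hL₂) (mul_le_mul (mul_le_mul_of_nonneg_left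
          (add_le_add ?_ ?_) hL₃) hM (norm_nonneg _) (by positivity)))
      · have e : z + η • u - (y + η • v) - (z - y) = η • (u - v) := by module
        rw [e]
        exact norm_smul_le_of_le_one h0 h1 _
      · rw [add_sub_cancel_left]; exact norm_smul_le_of_le_one h0 h1 _
      · rw [add_sub_cancel_left]; exact norm_smul_le_of_le_one h0 h1 _)
  simp only [one_smul, zero_smul, add_zero, sub_zero] at key
  have e : (f (z + u) - f z - fderiv ℝ f z t) - (f (y + v) - f y - fderiv ℝ f y w) =
      f (z + u) - fderiv ℝ f z t - (f (y + v) - fderiv ℝ f y w) - (f z - f y) := by abel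
  rwa [e]

end taylor

/-! ### Bounds for the coefficient -/

/-- The vector field `v ↦ Dg(y)[g(y) v]`. -/
noncomputable def fieldDeriv {m d : ℕ} (g : Euc d → Euc m →L[ℝ] Euc d) (y : Euc d) :
    Euc m →L[ℝ] Euc m →L[ℝ] Euc d :=
  (fderiv ℝ g y).comp (g y)

theorem supD_nonneg {m d : ℕ} (g : Euc d → Euc m →L[ℝ] Euc d) (k : ℕ) : 0 ≤ supD g k :=
  Real.iSup_nonneg fun _ => norm_nonneg _

theorem Cg_nonneg {m d : ℕ} (g : Euc d → Euc m →L[ℝ] Euc d) : 0 ≤ Cg g :=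
  (supD_nonneg g 1).trans (le_max_left _ _)

theorem supD_one_le {m d : ℕ} (g : Euc d → Euc m →L[ℝ] Euc d) : supD g 1 ≤ Cg g :=
  le_max_left _ _

theorem le_sq_of_sqrt_le {A C : ℝ} (hC : 0 ≤ C) (h : √A ≤ C) : A ≤ C ^ 2 :=
  (Real.sqrt_le_left hC).1 h

theorem le_cube_of_rpow_le {A C : ℝ} (hA : 0 ≤ A) (h : A ^ (1 / 3 : ℝ) ≤ C) : A ≤ C ^ 3 := by
  have := pow_le_pow_left₀ (Real.rpow_nonneg hA _) h 3
  rwa [← Real.rpow_natCast, ← Real.rpow_mul hA, show (1 / 3 : ℝ) * (3 : ℕ) = 1 by norm_num,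
    Real.rpow_one] at this

/-- The form in which C_g enters the estimates. The norms of D²g and D³g are controlled only after
multiplication by a power of ‖g‖_∞. -/
theorem supD_mul_le {m d : ℕ} (g : Euc d → Euc m →L[ℝ] Euc d) :
    supD g 1 * supD g 0 ≤ Cg g ^ 2 ∧ supD g 2 * supD g 0 ≤ Cg g ^ 2 ∧
    supD g 3 * supD g 0 ≤ Cg g ^ 2 ∧ supD g 2 * supD g 0 ^ 2 ≤ Cg g ^ 3 ∧
    supD g 3 * supD g 0 ^ 2 ≤ Cg g ^ 3 := by
  have h0 := Cg_nonneg g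
  refine ⟨le_sq_of_sqrt_le h0 ?_, le_sq_of_sqrt_le h0 ?_, le_sq_of_sqrt_le h0 ?_,
    le_cube_of_rpow_le (mul_nonneg (supD_nonneg g 2) (sq_nonneg _)) ?_,
    le_cube_of_rpow_le (mul_nonneg (supD_nonneg g 3) (sq_nonneg _)) ?_⟩ <;> simp [Cg]

namespace IsCb3

variable {m d : ℕ} {g : Euc d → Euc m →L[ℝ] Euc d}

theorem norm_iteratedFDeriv_le (hg : IsCb3 g) {k : ℕ} (hk : k ≤ 3) (y : Euc d) :
    ‖iteratedFDeriv ℝ k g y‖ ≤ supD g k := by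
  obtain ⟨C, hC⟩ := hg.2 k hk
  exact le_ciSup (f := fun y => ‖iteratedFDeriv ℝ k g y‖) ⟨C, by rintro _ ⟨y, rfl⟩; exact hC y⟩ y

theorem norm_le (hg : IsCb3 g) (y : Euc d) : ‖g y‖ ≤ supD g 0 := by
  simpa using hg.norm_iteratedFDeriv_le (k := 0) (by norm_num) y

theorem norm_fderiv_le (hg : IsCb3 g) (y : Euc d) : ‖fderiv ℝ g y‖ ≤ supD g 1 := by
  rw [← norm_iteratedFDeriv_one]
  exact hg.norm_iteratedFDeriv_le (by norm_num) y

theorem norm_fderiv_fderiv_le (hg : IsCb3 g) (y : Euc d) :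
    ‖fderiv ℝ (fderiv ℝ g) y‖ ≤ supD g 2 := by
  rw [← norm_iteratedFDeriv_one, norm_iteratedFDeriv_fderiv]
  exact hg.norm_iteratedFDeriv_le (by norm_num) y

theorem norm_fderiv_fderiv_fderiv_le (hg : IsCb3 g) (y : Euc d) :
    ‖fderiv ℝ (fderiv ℝ (fderiv ℝ g)) y‖ ≤ supD g 3 := by
  rw [← norm_iteratedFDeriv_one, norm_iteratedFDeriv_fderiv, norm_iteratedFDeriv_fderiv]
  exact hg.norm_iteratedFDeriv_le (by norm_num) y

theorem contDiff_fderiv (hg : IsCb3 g) : ContDiff ℝ 2 (fderiv ℝ g) :=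
  hg.1.fderiv_right (by norm_num)

theorem contDiff_fderiv_fderiv (hg : IsCb3 g) : ContDiff ℝ 1 (fderiv ℝ (fderiv ℝ g)) :=
  hg.contDiff_fderiv.fderiv_right (by norm_num)

theorem differentiable (hg : IsCb3 g) : Differentiable ℝ g := hg.1.differentiable (by norm_num)

theorem differentiable_fderiv (hg : IsCb3 g) : Differentiable ℝ (fderiv ℝ g) :=
  hg.contDiff_fderiv.differentiable (by norm_num)

theorem differentiable_fderiv_fderiv (hg : IsCb3 g) : Differentiable ℝ (fderiv ℝ (fderiv ℝ g)) :=
  hg.contDiff_fderiv_fderiv.differentiable (by norm_num)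

theorem lipschitz (hg : IsCb3 g) (y z : Euc d) : ‖g y - g z‖ ≤ supD g 1 * ‖y - z‖ :=
  norm_sub_le_of_norm_fderiv_le hg.differentiable hg.norm_fderiv_le y z

theorem lipschitz_fderiv (hg : IsCb3 g) (y z : Euc d) :
    ‖fderiv ℝ g y - fderiv ℝ g z‖ ≤ supD g 2 * ‖y - z‖ :=
  norm_sub_le_of_norm_fderiv_le hg.differentiable_fderiv hg.norm_fderiv_fderiv_le y z

theorem lipschitz_fderiv_fderiv (hg : IsCb3 g) (y z : Euc d) :
    ‖fderiv ℝ (fderiv ℝ g) y - fderiv ℝ (fderiv ℝ g) z‖ ≤ supD g 3 * ‖y - z‖ :=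
  norm_sub_le_of_norm_fderiv_le hg.differentiable_fderiv_fderiv hg.norm_fderiv_fderiv_fderiv_le y z

theorem norm_fieldDeriv_le (hg : IsCb3 g) (y : Euc d) :
    ‖fieldDeriv g y‖ ≤ supD g 1 * ‖g y‖ :=
  (ContinuousLinearMap.opNorm_comp_le _ _).trans
    (mul_le_mul_of_nonneg_right (hg.norm_fderiv_le y) (norm_nonneg _))

theorem norm_fieldDeriv_le' (hg : IsCb3 g) (y : Euc d) :
    ‖fieldDeriv g y‖ ≤ supD g 1 * supD g 0 :=
  (hg.norm_fieldDeriv_le y).trans (mul_le_mul_of_nonneg_left (hg.norm_le y) (supD_nonneg g 1))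

theorem lipschitz_fieldDeriv (hg : IsCb3 g) (y z : Euc d) :
    ‖fieldDeriv g y - fieldDeriv g z‖ ≤ (supD g 2 * supD g 0 + supD g 1 ^ 2) * ‖y - z‖ := by
  have e : fieldDeriv g y - fieldDeriv g z =
      (fderiv ℝ g y - fderiv ℝ g z).comp (g y) + (fderiv ℝ g z).comp (g y - g z) := by
    ext v w; simp [fieldDeriv]
  have a1 := mul_le_mul (hg.lipschitz_fderiv y z) (hg.norm_le y) (norm_nonneg _)
    (mul_nonneg (supD_nonneg g 2) (norm_nonneg _))
  have a2 := mul_le_mul (hg.norm_fderiv_le z) (hg.lipschitz y z) (norm_nonneg _) (supD_nonneg g 1)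
  rw [e]
  refine (norm_add_le _ _).trans ((add_le_add (ContinuousLinearMap.opNorm_comp_le _ _)
    (ContinuousLinearMap.opNorm_comp_le _ _)).trans ?_)
  linarith

theorem four_point (hg : IsCb3 g) (y₁ y₂ z₁ z₂ : Euc d) :
    ‖(g z₂ - g y₂) - (g z₁ - g y₁)‖ ≤ supD g 1 * ‖(z₂ - y₂) - (z₁ - y₁)‖ +
      supD g 2 * (‖y₂ - y₁‖ + ‖z₂ - z₁‖) * ‖z₁ - y₁‖ :=
  norm_four_point_le hg.differentiable hg.norm_fderiv_le hg.lipschitz_fderiv (supD_nonneg g 2)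
    _ _ _ _

theorem four_point_fderiv (hg : IsCb3 g) (y₁ y₂ z₁ z₂ : Euc d) :
    ‖(fderiv ℝ g z₂ - fderiv ℝ g y₂) - (fderiv ℝ g z₁ - fderiv ℝ g y₁)‖ ≤
      supD g 2 * ‖(z₂ - y₂) - (z₁ - y₁)‖ +
        supD g 3 * (‖y₂ - y₁‖ + ‖z₂ - z₁‖) * ‖z₁ - y₁‖ :=
  norm_four_point_le hg.differentiable_fderiv hg.norm_fderiv_fderiv_le hg.lipschitz_fderiv_fderiv
    (supD_nonneg g 3) _ _ _ _

theorem four_point_fieldDeriv (hg : IsCb3 g) (y₁ y₂ z₁ z₂ : Euc d) :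
    ‖(fieldDeriv g z₂ - fieldDeriv g y₂) - (fieldDeriv g z₁ - fieldDeriv g y₁)‖ ≤
      (supD g 2 * supD g 0 + supD g 1 ^ 2) * ‖(z₂ - y₂) - (z₁ - y₁)‖ +
        (supD g 3 * supD g 0 + 2 * (supD g 2 * supD g 1)) * (‖y₂ - y₁‖ + ‖z₂ - z₁‖) *
          ‖z₁ - y₁‖ := by
  -- Leibniz rule for the double increment of the product Dg·g.
  have e : (fieldDeriv g z₂ - fieldDeriv g y₂) - (fieldDeriv g z₁ - fieldDeriv g y₁) =
      ((fderiv ℝ g z₂ - fderiv ℝ g y₂) - (fderiv ℝ g z₁ - fderiv ℝ g y₁)).comp (g z₂) +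
      (fderiv ℝ g z₁ - fderiv ℝ g y₁).comp (g z₂ - g z₁) +
      (fderiv ℝ g y₂).comp ((g z₂ - g y₂) - (g z₁ - g y₁)) +
      (fderiv ℝ g y₂ - fderiv ℝ g y₁).comp (g z₁ - g y₁) := by
    ext v w; simp [fieldDeriv]; ring
  have n2 := supD_nonneg g 2
  have n3 := supD_nonneg g 3
  have n1 := supD_nonneg g 1
  have a1 := mul_le_mul (hg.four_point_fderiv y₁ y₂ z₁ z₂) (hg.norm_le z₂) (norm_nonneg _)
    (by positivity)
  have a2 := mul_le_mul (hg.lipschitz_fderiv z₁ y₁) (hg.lipschitz z₂ z₁) (norm_nonneg _)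
    (by positivity)
  have a3 := mul_le_mul (hg.norm_fderiv_le y₂) (hg.four_point y₁ y₂ z₁ z₂) (norm_nonneg _) n1
  have a4 := mul_le_mul (hg.lipschitz_fderiv y₂ y₁) (hg.lipschitz z₁ y₁) (norm_nonneg _)
    (by positivity)
  rw [e]
  refine (norm_add_le _ _).trans ((add_le_add ((norm_add_le _ _).trans (add_le_add
    ((norm_add_le _ _).trans (add_le_add (ContinuousLinearMap.opNorm_comp_le _ _)
    (ContinuousLinearMap.opNorm_comp_le _ _))) (ContinuousLinearMap.opNorm_comp_le _ _)))
    (ContinuousLinearMap.opNorm_comp_le _ _)).trans ?_)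
  linarith

end IsCb3

/-! ### Rough integrals on subintervals -/

section integral

variable {m : ℕ} {W : Type*} [NormedAddCommGroup W] [NormedSpace ℝ W] {x : ℝ → Euc m}
  {X : ℝ → ℝ → Euc m ⊗[ℝ] Euc m}

theorem localIncrement_sub_coeff (y z : ℝ → Euc m →L[ℝ] W)
    (y' z' : ℝ → Euc m →L[ℝ] Euc m →L[ℝ] W) (s t : ℝ) :
    localIncrement x X (fun u => z u - y u) (fun u => z' u - y' u) s t =
      localIncrement x X z z' s t - localIncrement x X y y' s t := by
  simp only [localIncrement, sub_apply, contract_sub_left]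
  abel

theorem remainder_sub (y z : ℝ → W) (y' z' : ℝ → Euc m →L[ℝ] W) (s t : ℝ) :
    remainder x (fun u => z u - y u) (fun u => z' u - y' u) s t =
      remainder x z z' s t - remainder x y y' s t := by
  simp only [remainder, sub_apply]
  abel

theorem IsControlled.sub {α a b : ℝ} {y z : ℝ → W} {y' z' : ℝ → Euc m →L[ℝ] W}
    (hz : IsControlled α a b x z z') (hy : IsControlled α a b x y y') :
    IsControlled α a b x (fun u => z u - y u) (fun u => z' u - y' u) := by
  refine ⟨(hz.holder_path.add hy.holder_path).mono fun s t _ _ _ => ?_,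
    (hz.holder_deriv.add hy.holder_deriv).mono fun s t _ _ _ => ?_,
    (hz.holder_remainder.add hy.holder_remainder).mono fun s t _ _ _ => ?_⟩
  · rw [sub_sub_sub_comm]; exact norm_sub_le _ _
  · rw [sub_sub_sub_comm]; exact norm_sub_le _ _
  · rw [remainder_sub]; exact norm_sub_le _ _

theorem HasRoughIntegral.sub {s t : ℝ} {y z : ℝ → Euc m →L[ℝ] W}
    {y' z' : ℝ → Euc m →L[ℝ] Euc m →L[ℝ] W} {I J : W} (hz : HasRoughIntegral x X z z' s t J)
    (hy : HasRoughIntegral x X y y' s t I) :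
    HasRoughIntegral x X (fun u => z u - y u) (fun u => z' u - y' u) s t (J - I) := by
  intro ε hε
  obtain ⟨δ₁, hδ₁, h₁⟩ := hz (ε / 2) (half_pos hε)
  obtain ⟨δ₂, hδ₂, h₂⟩ := hy (ε / 2) (half_pos hε)
  refine ⟨min δ₁ δ₂, lt_min hδ₁ hδ₂, fun n τ hτ hm => ?_⟩
  have a1 := h₁ n τ hτ fun i hi => (hm i hi).trans (min_le_left _ _)
  have a2 := h₂ n τ hτ fun i hi => (hm i hi).trans (min_le_right _ _)
  simp only [localIncrement_sub_coeff, Finset.sum_sub_distrib]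
  rw [sub_sub_sub_comm]
  exact (norm_sub_le _ _).trans (by linarith)

/-- Prefix a fine partition of [a,s] to a partition of [s,t]; the Riemann sum over [s,t] is the
difference of two sums with known limits. -/
theorem HasRoughIntegral.of_initial {a s t : ℝ} (has : a ≤ s) {y : ℝ → Euc m →L[ℝ] W}
    {y' : ℝ → Euc m →L[ℝ] Euc m →L[ℝ] W} {I J : W} (hs : HasRoughIntegral x X y y' a s I)
    (ht : HasRoughIntegral x X y y' a t J) : HasRoughIntegral x X y y' s t (J - I) := by
  intro ε hε
  obtain ⟨δ₁, hδ₁, h₁⟩ := hs (ε / 2) (half_pos hε)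
  obtain ⟨δ₂, hδ₂, h₂⟩ := ht (ε / 2) (half_pos hε)
  refine ⟨δ₂, hδ₂, fun n τ hτ hm => ?_⟩
  obtain ⟨n₁, τ₁, hτ₁, hm₁⟩ := exists_isPartition_mesh_le has (lt_min hδ₁ hδ₂)
  obtain ⟨τ₂, hτ₂, hm₂, e⟩ := hτ₁.append_sum (W := W) hτ
  have a1 := h₁ n₁ τ₁ hτ₁ fun i hi => (hm₁ i hi).trans (min_le_left _ _)
  have a2 := h₂ _ τ₂ hτ₂ (hm₂ δ₂ (fun i hi => (hm₁ i hi).trans (min_le_right _ _)) hm)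
  rw [e] at a2
  have e2 : ∑ i ∈ Finset.range n, localIncrement x X y y' (τ i) (τ (i + 1)) - (J - I) =
      (∑ i ∈ Finset.range n₁, localIncrement x X y y' (τ₁ i) (τ₁ (i + 1)) +
        ∑ i ∈ Finset.range n, localIncrement x X y y' (τ i) (τ (i + 1)) - J) -
      (∑ i ∈ Finset.range n₁, localIncrement x X y y' (τ₁ i) (τ₁ (i + 1)) - I) := by abel
  rw [e2]
  exact (norm_sub_le _ _).trans (by linarith)

theorem IsControlled.restrict {α a b s t : ℝ} {y : ℝ → W} {y' : ℝ → Euc m →L[ℝ] W}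
    (hy : IsControlled α a b x y y') (has : a ≤ s) (htb : t ≤ b) : IsControlled α s t x y y' :=
  ⟨hy.holder_path.restrict has htb, hy.holder_deriv.restrict has htb,
    hy.holder_remainder.restrict has htb⟩

theorem norm_increment_le (y : ℝ → W) (y' : ℝ → Euc m →L[ℝ] W) (s t : ℝ) :
    ‖y t - y s‖ ≤ ‖y' s‖ * ‖x t - x s‖ + ‖remainder x y y' s t‖ := by
  have e : y t - y s = y' s (x t - x s) + remainder x y y' s t := by simp [remainder]
  rw [e]
  exact (norm_add_le _ _).trans (add_le_add (ContinuousLinearMap.le_opNorm _ _) le_rfl)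

end integral

/-! ### Variation estimates for integral paths -/

section core

variable {m d : ℕ} {α a b C : ℝ} {x : ℝ → Euc m} {X : ℝ → ℝ → Euc m ⊗[ℝ] Euc m}
  {z : ℝ → Euc d} {y : ℝ → Euc m →L[ℝ] Euc d} {y' : ℝ → Euc m →L[ℝ] Euc m →L[ℝ] Euc d}

theorem IsRoughIntegralConstant.norm_increment_sub_le (hα : 0 < α) (hC0 : 0 ≤ C)
    (hC : IsRoughIntegralConstant α m d C) (hX : IsRoughPath α a b x X) (hab : a ≤ b)
    (hy : IsControlled α a b x y y') (hI : HasRoughIntegral x X y y' a b (z b - z a))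
    {Xp V B₁ B₂ : ℝ} (hxV : VarLE (1 / α) (fun s t => ‖x t - x s‖) a b Xp)
    (hXV : VarLE (1 / α / 2) (fun s t => tensorNorm (X s t)) a b V)
    (hR : VarLE (1 / α / 2) (fun s t => ‖remainder x y y' s t‖) a b B₁)
    (hy' : VarLE (1 / α) (fun s t => ‖y' t - y' s‖) a b B₂) :
    ‖z b - z a - localIncrement x X y y' a b‖ ≤ C * (Xp * B₁ + B₂ * V) := by
  have hp : 0 < 1 / α := by positivity
  have hq : 0 < 1 / α / 2 := by positivity
  have h := hC a b x X hX y y' hy a b le_rfl hab le_rfl _ hI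
  have e : z b - z a - localIncrement x X y y' a b =
      z b - z a - y a (x b - x a) - contract (y' a) (X a b) := by
    simp only [localIncrement]; abel
  rw [e]
  refine h.trans (mul_le_mul_of_nonneg_left (add_le_add ?_ ?_) hC0)
  · exact mul_le_mul (hxV.variation_le hp) (hR.variation_le hq) (variation_nonneg hR.nonneg _ _)
      hxV.bound_nonneg
  · exact mul_le_mul (hy'.variation_le hp) (hXV.variation_le hq) (variation_nonneg hXV.nonneg _ _)
      hy'.bound_nonneg

/-- On each [s,t] the remainder of z is y'_s X_{s,t} plus the error in the basic estimate. In each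
product of that error the p-variation factor is replaced by its bound on [a,b], and the local
q-variation factor is summed by `VarLE.superadd`. -/
theorem IsRoughIntegralConstant.varLE_remainder (hα : 0 < α) (hα' : α < 1 / 2) (hC0 : 0 ≤ C)
    (hC : IsRoughIntegralConstant α m d C) (hX : IsRoughPath α a b x X)
    (hy : IsControlled α a b x y y')
    (hI : ∀ s t, a ≤ s → s ≤ t → t ≤ b → HasRoughIntegral x X y y' s t (z t - z s))
    {Xp V B₁ B₂ K : ℝ} (hK0 : 0 ≤ K) (hK : ∀ s, a ≤ s → s ≤ b → ‖y' s‖ ≤ K)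
    (hxV : VarLE (1 / α) (fun s t => ‖x t - x s‖) a b Xp)
    (hXV : VarLE (1 / α / 2) (fun s t => tensorNorm (X s t)) a b V)
    (hR : VarLE (1 / α / 2) (fun s t => ‖remainder x y y' s t‖) a b B₁)
    (hy' : VarLE (1 / α) (fun s t => ‖y' t - y' s‖) a b B₂) :
    VarLE (1 / α / 2) (fun s t => ‖remainder x z y s t‖) a b
      (K * V + C * (Xp * B₁ + B₂ * V)) := by
  have hp : 0 < 1 / α := by positivity
  have hq : 0 < 1 / α / 2 := by positivity
  have hq1 : 1 ≤ 1 / α / 2 := by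
    rw [div_div, le_div_iff₀ (by positivity)]; linarith
  have main := (hXV.const_mul hK0).add hq1 ((((hR.superadd hq).const_mul hxV.bound_nonneg).add hq1
    ((hXV.superadd hq).const_mul hy'.bound_nonneg)).const_mul hC0)
  refine main.mono hq (fun _ _ => norm_nonneg _) fun s t has hst htb => ?_
  have h := hC.norm_increment_sub_le hα hC0 (hX.restrict has htb) hst.le (hy.restrict has htb)
    (hI s t has hst.le htb) (hxV.restrict has htb) ((hXV.restrict has htb).self hq)
    ((hR.restrict has htb).self hq) (hy'.restrict has htb)
  have e : remainder x z y s t =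
      contract (y' s) (X s t) + (z t - z s - localIncrement x X y y' s t) := by
    simp only [remainder, localIncrement]; abel
  rw [e]
  exact (norm_add_le _ _).trans (add_le_add ((norm_contract_le _ _).trans
    (mul_le_mul_of_nonneg_right (hK s has (hst.le.trans htb)) (tensorNorm_nonneg _))) h)

/-- The increment of z is y_s x_{s,t} plus the remainder, whose p-variation is at most its
q-variation. -/
theorem varLE_path_of_remainder {W : Type*} [NormedAddCommGroup W] [NormedSpace ℝ W]
    {z : ℝ → W} {y : ℝ → Euc m →L[ℝ] W} (hα : 0 < α) (hα' : α < 1 / 2) {Xp ρ K : ℝ} (hK0 : 0 ≤ K)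
    (hK : ∀ s, a ≤ s → s ≤ b → ‖y s‖ ≤ K)
    (hxV : VarLE (1 / α) (fun s t => ‖x t - x s‖) a b Xp)
    (hR : VarLE (1 / α / 2) (fun s t => ‖remainder x z y s t‖) a b ρ) :
    VarLE (1 / α) (fun s t => ‖z t - z s‖) a b (K * Xp + ρ) := by
  have hp : 0 < 1 / α := by positivity
  have hp1 : 1 ≤ 1 / α := by rw [le_div_iff₀ hα]; linarith
  have hqp : 1 / α / 2 ≤ 1 / α := by linarith
  refine ((hxV.const_mul hK0).add hp1 (hR.exponent (by positivity) hqp)).mono hp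
    (fun _ _ => norm_nonneg _) fun s t has hst htb => ?_
  exact (norm_increment_le (x := x) z y s t).trans (add_le_add (mul_le_mul_of_nonneg_right
    (hK s has (hst.le.trans htb)) (norm_nonneg _)) le_rfl)

theorem VarLE.norm_le_add {W : Type*} [NormedAddCommGroup W] {r B : ℝ} {z : ℝ → W} (hr : 0 < r)
    (h : VarLE r (fun s t => ‖z t - z s‖) a b B) {s : ℝ} (has : a ≤ s) (hsb : s ≤ b) :
    ‖z s‖ ≤ ‖z a‖ + B := by
  rcases has.eq_or_lt with rfl | has
  · linarith [h.bound_nonneg]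
  · have h1 := h.le hr le_rfl has hsb
    have h2 := norm_sub_norm_le (z s) (z a)
    linarith

end core

/-! ### Solutions -/

section solution

variable {m d : ℕ} {α a b C : ℝ} {x : ℝ → Euc m} {X : ℝ → ℝ → Euc m ⊗[ℝ] Euc m}
  {g : Euc d → Euc m →L[ℝ] Euc d} {φ : ℝ → Euc d}

theorem IsCb3.norm_remainder_le (hg : IsCb3 g) (φ : ℝ → Euc d) (s t : ℝ) :
    ‖remainder x (fun u => g (φ u)) (gDeriv g φ) s t‖ ≤
      supD g 1 * ‖remainder x φ (fun u => g (φ u)) s t‖ +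
        supD g 2 * supD g 0 * (‖φ t - φ s‖ * ‖x t - x s‖) := by
  have h := norm_taylor_le hg.differentiable hg.norm_fderiv_le hg.lipschitz_fderiv
    (supD_nonneg g 2) (φ s) (φ t - φ s) (g (φ s) (x t - x s))
  rw [add_sub_cancel] at h
  refine h.trans (add_le_add le_rfl ?_)
  have := norm_apply_le (hg.norm_le (φ s)) (x t - x s)
  have h2 := mul_le_mul_of_nonneg_left this
    (mul_nonneg (supD_nonneg g 2) (norm_nonneg (φ t - φ s)))
  linarith

theorem IsPureSolution.controlled_field (hα : 0 < α) (hX : IsRoughPath α a b x X) (hg : IsCb3 g)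
    (hφ : IsPureSolution α a b x X g φ) :
    IsControlled α a b x (fun u => g (φ u)) (gDeriv g φ) := by
  have n1 := supD_nonneg g 1
  have n2 := supD_nonneg g 2
  have n0 := supD_nonneg g 0
  refine ⟨(hφ.controlled.holder_path.const_mul n1).mono fun s t _ _ _ => hg.lipschitz _ _,
    (hφ.controlled.holder_path.const_mul
      (by positivity : 0 ≤ supD g 2 * supD g 0 + supD g 1 ^ 2)).mono
      fun s t _ _ _ => hg.lipschitz_fieldDeriv _ _, ?_⟩
  exact ((hφ.controlled.holder_remainder.const_mul n1).add
    ((hφ.controlled.holder_path.mul hX.holder_path hα fun _ _ => norm_nonneg _).const_mul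
      (mul_nonneg n2 n0))).mono fun s t _ _ _ => hg.norm_remainder_le φ s t

theorem IsPureSolution.hasRoughIntegral (hφ : IsPureSolution α a b x X g φ) {s t : ℝ}
    (has : a ≤ s) (hst : s ≤ t) (htb : t ≤ b) :
    HasRoughIntegral x X (fun u => g (φ u)) (gDeriv g φ) s t (φ t - φ s) := by
  have h := (hφ.integral_eq s ⟨has, hst.trans htb⟩).of_initial has
    (hφ.integral_eq t ⟨has.trans hst, htb⟩)
  rwa [sub_sub_sub_cancel_right] at h

theorem IsPureSolution.restrict (hφ : IsPureSolution α a b x X g φ) {s t : ℝ} (has : a ≤ s)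
    (htb : t ≤ b) : IsPureSolution α s t x X g φ :=
  ⟨hφ.controlled.restrict has htb, fun _u hu => hφ.hasRoughIntegral has hu.1 (hu.2.trans htb)⟩

/-- The variation bounds of the driving rough path that enter the estimates. -/
structure RoughBound (α a b : ℝ) (x : ℝ → Euc m) (X : ℝ → ℝ → Euc m ⊗[ℝ] Euc m)
    (Xp v : ℝ) : Prop where
  path : VarLE (1 / α) (fun s t => ‖x t - x s‖) a b Xp
  area : VarLE (1 / α / 2) (fun s t => tensorNorm (X s t)) a b (v ^ 2)
  path_le : Xp ≤ v

theorem lipschitz_const_le (g : Euc d → Euc m →L[ℝ] Euc d) :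
    supD g 2 * supD g 0 + supD g 1 ^ 2 ≤ 2 * Cg g ^ 2 := by
  have := pow_le_pow_left₀ (supD_nonneg g 1) (supD_one_le g) 2
  linarith [(supD_mul_le g).2.1]

/-- Absorption: the coefficient of r on the right is at most 1/8 + 3/64, and the rest is at most
11/8·λ²L. -/
theorem le_of_remainder_recursion {r L lam : ℝ} (hr : 0 ≤ r) (hL : 0 ≤ L) (h0 : 0 ≤ lam)
    (h8 : lam ≤ 1 / 8)
    (h : r ≤ L * lam ^ 2 + lam * r + 3 * lam ^ 3 * L + 3 * lam ^ 2 * r) :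
    r ≤ 2 * lam ^ 2 * L := by
  have a1 : lam * r ≤ 1 / 8 * r := mul_le_mul_of_nonneg_right h8 hr
  have a2 : lam ^ 2 ≤ 1 / 64 := by nlinarith
  have a3 : lam ^ 2 * r ≤ 1 / 64 * r := mul_le_mul_of_nonneg_right a2 hr
  have a4 : lam ^ 3 * L ≤ 1 / 8 * (lam ^ 2 * L) := by
    have := mul_le_mul_of_nonneg_right h8 (mul_nonneg (sq_nonneg lam) hL)
    linarith
  have a5 := mul_nonneg (sq_nonneg lam) hL
  linarith

variable {Xp v : ℝ}

theorem IsPureSolution.exists_varLE_remainder (hα : 0 < α) (hab : a ≤ b)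
    (hφ : IsPureSolution α a b x X g φ) :
    ∃ ρ, VarLE (1 / α / 2) (fun s t => ‖remainder x φ (fun u => g (φ u)) s t‖) a b ρ :=
  hφ.controlled.holder_remainder.exists_varLE_half hα (fun _ _ => norm_nonneg _) hab

/-- The `q`-variation of the remainder of a solution, weighted with a constant `k`. -/
theorem IsPureSolution.mul_twoVar_remainder_le (hα : 0 < α) (hα' : α < 1 / 2) (hC1 : 1 < C)
    (hC : IsRoughIntegralConstant α m d C) (hab : a ≤ b) (hX : IsRoughPath α a b x X)
    (hg : IsCb3 g) (hφ : IsPureSolution α a b x X g φ) (hv : RoughBound α a b x X Xp v)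
    (hlam : C * Cg g * v ≤ 1 / 8) {k L : ℝ} (hk : 0 ≤ k) (hL : 0 ≤ L)
    (h₁ : k * (supD g 1 * supD g 0) ≤ L * Cg g ^ 2)
    (h₂ : k * (supD g 2 * supD g 0 ^ 2) ≤ L * Cg g ^ 3) :
    k * twoVar (1 / α / 2) (remainder x φ (fun u => g (φ u))) a b ≤
      2 * (C * Cg g * v) ^ 2 * L := by
  have hq : 0 < 1 / α / 2 := by positivity
  have hp : 0 < 1 / α := by positivity
  have hq1 : 1 ≤ 1 / α / 2 := by
    rw [div_div, le_div_iff₀ (by positivity)]; linarith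
  have hqp : 1 / α / 2 ≤ 1 / α := by linarith
  have n1 := supD_nonneg g 1
  have n2 := supD_nonneg g 2
  have n0 := supD_nonneg g 0
  -- The Hölder bound of the controlled path makes ρ finite in advance, which justifies the later
  -- absorption.
  obtain ⟨_, hρ'⟩ := hφ.exists_varLE_remainder hα hab
  have hρ := hρ'.self hq
  change VarLE _ _ _ _ (twoVar (1 / α / 2) (remainder x φ (fun u => g (φ u))) a b) at hρ
  set ρ := twoVar (1 / α / 2) (remainder x φ (fun u => g (φ u))) a b
  have hφV := varLE_path_of_remainder hα hα' n0 (fun s _ _ => hg.norm_le (φ s)) hv.path hρ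
  have hR := ((hρ.const_mul n1).add hq1 ((hφV.mul hv.path).const_mul (mul_nonneg n2 n0))).mono hq
    (fun _ _ => norm_nonneg _) fun s t _ _ _ => hg.norm_remainder_le (x := x) φ s t
  have hH0 : 0 ≤ supD g 2 * supD g 0 + supD g 1 ^ 2 := by positivity
  have hy' := (hφV.const_mul hH0).mono hp (N' := fun s t => ‖gDeriv g φ t - gDeriv g φ s‖)
    (fun _ _ => norm_nonneg _) fun s t _ _ _ => hg.lipschitz_fieldDeriv _ _
  have main := (hC.varLE_remainder hα hα' (by linarith) hX (hφ.controlled_field hα hX hg)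
    (fun s t has hst htb => hφ.hasRoughIntegral has hst htb) (mul_nonneg n1 n0)
    (fun s _ _ => hg.norm_fieldDeriv_le' (φ s)) hv.path hv.area hR hy').variation_le hq
  change ρ ≤ _ at main
  have hXp0 := hv.path.bound_nonneg
  have hv0 := hXp0.trans hv.path_le
  have hρ0 := hρ.bound_nonneg
  have hc := Cg_nonneg g
  -- The unknown is now kρ. The hypotheses `h₁` and `h₂` turn the source terms into powers of C_g,
  -- while the terms containing ρ are linear in kρ.
  have hk1 := mul_le_mul_of_nonneg_left main hk
  set c := Cg g
  set D0 := supD g 0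
  set D1 := supD g 1
  set D2 := supD g 2
  have hkρ : 0 ≤ k * ρ := mul_nonneg hk hρ0
  have d1 : D1 ≤ c := supD_one_le g
  have d20 : D2 * D0 ≤ c ^ 2 := (supD_mul_le g).2.1
  have e1 : k * (D1 * D0 * v ^ 2) ≤ L * (c * v) ^ 2 := by
    have := mul_le_mul_of_nonneg_right h₁ (sq_nonneg v)
    linarith
  have hxx : Xp ^ 2 ≤ v ^ 2 := pow_le_pow_left₀ hXp0 hv.path_le 2
  have e2 : k * (Xp * (D1 * ρ + D2 * D0 * ((D0 * Xp + ρ) * Xp))) ≤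
      c * v * (k * ρ) + L * (c * v) ^ 3 + (c * v) ^ 2 * (k * ρ) := by
    have b1 : Xp * D1 * (k * ρ) ≤ v * c * (k * ρ) :=
      mul_le_mul_of_nonneg_right (mul_le_mul hv.path_le d1 n1 hv0) hkρ
    have b2 : k * (D2 * D0 ^ 2) * Xp ^ 3 ≤ L * c ^ 3 * v ^ 3 :=
      mul_le_mul h₂ (pow_le_pow_left₀ hXp0 hv.path_le 3) (by positivity) (by positivity)
    have b3 : D2 * D0 * Xp ^ 2 * (k * ρ) ≤ c ^ 2 * v ^ 2 * (k * ρ) :=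
      mul_le_mul_of_nonneg_right (mul_le_mul d20 hxx (by positivity) (by positivity)) hkρ
    linarith
  have e3 : k * ((D2 * D0 + D1 ^ 2) * (D0 * Xp + ρ) * v ^ 2) ≤
      2 * L * (c * v) ^ 3 + 2 * (c * v) ^ 2 * (k * ρ) := by
    have b1 : k * (D1 * D0) * D1 ≤ L * c ^ 2 * c := mul_le_mul h₁ d1 n1 (by positivity)
    have b2 : (k * (D2 * D0 ^ 2) + k * (D1 * D0) * D1) * Xp ≤ (2 * L * c ^ 3) * v :=
      mul_le_mul (by linarith) hv.path_le hXp0 (by positivity)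
    have b3 := mul_le_mul_of_nonneg_right b2 (sq_nonneg v)
    have b4 : (D2 * D0 + D1 ^ 2) * v ^ 2 * (k * ρ) ≤ 2 * c ^ 2 * v ^ 2 * (k * ρ) :=
      mul_le_mul_of_nonneg_right (mul_le_mul_of_nonneg_right (lipschitz_const_le g) (sq_nonneg v))
        hkρ
    linarith
  have hw0 : 0 ≤ c * v := mul_nonneg hc hv0
  have hwl : c * v ≤ C * c * v := by
    rw [mul_assoc]; exact le_mul_of_one_le_left hw0 hC1.le
  set w := c * v with hw
  have hlw : C * c * v = C * w := by rw [hw]; ring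
  rw [hlw] at hwl hlam ⊢
  have hl0 : 0 ≤ C * w := hw0.trans hwl
  have e4 := mul_le_mul_of_nonneg_left (add_le_add e2 e3) (by linarith : 0 ≤ C)
  have hw2 : w ^ 2 ≤ (C * w) ^ 2 := pow_le_pow_left₀ hw0 hwl 2
  refine le_of_remainder_recursion hkρ hL hl0 hlam ?_
  have f1 : L * w ^ 2 ≤ L * (C * w) ^ 2 := mul_le_mul_of_nonneg_left hw2 hL
  have f2 : (C * w) * w ^ 2 * L ≤ (C * w) * (C * w) ^ 2 * L :=
    mul_le_mul_of_nonneg_right (mul_le_mul_of_nonneg_left hw2 hl0) hL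
  have f3 : (C * w) * w * (k * ρ) ≤ (C * w) * (C * w) * (k * ρ) :=
    mul_le_mul_of_nonneg_right (mul_le_mul_of_nonneg_left hwl hl0) hkρ
  linarith

end solution

/-! ### A priori bounds and comparison of two solutions -/

section estimates

variable {m d : ℕ} {α a b C : ℝ} {x : ℝ → Euc m} {X : ℝ → ℝ → Euc m ⊗[ℝ] Euc m}
  {g : Euc d → Euc m →L[ℝ] Euc d} {φ ψ : ℝ → Euc d} {Xp v : ℝ}

theorem IsPureSolution.varLE_remainder (hα : 0 < α) (hα' : α < 1 / 2) (hC1 : 1 < C)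
    (hC : IsRoughIntegralConstant α m d C) (hab : a ≤ b) (hX : IsRoughPath α a b x X)
    (hg : IsCb3 g) (hφ : IsPureSolution α a b x X g φ) (hv : RoughBound α a b x X Xp v)
    (hlam : C * Cg g * v ≤ 1 / 8) :
    VarLE (1 / α / 2) (fun s t => ‖remainder x φ (fun u => g (φ u)) s t‖) a b
      (2 * (C * Cg g * v) ^ 2) := by
  have hq : 0 < 1 / α / 2 := by positivity
  obtain ⟨_, hρ'⟩ := hφ.exists_varLE_remainder hα hab
  refine (hρ'.self hq).mono_bound hq ?_
  have := hφ.mul_twoVar_remainder_le hα hα' hC1 hC hab hX hg hv hlam (k := 1) (L := 1)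
    zero_le_one zero_le_one (by linarith [(supD_mul_le g).1])
    (by linarith [(supD_mul_le g).2.2.2.1])
  rwa [one_mul, mul_one] at this

/-- The variation Φ of the path also enters through the growth of g(φ), so the two coupled
inequalities are solved together. -/
theorem le_of_linear_growth_recursion {ρ Φ N lam : ℝ} (hρ : 0 ≤ ρ) (hΦ : 0 ≤ Φ) (hN : 0 ≤ N)
    (h0 : 0 ≤ lam) (h8 : lam ≤ 1 / 8)
    (h₁ : ρ ≤ lam ^ 2 * (N + Φ) + lam * ρ + 3 * lam ^ 2 * Φ)
    (h₂ : Φ ≤ lam * (N + Φ) + ρ) : Φ ≤ 2 * lam * N ∧ ρ ≤ 2 * lam ^ 2 * N := by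
  have a1 : lam * ρ ≤ 1 / 8 * ρ := mul_le_mul_of_nonneg_right h8 hρ
  have a2 : lam * Φ ≤ 1 / 8 * Φ := mul_le_mul_of_nonneg_right h8 hΦ
  have a3 : lam ^ 2 * Φ ≤ 1 / 64 * Φ := by
    refine mul_le_mul_of_nonneg_right ?_ hΦ
    nlinarith
  have a4 : lam ^ 2 * N ≤ 1 / 8 * (lam * N) := by
    have := mul_le_mul_of_nonneg_right h8 (mul_nonneg h0 hN)
    linarith
  have a5 := mul_nonneg h0 hN
  -- Eliminating ρ leaves 45/56·Φ ≤ 8/7·λN.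
  have b1 : Φ ≤ 64 / 45 * (lam * N) := by linarith
  refine ⟨by linarith, ?_⟩
  have b2 : lam ^ 2 * Φ ≤ 8 / 45 * (lam ^ 2 * N) := by
    have := mul_le_mul_of_nonneg_left b1 (sq_nonneg lam)
    have := mul_le_mul_of_nonneg_right h8 (mul_nonneg (sq_nonneg lam) hN)
    linarith
  have b3 := mul_nonneg (sq_nonneg lam) hN
  linarith

/-- When g(0) = 0 the supremum of g is replaced by ‖g(φ_s)‖ ≤ C_g ‖φ_s‖ ≤ C_g (‖φ_a‖ + Φ), which
makes all bounds proportional to the initial value. -/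
theorem IsPureSolution.pathVar_le_of_zero (hα : 0 < α) (hα' : α < 1 / 2) (hC1 : 1 < C)
    (hC : IsRoughIntegralConstant α m d C) (hab : a ≤ b) (hX : IsRoughPath α a b x X)
    (hg : IsCb3 g) (hφ : IsPureSolution α a b x X g φ) (hv : RoughBound α a b x X Xp v)
    (hlam : C * Cg g * v ≤ 1 / 8) (hg0 : g 0 = 0) :
    pathVar (1 / α) φ a b ≤ 2 * (C * Cg g * v) * ‖φ a‖ ∧
    twoVar (1 / α / 2) (remainder x φ (fun u => g (φ u))) a b ≤
      2 * (C * Cg g * v) ^ 2 * ‖φ a‖ := by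
  have hq : 0 < 1 / α / 2 := by positivity
  have hp : 0 < 1 / α := by positivity
  have hq1 : 1 ≤ 1 / α / 2 := by
    rw [div_div, le_div_iff₀ (by positivity)]; linarith
  have n1 := supD_nonneg g 1
  have n2 := supD_nonneg g 2
  have n0 := supD_nonneg g 0
  obtain ⟨_, hρ'⟩ := hφ.exists_varLE_remainder hα hab
  have hρ := hρ'.self hq
  change VarLE _ _ _ _ (twoVar (1 / α / 2) (remainder x φ (fun u => g (φ u))) a b) at hρ
  set ρ := twoVar (1 / α / 2) (remainder x φ (fun u => g (φ u))) a b
  obtain ⟨_, hφ'⟩ := hφ.controlled.holder_path.exists_varLE hα (fun _ _ => norm_nonneg _) hab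
  have hφV := hφ'.self hp
  change VarLE _ _ _ _ (pathVar (1 / α) φ a b) at hφV
  set Φ := pathVar (1 / α) φ a b
  have hρ0 := hρ.bound_nonneg
  have hΦ0 := hφV.bound_nonneg
  have hM : ∀ s, a ≤ s → s ≤ b → ‖φ s‖ ≤ ‖φ a‖ + Φ := fun s has hsb => hφV.norm_le_add hp has hsb
  set N := ‖φ a‖
  have hN0 : 0 ≤ N := norm_nonneg _
  have hM0 : 0 ≤ N + Φ := add_nonneg hN0 hΦ0
  have hc := Cg_nonneg g
  have d1 := supD_one_le g
  have hgM : ∀ s, a ≤ s → s ≤ b → ‖g (φ s)‖ ≤ Cg g * (N + Φ) := by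
    intro s has hsb
    have h := hg.lipschitz (φ s) 0
    rw [hg0, sub_zero, sub_zero] at h
    exact h.trans (mul_le_mul d1 (hM s has hsb) (norm_nonneg _) hc)
  have d20 := (supD_mul_le g).2.1
  have hR := ((hρ.const_mul hc).add hq1 ((hφV.mul hv.path).const_mul (sq_nonneg (Cg g)))).mono hq
    (fun _ _ => norm_nonneg _) fun s t _ _ _ => (hg.norm_remainder_le (x := x) φ s t).trans
      (add_le_add (mul_le_mul_of_nonneg_right d1 (norm_nonneg _))
        (mul_le_mul_of_nonneg_right d20 (by positivity)))
  have hH0 : 0 ≤ 2 * Cg g ^ 2 := by positivity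
  have hy' := (hφV.const_mul hH0).mono hp (N' := fun s t => ‖gDeriv g φ t - gDeriv g φ s‖)
    (fun _ _ => norm_nonneg _) fun s t _ _ _ => (hg.lipschitz_fieldDeriv _ _).trans
      (mul_le_mul_of_nonneg_right (lipschitz_const_le g) (norm_nonneg _))
  have hK0 : 0 ≤ Cg g * (Cg g * (N + Φ)) := mul_nonneg hc (mul_nonneg hc hM0)
  have main := (hC.varLE_remainder hα hα' (by linarith) hX (hφ.controlled_field hα hX hg)
    (fun s t has hst htb => hφ.hasRoughIntegral has hst htb) hK0
    (fun s has hsb => (hg.norm_fieldDeriv_le (φ s)).trans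
      (mul_le_mul d1 (hgM s has hsb) (norm_nonneg _) hc)) hv.path hv.area hR hy').variation_le hq
  change ρ ≤ _ at main
  have path := (varLE_path_of_remainder hα hα' (mul_nonneg hc hM0) hgM hv.path hρ).variation_le hp
  change Φ ≤ _ at path
  have hXp0 := hv.path.bound_nonneg
  have hv0 := hXp0.trans hv.path_le
  set c := Cg g
  have hw0 : 0 ≤ c * v := mul_nonneg hc hv0
  have hwl : c * v ≤ C * c * v := by
    rw [mul_assoc]; exact le_mul_of_one_le_left hw0 hC1.le
  set lam := C * c * v with hl
  have hl0 : 0 ≤ lam := hw0.trans hwl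
  have hw2 : (c * v) ^ 2 ≤ lam ^ 2 := pow_le_pow_left₀ hw0 hwl 2
  have cX : c * Xp ≤ c * v := mul_le_mul_of_nonneg_left hv.path_le hc
  have cX0 : 0 ≤ c * Xp := mul_nonneg hc hXp0
  have C0 : 0 ≤ C := by linarith
  have cX2 : (c * Xp) ^ 2 ≤ (c * v) ^ 2 := pow_le_pow_left₀ cX0 cX 2
  refine le_of_linear_growth_recursion hρ0 hΦ0 hN0 hl0 hlam ?_ ?_
  · have e1 : (c * v) ^ 2 * (N + Φ) ≤ lam ^ 2 * (N + Φ) := mul_le_mul_of_nonneg_right hw2 hM0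
    have e2 : C * (c * Xp) * ρ ≤ C * (c * v) * ρ :=
      mul_le_mul_of_nonneg_right (mul_le_mul_of_nonneg_left cX C0) hρ0
    have e3 : C * (c * Xp) ^ 2 * Φ ≤ C * (c * v) ^ 2 * Φ :=
      mul_le_mul_of_nonneg_right (mul_le_mul_of_nonneg_left cX2 C0) hΦ0
    have e4 : lam * (c * v) * Φ ≤ lam * lam * Φ :=
      mul_le_mul_of_nonneg_right (mul_le_mul_of_nonneg_left hwl hl0) hΦ0
    have e5 : lam * (c * v) = C * (c * v) ^ 2 := by rw [hl]; ring
    have e6 : lam * ρ = C * (c * v) * ρ := by rw [hl]; ring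
    rw [e5] at e4
    linarith
  · have e1 : c * Xp * (N + Φ) ≤ lam * (N + Φ) :=
      mul_le_mul_of_nonneg_right (cX.trans hwl) hM0
    linarith

/-- The terms are grouped so that D²g and D³g multiply either ‖g‖_∞ or a quantity of a single
solution, for which the weighted bounds are available. -/
theorem IsCb3.norm_remainder_sub_le (hg : IsCb3 g) (φ ψ : ℝ → Euc d) (s t : ℝ) {M : ℝ}
    (hs : ‖ψ s - φ s‖ ≤ M) (ht : ‖ψ t - φ t‖ ≤ M) :
    ‖remainder x (fun u => g (ψ u) - g (φ u)) (fun u => gDeriv g ψ u - gDeriv g φ u) s t‖ ≤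
      supD g 1 * ‖remainder x (fun u => ψ u - φ u) (fun u => g (ψ u) - g (φ u)) s t‖ +
      M * (supD g 2 * ‖remainder x φ (fun u => g (φ u)) s t‖) +
      M * (supD g 2 * supD g 1 * (‖ψ t - ψ s‖ * ‖x t - x s‖)) +
      supD g 2 * supD g 0 * (‖(ψ t - φ t) - (ψ s - φ s)‖ * ‖x t - x s‖) +
      M * (supD g 3 * supD g 0 * ((‖φ t - φ s‖ + ‖ψ t - ψ s‖) * ‖x t - x s‖)) := by
  have n1 := supD_nonneg g 1
  have n2 := supD_nonneg g 2
  have n3 := supD_nonneg g 3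
  have hM0 : 0 ≤ M := (norm_nonneg _).trans hs
  have h := norm_taylor_sub_taylor_le hg.differentiable hg.differentiable_fderiv hg.norm_fderiv_le
    hg.norm_fderiv_fderiv_le hg.lipschitz_fderiv_fderiv n2 n3 (φ s) (φ t - φ s)
    (g (φ s) (x t - x s)) (ψ s) (ψ t - ψ s) (g (ψ s) (x t - x s)) hs (by simpa using ht)
  rw [add_sub_cancel, add_sub_cancel] at h
  rw [remainder_sub (x := x) φ ψ, remainder_sub (x := x) (fun u => g (φ u)) (fun u => g (ψ u))]
  have e1 : ψ t - ψ s - (φ t - φ s) = (ψ t - φ t) - (ψ s - φ s) := by abel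
  rw [e1] at h
  have b1 : ‖g (ψ s) (x t - x s) - g (φ s) (x t - x s)‖ ≤ supD g 1 * M * ‖x t - x s‖ := by
    rw [← sub_apply]
    exact norm_apply_le ((hg.lipschitz _ _).trans (mul_le_mul_of_nonneg_left hs n1)) _
  have b2 := norm_apply_le (hg.norm_le (φ s)) (x t - x s)
  have c1 := mul_le_mul_of_nonneg_left b1 (mul_nonneg n2 (norm_nonneg (ψ t - ψ s)))
  have c2 := mul_le_mul_of_nonneg_left b2
    (by positivity : 0 ≤ supD g 2 * ‖(ψ t - φ t) - (ψ s - φ s)‖ +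
      supD g 3 * (‖φ t - φ s‖ + ‖ψ t - ψ s‖) * M)
  refine h.trans ?_
  simp only [remainder]
  linarith

/-- The bracket in `h₁` bounds the error of the second-order expansion of the difference. Keeping it
apart shows that it is cubic in λ although ρ itself is only quadratic. -/
theorem le_of_difference_recursion {ρ Z N lam : ℝ} (hρ : 0 ≤ ρ) (hZ : 0 ≤ Z) (hN : 0 ≤ N)
    (h0 : 0 ≤ lam) (h8 : lam ≤ 1 / 8)
    (h₁ : ρ ≤ 2 * lam ^ 2 * (N + Z) + (lam * ρ + 53 / 4 * lam ^ 3 * (N + Z) + 3 * lam ^ 2 * Z))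
    (h₂ : Z ≤ lam * (N + Z) + ρ) :
    Z ≤ 8 / 3 * lam * N ∧
      lam * ρ + 53 / 4 * lam ^ 3 * (N + Z) + 3 * lam ^ 2 * Z ≤ 40 * lam ^ 3 * N := by
  have a1 : lam * ρ ≤ 1 / 8 * ρ := mul_le_mul_of_nonneg_right h8 hρ
  have a2 : lam * Z ≤ 1 / 8 * Z := mul_le_mul_of_nonneg_right h8 hZ
  have a3 : lam ^ 2 * Z ≤ 1 / 64 * Z := by
    refine mul_le_mul_of_nonneg_right ?_ hZ
    nlinarith
  have a4 : lam ^ 2 * N ≤ 1 / 8 * (lam * N) := by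
    have := mul_le_mul_of_nonneg_right h8 (mul_nonneg h0 hN)
    linarith
  have a5 := mul_nonneg h0 hN
  have a6 := mul_nonneg (sq_nonneg lam) hN
  have a8 := mul_nonneg (sq_nonneg lam) hZ
  have a7 : lam ^ 3 * (N + Z) ≤ 1 / 8 * (lam ^ 2 * N + lam ^ 2 * Z) := by
    have := mul_le_mul_of_nonneg_right h8 (add_nonneg a6 a8)
    linarith
  -- Solve `h₁` for ρ, dividing by 7/8, then insert the result in `h₂`; the decimals are rounded up.
  have b0 : ρ ≤ 4.18 * (lam ^ 2 * N) + 7.61 * (lam ^ 2 * Z) := by linarith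
  have b1 : Z ≤ 2.02 * (lam * N) := by linarith
  refine ⟨by linarith, ?_⟩
  have b2 : lam ^ 2 * Z ≤ 2.02 * (lam ^ 3 * N) := by
    have := mul_le_mul_of_nonneg_left b1 (sq_nonneg lam)
    linarith
  have b3 : lam ^ 3 * Z ≤ 1 / 8 * (lam ^ 2 * Z) := by
    have := mul_le_mul_of_nonneg_right h8 a8
    linarith
  have b4 := mul_le_mul_of_nonneg_left b0 h0
  have b5 : 0 ≤ lam ^ 3 * N := by positivity
  linarith

set_option maxHeartbeats 1000000 in
/-- Two solutions differ by at most a multiple of the difference of their initial values. -/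
theorem IsPureSolution.norm_sub_sub_le (hα : 0 < α) (hα' : α < 1 / 2) (hC1 : 1 < C)
    (hC : IsRoughIntegralConstant α m d C) (hab : a ≤ b) (hX : IsRoughPath α a b x X)
    (hg : IsCb3 g) (hφ : IsPureSolution α a b x X g φ) (hψ : IsPureSolution α a b x X g ψ)
    (hv : RoughBound α a b x X Xp v) (hlam : C * Cg g * v ≤ 1 / 8) :
    VarLE (1 / α) (fun s t => ‖(ψ t - φ t) - (ψ s - φ s)‖) a b
      (8 / 3 * (C * Cg g * v) * ‖ψ a - φ a‖) ∧
    ‖(ψ b - φ b) - (ψ a - φ a) - localIncrement x X (fun u => g (ψ u) - g (φ u))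
      (fun u => gDeriv g ψ u - gDeriv g φ u) a b‖ ≤ 40 * (C * Cg g * v) ^ 3 * ‖ψ a - φ a‖ := by
  have hq : 0 < 1 / α / 2 := by positivity
  have hp : 0 < 1 / α := by positivity
  have hp1 : 1 ≤ 1 / α := by rw [le_div_iff₀ hα]; linarith
  have hq1 : 1 ≤ 1 / α / 2 := by
    rw [div_div, le_div_iff₀ (by positivity)]; linarith
  have n1 := supD_nonneg g 1
  have n2 := supD_nonneg g 2
  have n3 := supD_nonneg g 3
  have n0 := supD_nonneg g 0
  have hc := Cg_nonneg g
  have hXp0 := hv.path.bound_nonneg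
  have hv0 := hXp0.trans hv.path_le
  have d1 := supD_one_le g
  obtain ⟨d10, d20, d30, d200, d300⟩ := supD_mul_le g
  -- weighted bounds for a single solution
  have single : ∀ {χ : ℝ → Euc d}, IsPureSolution α a b x X g χ → ∃ ρ Φ,
      VarLE (1 / α / 2) (fun s t => ‖remainder x χ (fun u => g (χ u)) s t‖) a b ρ ∧
      VarLE (1 / α) (fun s t => ‖χ t - χ s‖) a b Φ ∧
      supD g 2 * ρ ≤ 2 * (C * Cg g * v) ^ 2 * Cg g ∧
      supD g 2 * supD g 1 * Φ ≤ Cg g ^ 2 * (Cg g * v + 2 * (C * Cg g * v) ^ 2) ∧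
      supD g 3 * supD g 0 * Φ ≤ Cg g ^ 2 * (Cg g * v + 2 * (C * Cg g * v) ^ 2) := by
    intro χ hχ
    obtain ⟨_, hρ'⟩ := hχ.exists_varLE_remainder hα hab
    have hρ := hρ'.self hq
    have hΦ := varLE_path_of_remainder hα hα' n0 (fun s _ _ => hg.norm_le (χ s)) hv.path hρ
    refine ⟨_, _, hρ, hΦ, ?_⟩
    -- The weights ‖D²g‖ with L = C_g and ‖D³g‖‖g‖ with L = C_g² are those with which the variation
    -- of a single solution occurs in the difference.
    have k1 := hχ.mul_twoVar_remainder_le hα hα' hC1 hC hab hX hg hv hlam n2 hc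
      (by
        have := mul_le_mul d20 d1 n1 (sq_nonneg _)
        linarith)
      (by
        have := mul_le_mul d20 d20 (by positivity) (sq_nonneg _)
        linarith)
    have k2 := hχ.mul_twoVar_remainder_le hα hα' hC1 hC hab hX hg hv hlam
      (mul_nonneg n3 n0) (sq_nonneg (Cg g)) (mul_le_mul d30 d10 (by positivity) (sq_nonneg _))
      (mul_le_mul d30 d200 (by positivity) (sq_nonneg _))
    have k3 := mul_le_mul k1 d1 n1 (by positivity)
    refine ⟨k1, ?_, ?_⟩
    · have := mul_le_mul (mul_le_mul d20 d1 n1 (sq_nonneg _)) hv.path_le hXp0 (by positivity)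
      unfold twoVar at k3
      linarith
    · have := mul_le_mul d300 hv.path_le hXp0 (by positivity)
      unfold twoVar at k2
      linarith
  obtain ⟨ρφ, Φφ, hρφ, hΦφ, kφ1, kφ2, kφ3⟩ := single hφ
  obtain ⟨ρψ, Φψ, hρψ, hΦψ, kψ1, kψ2, kψ3⟩ := single hψ
  -- the difference is an integral path
  have hcontr := (hψ.controlled_field hα hX hg).sub (hφ.controlled_field hα hX hg)
  have hint : ∀ s t, a ≤ s → s ≤ t → t ≤ b → HasRoughIntegral x X (fun u => g (ψ u) - g (φ u))
      (fun u => gDeriv g ψ u - gDeriv g φ u) s t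
      ((fun u => ψ u - φ u) t - (fun u => ψ u - φ u) s) := by
    intro s t has hst htb
    have := (hψ.hasRoughIntegral has hst htb).sub (hφ.hasRoughIntegral has hst htb)
    rwa [sub_sub_sub_comm] at this
  have hzc := hψ.controlled.sub hφ.controlled
  obtain ⟨_, hZ'⟩ := hzc.holder_path.exists_varLE hα (fun _ _ => norm_nonneg _) hab
  have hZ := hZ'.self hp
  obtain ⟨_, hρ'⟩ := hzc.holder_remainder.exists_varLE_half hα (fun _ _ => norm_nonneg _) hab
  have hρ := hρ'.self hq
  set Z := variation (1 / α) (fun s t => ‖ψ t - φ t - (ψ s - φ s)‖) a b with hZdef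
  set ρ := variation (1 / α / 2) (fun s t =>
    ‖remainder x (fun u => ψ u - φ u) (fun u => g (ψ u) - g (φ u)) s t‖) a b with hρdef
  have hρ0 := hρ.bound_nonneg
  have hZ0 := hZ.bound_nonneg
  -- The unknown Z also controls the distance of the solutions at every time; this is the M of the
  -- Taylor estimates.
  have hM : ∀ s, a ≤ s → s ≤ b → ‖ψ s - φ s‖ ≤ ‖ψ a - φ a‖ + Z :=
    fun s has hsb => VarLE.norm_le_add (z := fun u => ψ u - φ u) hp hZ has hsb
  set N := ‖ψ a - φ a‖
  have hN0 : 0 ≤ N := norm_nonneg _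
  have hM0 : 0 ≤ N + Z := add_nonneg hN0 hZ0
  have hR := (((((hρ.const_mul n1).add hq1 ((hρφ.const_mul n2).const_mul hM0)).add hq1
    (((hΦψ.mul hv.path).const_mul (mul_nonneg n2 n1)).const_mul hM0)).add hq1
    ((hZ.mul hv.path).const_mul (mul_nonneg n2 n0))).add hq1
    ((((hΦφ.add hp1 hΦψ).mul hv.path).const_mul (mul_nonneg n3 n0)).const_mul hM0)).mono hq
    (fun _ _ => norm_nonneg _) fun s t has hst htb => hg.norm_remainder_sub_le (x := x) φ ψ s t
      (hM s has (hst.le.trans htb)) (hM t (has.trans hst.le) htb)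
  have hy' := ((hZ.const_mul (by positivity : 0 ≤ supD g 2 * supD g 0 + supD g 1 ^ 2)).add hp1
    (((hΦφ.add hp1 hΦψ).const_mul (by positivity :
      0 ≤ supD g 3 * supD g 0 + 2 * (supD g 2 * supD g 1))).const_mul hM0)).mono hp
    (N' := fun s t => ‖(gDeriv g ψ t - gDeriv g φ t) - (gDeriv g ψ s - gDeriv g φ s)‖)
    (fun _ _ => norm_nonneg _) fun s t has hst htb => by
      refine (hg.four_point_fieldDeriv (φ s) (φ t) (ψ s) (ψ t)).trans (add_le_add le_rfl ?_)
      rw [mul_comm (N + Z)]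
      exact mul_le_mul_of_nonneg_left (hM s has (hst.le.trans htb)) (by positivity)
  have hyM : ∀ s, a ≤ s → s ≤ b → ‖g (ψ s) - g (φ s)‖ ≤ Cg g * (N + Z) := fun s has hsb =>
    (hg.lipschitz _ _).trans (mul_le_mul d1 (hM s has hsb) (norm_nonneg _) hc)
  have hy'M : ∀ s, a ≤ s → s ≤ b → ‖gDeriv g ψ s - gDeriv g φ s‖ ≤ 2 * Cg g ^ 2 * (N + Z) :=
    fun s has hsb => (hg.lipschitz_fieldDeriv _ _).trans
      (mul_le_mul (lipschitz_const_le g) (hM s has hsb) (norm_nonneg _) (by positivity))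
  have C0 : 0 ≤ C := by linarith
  have main := (hC.varLE_remainder hα hα' C0 hX hcontr hint (by positivity) hy'M hv.path hv.area
    hR hy').variation_le hq
  rw [← hρdef] at main
  have hE := hC.norm_increment_sub_le (z := fun u => ψ u - φ u) hα C0 hX hab hcontr (hint a b le_rfl hab le_rfl) hv.path
    hv.area hR hy'
  have path := (varLE_path_of_remainder (z := fun u => ψ u - φ u) hα hα' (mul_nonneg hc hM0) hyM hv.path hρ).variation_le hp
  rw [← hZdef] at path
  -- reduction to a scalar inequality
  set c := Cg g
  set M := N + Z with hMdef
  have hw0 : 0 ≤ c * v := mul_nonneg hc hv0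
  have hwl : c * v ≤ C * c * v := by
    rw [mul_assoc]; exact le_mul_of_one_le_left hw0 hC1.le
  set lam := C * c * v with hl
  have hl0 : 0 ≤ lam := hw0.trans hwl
  have hw2 : (c * v) ^ 2 ≤ lam ^ 2 := pow_le_pow_left₀ hw0 hwl 2
  have cX : c * Xp ≤ c * v := mul_le_mul_of_nonneg_left hv.path_le hc
  -- From λ ≤ 1/8 one has 2λ² ≤ λ/4.
  have hκ : c * v + 2 * lam ^ 2 ≤ 5 / 4 * lam := by nlinarith
  have hκ' := mul_le_mul_of_nonneg_left hκ (sq_nonneg c)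
  have hXx : Xp ^ 2 ≤ v ^ 2 := pow_le_pow_left₀ hXp0 hv.path_le 2
  have s1 : C * (Xp * (supD g 1 * ρ + M * (supD g 2 * ρφ) +
      M * (supD g 2 * supD g 1 * (Φψ * Xp)) + supD g 2 * supD g 0 * (Z * Xp) +
      M * (supD g 3 * supD g 0 * ((Φφ + Φψ) * Xp)))) ≤
      lam * ρ + 23 / 4 * lam ^ 3 * M + lam ^ 2 * Z := by
    have t1 : Xp * supD g 1 * ρ ≤ v * c * ρ :=
      mul_le_mul_of_nonneg_right (mul_le_mul hv.path_le d1 n1 hv0) hρ0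
    have t2 : Xp * (supD g 2 * ρφ) * M ≤ v * (2 * lam ^ 2 * c) * M :=
      mul_le_mul_of_nonneg_right (mul_le_mul hv.path_le kφ1
        (mul_nonneg n2 hρφ.bound_nonneg) hv0) hM0
    -- Three weighted variations, each at most 5/4·c²λ.
    have t3 : (supD g 2 * supD g 1 * Φψ + supD g 3 * supD g 0 * (Φφ + Φψ)) * Xp ^ 2 * M ≤
        (15 / 4 * c ^ 2 * lam) * v ^ 2 * M := by
      refine mul_le_mul_of_nonneg_right (mul_le_mul ?_ hXx (sq_nonneg _) (by positivity)) hM0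
      linarith
    have t4 : supD g 2 * supD g 0 * Xp ^ 2 * Z ≤ c ^ 2 * v ^ 2 * Z :=
      mul_le_mul_of_nonneg_right (mul_le_mul d20 hXx (sq_nonneg _) (sq_nonneg _)) hZ0
    have t5 := mul_le_mul_of_nonneg_left (add_le_add (add_le_add t1 t2) (add_le_add t3 t4)) C0
    have u1 : lam * (c * v) * (lam * M) ≤ lam * lam * (lam * M) :=
      mul_le_mul_of_nonneg_right (mul_le_mul_of_nonneg_left hwl hl0) (mul_nonneg hl0 hM0)
    have u2 : lam * (c * v) * Z ≤ lam * lam * Z :=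
      mul_le_mul_of_nonneg_right (mul_le_mul_of_nonneg_left hwl hl0) hZ0
    have w1 : C * (v * c * ρ) = lam * ρ := by rw [hl]; ring
    have w2 : C * (v * (2 * lam ^ 2 * c) * M) = 2 * lam ^ 3 * M := by rw [hl]; ring
    have w3 : C * ((15 / 4 * c ^ 2 * lam) * v ^ 2 * M) = 15 / 4 * (lam * (c * v) * (lam * M)) := by
      rw [hl]; ring
    have w4 : C * (c ^ 2 * v ^ 2 * Z) = lam * (c * v) * Z := by rw [hl]; ring
    linarith
  have s2 : C * (((supD g 2 * supD g 0 + supD g 1 ^ 2) * Z +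
      M * ((supD g 3 * supD g 0 + 2 * (supD g 2 * supD g 1)) * (Φφ + Φψ))) * v ^ 2) ≤
      15 / 2 * lam ^ 3 * M + 2 * lam ^ 2 * Z := by
    have t1 : (supD g 2 * supD g 0 + supD g 1 ^ 2) * Z * v ^ 2 ≤ 2 * c ^ 2 * Z * v ^ 2 :=
      mul_le_mul_of_nonneg_right (mul_le_mul_of_nonneg_right (lipschitz_const_le g) hZ0)
        (sq_nonneg v)
    -- Counted with multiplicity there are six weighted variations, each at most 5/4·c²λ.
    have t2 : ((supD g 3 * supD g 0 + 2 * (supD g 2 * supD g 1)) * (Φφ + Φψ)) * (M * v ^ 2) ≤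
        (15 / 2 * c ^ 2 * lam) * (M * v ^ 2) := by
      refine mul_le_mul_of_nonneg_right ?_ (by positivity)
      linarith
    have t5 := mul_le_mul_of_nonneg_left (add_le_add t1 t2) C0
    have u1 : lam * (c * v) * (lam * M) ≤ lam * lam * (lam * M) :=
      mul_le_mul_of_nonneg_right (mul_le_mul_of_nonneg_left hwl hl0) (mul_nonneg hl0 hM0)
    have u2 : lam * (c * v) * Z ≤ lam * lam * Z :=
      mul_le_mul_of_nonneg_right (mul_le_mul_of_nonneg_left hwl hl0) hZ0
    have w3 : C * ((15 / 2 * c ^ 2 * lam) * (M * v ^ 2)) = 15 / 2 * (lam * (c * v) * (lam * M)) := by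
      rw [hl]; ring
    have w4 : C * (2 * c ^ 2 * Z * v ^ 2) = 2 * (lam * (c * v) * Z) := by rw [hl]; ring
    linarith
  have s3 : 2 * c ^ 2 * M * v ^ 2 ≤ 2 * lam ^ 2 * M := by
    have := mul_le_mul_of_nonneg_right hw2 hM0
    linarith
  have scal := le_of_difference_recursion hρ0 hZ0 hN0 hl0 hlam
    (by rw [← hMdef]; linarith)
    (by
      rw [← hMdef]
      have : c * Xp * M ≤ lam * M := mul_le_mul_of_nonneg_right (cX.trans hwl) hM0
      linarith)
  refine ⟨hZ.mono_bound hp scal.1, hE.trans (le_trans ?_ scal.2)⟩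
  rw [← hMdef]
  linarith

end estimates

/-! ### Almost flows -/

open Filter Topology in
-- As δ → 0 the left side tends to 2·2^(-θ), which is below 1: halving an interval gains more than
-- adding the two halves loses.
theorem exists_small_contraction {α θ : ℝ} (hα : 0 < α) (hθ : 1 < θ) (κ : ℝ) :
    ∃ δ : ℝ, 0 < δ ∧ ((1 + κ * δ ^ α) ^ 2 + 1) * 2⁻¹ ^ θ < 1 := by
  have hlim : Tendsto (fun δ : ℝ => ((1 + κ * δ ^ α) ^ 2 + 1) * (2⁻¹ : ℝ) ^ θ) (𝓝[>] 0)
      (𝓝 (((1 + κ * 0 ^ α) ^ 2 + 1) * (2⁻¹ : ℝ) ^ θ)) := by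
    have h : ContinuousAt (fun δ : ℝ => ((1 + κ * δ ^ α) ^ 2 + 1) * (2⁻¹ : ℝ) ^ θ) 0 := by
      have := Real.continuousAt_rpow_const (0 : ℝ) α (Or.inr hα.le)
      fun_prop
    exact h.tendsto.mono_left nhdsWithin_le_nhds
  have hval : ((1 + κ * 0 ^ α) ^ 2 + 1) * (2⁻¹ : ℝ) ^ θ < 1 := by
    rw [Real.zero_rpow hα.ne', mul_zero, add_zero]
    have : (2⁻¹ : ℝ) ^ θ < 2⁻¹ ^ (1 : ℝ) :=
      Real.rpow_lt_rpow_of_exponent_gt (by norm_num) (by norm_num) hθ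
    rw [Real.rpow_one] at this
    linarith
  obtain ⟨δ, h1, h2⟩ := ((hlim.eventually_lt_const hval).and self_mem_nhdsWithin).exists
  exact ⟨δ, h2, h1⟩

theorem exists_lt_and_not_succ {P : ℕ → Prop} {i : ℕ} (h0 : P i) :
    ∀ l, ¬ P (i + l) → ∃ k < l, P (i + k) ∧ ¬ P (i + k + 1) := by
  intro l
  induction l with
  | zero => intro h; exact absurd h0 h
  | succ l ih =>
    intro h
    by_cases hl : P (i + l)
    · exact ⟨l, Nat.lt_succ_self l, hl, h⟩
    · obtain ⟨k, hk, h1⟩ := ih hl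
      exact ⟨k, hk.trans (Nat.lt_succ_self l), h1⟩

/-- A family of maps that is Lipschitz and satisfies the flow property up to an error of order
`θ`. -/
structure IsAlmostFlow {E : Type*} [NormedAddCommGroup E] (a b α κ D θ : ℝ)
    (F : ℝ → ℝ → E → E) : Prop where
  self : ∀ s y, a ≤ s → s ≤ b → F s s y = y
  lipschitz : ∀ s t y z, a ≤ s → s ≤ t → t ≤ b →
    ‖F s t y - F s t z‖ ≤ (1 + κ * (t - s) ^ α) * ‖y - z‖
  flow : ∀ s u t y, a ≤ s → s ≤ u → u ≤ t → t ≤ b →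
    ‖F u t (F s u y) - F s t y‖ ≤ D * (t - s) ^ θ
  bounded : ∃ B, ∀ s t y, a ≤ s → s ≤ t → t ≤ b → ‖F s t y - y‖ ≤ B

namespace IsAlmostFlow

variable {E : Type*} [NormedAddCommGroup E] {a b α κ D θ : ℝ} {F : ℝ → ℝ → E → E}

theorem half_rpow_le {l l' : ℝ} (hl' : 0 ≤ l') (h : l' ≤ l / 2) (hθ : 0 ≤ θ) :
    l' ^ θ ≤ 2⁻¹ ^ θ * l ^ θ := by
  have hl : 0 ≤ l := by linarith
  rw [← Real.mul_rpow (by norm_num) hl]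
  exact Real.rpow_le_rpow hl' (by linarith) hθ

/-- Discrete nonlinear sewing. -/
theorem euler_estimate (hF : IsAlmostFlow a b α κ D θ F) (hα : 0 < α) (hθ : 1 < θ) (hκ : 0 ≤ κ)
    (hD : 0 ≤ D) :
    ∃ δ K : ℝ, 0 < δ ∧ 0 ≤ K ∧ ∀ (n : ℕ) (τ : ℕ → ℝ) (y : ℕ → E),
      (∀ i ≤ n, a ≤ τ i ∧ τ i ≤ b) → (∀ i j, i < j → j ≤ n → τ i < τ j) →
      (∀ i < n, y (i + 1) = F (τ i) (τ (i + 1)) (y i)) →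
      ∀ i j, i ≤ j → j ≤ n → τ j - τ i ≤ δ →
        ‖y j - F (τ i) (τ j) (y i)‖ ≤ K * (τ j - τ i) ^ θ := by
  obtain ⟨δ, hδ, hc⟩ := exists_small_contraction hα hθ κ
  set L := 1 + κ * δ ^ α with hL
  have hL1 : 1 ≤ L := by
    have := mul_nonneg hκ (Real.rpow_nonneg hδ.le α)
    linarith
  set r := (2⁻¹ : ℝ) ^ θ with hr
  have hr0 : 0 < r := by positivity
  -- K is the fixed point of the recursion produced by the four-term splitting below.
  set K := D * (1 + L) / (1 - (L ^ 2 + 1) * r) with hKdef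
  have hden : 0 < 1 - (L ^ 2 + 1) * r := by linarith
  have hK0 : 0 ≤ K := div_nonneg (mul_nonneg hD (by linarith)) hden.le
  have hK : K * ((L ^ 2 + 1) * r) + D * (1 + L) = K := by
    rw [hKdef]; field_simp; ring
  refine ⟨δ, K, hδ, hK0, fun n τ y hτ hmono hy => ?_⟩
  have lip : ∀ s t y z, a ≤ s → s ≤ t → t ≤ b → t - s ≤ δ →
      ‖F s t y - F s t z‖ ≤ L * ‖y - z‖ := by
    intro s t y z has hst htb hδ'
    refine (hF.lipschitz s t y z has hst htb).trans (mul_le_mul_of_nonneg_right ?_ (norm_nonneg _))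
    have := mul_le_mul_of_nonneg_left
      (Real.rpow_le_rpow (sub_nonneg.2 hst) hδ' hα.le) hκ
    linarith
  have main : ∀ l i, i + l ≤ n → τ (i + l) - τ i ≤ δ →
      ‖y (i + l) - F (τ i) (τ (i + l)) (y i)‖ ≤ K * (τ (i + l) - τ i) ^ θ := by
    intro l
    induction l using Nat.strong_induction_on with
    | _ l ih =>
      intro i hil hlen
      have mono : ∀ {i j}, i ≤ j → j ≤ n → τ i ≤ τ j := by
        intro i j hij hj
        rcases hij.eq_or_lt with rfl | h
        · exact le_rfl
        · exact (hmono i j h hj).le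
      rcases Nat.eq_zero_or_pos l with rfl | hl
      · have hi := hτ i (by omega)
        simp only [add_zero, sub_self]
        rw [hF.self _ _ hi.1 hi.2, sub_self, norm_zero]
        exact mul_nonneg hK0 (Real.rpow_nonneg le_rfl _)
      have hlt := hmono i (i + l) (by omega) hil
      -- The single step from u to w crosses the midpoint of [s,t], so [s,u] and [w,t] are both at
      -- most half as long and the induction hypothesis applies to them.
      obtain ⟨k, hk, h1, h2⟩ := exists_lt_and_not_succ
        (P := fun k => τ k ≤ (τ i + τ (i + l)) / 2) (i := i) (by linarith) l
        (by simp only [not_le]; linarith)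
      simp only [not_le] at h2
      obtain ⟨l', rfl⟩ : ∃ l', l = k + 1 + l' := ⟨l - (k + 1), by omega⟩
      have e : i + (k + 1 + l') = i + k + 1 + l' := by ring
      rw [e] at hil hlen hlt h1 h2 ⊢
      have m1 : τ i ≤ τ (i + k) := mono (by omega) (by omega)
      have m2 : τ (i + k) ≤ τ (i + k + 1) := mono (by omega) (by omega)
      have m3 : τ (i + k + 1) ≤ τ (i + k + 1 + l') := mono (by omega) (by omega)
      have ai := (hτ i (by omega)).1
      have bj := (hτ (i + k + 1 + l') hil).2
      set s := τ i
      set u := τ (i + k)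
      set w := τ (i + k + 1)
      set t := τ (i + k + 1 + l')
      have r1 := half_rpow_le (θ := θ) (l := t - s) (l' := u - s) (by linarith) (by linarith)
        (by linarith)
      have r2 := half_rpow_le (θ := θ) (l := t - s) (l' := t - w) (by linarith) (by linarith)
        (by linarith)
      rw [← hr] at r1 r2
      have p1 := (ih k (by omega) i (by omega) (by linarith)).trans
        (mul_le_mul_of_nonneg_left r1 hK0)
      have p2 := (ih l' (by omega) (i + k + 1) (by omega) (by linarith)).trans
        (mul_le_mul_of_nonneg_left r2 hK0)
      have p3 : ‖F w t (F u w (y (i + k))) - F w t (F u w (F s u (y i)))‖ ≤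
          L * (L * (K * (r * (t - s) ^ θ))) :=
        (lip w t _ _ (by linarith) m3 bj (by linarith)).trans (mul_le_mul_of_nonneg_left
          ((lip u w _ _ (by linarith) m2 (by linarith) (by linarith)).trans
            (mul_le_mul_of_nonneg_left p1 (by linarith))) (by linarith))
      have p4 : ‖F w t (F u w (F s u (y i))) - F w t (F s w (y i))‖ ≤
          L * (D * (t - s) ^ θ) :=
        (lip w t _ _ (by linarith) m3 bj (by linarith)).trans (mul_le_mul_of_nonneg_left
          ((hF.flow s u w (y i) ai m1 m2 (by linarith)).trans
            (mul_le_mul_of_nonneg_left (Real.rpow_le_rpow (by linarith) (by linarith)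
              (by linarith)) hD)) (by linarith))
      have p5 := hF.flow s w t (y i) ai (by linarith) m3 bj
      have hy1 := hy (i + k) (by omega)
      have split : y (i + k + 1 + l') - F s t (y i) =
          (y (i + k + 1 + l') - F w t (y (i + k + 1))) +
          (F w t (F u w (y (i + k))) - F w t (F u w (F s u (y i)))) +
          (F w t (F u w (F s u (y i))) - F w t (F s w (y i))) +
          (F w t (F s w (y i)) - F s t (y i)) := by
        rw [hy1]; abel
      rw [split]
      refine (norm_add_le _ _).trans ((add_le_add ((norm_add_le _ _).trans
        (add_le_add ((norm_add_le _ _).trans (add_le_add p2 p3)) p4)) p5).trans ?_)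
      nth_rewrite 3 [← hK]
      linarith
  intro i j hij hj hlen
  obtain ⟨l, rfl⟩ := Nat.exists_eq_add_of_le hij
  exact main l i hj hlen

/-- An almost flow has discrete trajectories on every finite set of times. -/
theorem exists_finset_path (hF : IsAlmostFlow a b α κ D θ F) (hα : 0 < α) (hθ : 1 < θ)
    (hκ : 0 ≤ κ) (hD : 0 ≤ D) (hab : a ≤ b) (ξ : E) :
    ∃ δ K : ℝ, 0 < δ ∧ 0 ≤ K ∧ ∀ S : Finset ℝ, ∃ y : ℝ → E, y a = ξ ∧
      ∀ s ∈ insert a S, ∀ t ∈ insert a S, a ≤ s → s ≤ t → t ≤ b → t - s ≤ δ →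
        ‖y t - F s t (y s)‖ ≤ K * (t - s) ^ θ := by
  obtain ⟨δ, K, hδ, hK, H⟩ := hF.euler_estimate hα hθ hκ hD
  refine ⟨δ, K, hδ, hK, fun S => ?_⟩
  -- Including a fixes the starting point. The scheme runs through T in increasing order; δ and K do
  -- not depend on S.
  set T := (insert a S).filter (fun s => a ≤ s ∧ s ≤ b) with hT
  have haT : a ∈ T := by simp [hT, hab]
  obtain ⟨n, hn⟩ : ∃ n, T.card = n + 1 :=
    Nat.exists_eq_succ_of_ne_zero (Finset.card_ne_zero_of_mem haT)
  set e := T.orderEmbOfFin hn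
  set τ : ℕ → ℝ := fun i => if h : i < n + 1 then e ⟨i, h⟩ else b with hτ
  have τe : ∀ i (h : i < n + 1), τ i = e ⟨i, h⟩ := fun i h => dif_pos h
  have τmem : ∀ i ≤ n, τ i ∈ T := fun i hi => by
    rw [τe i (by omega)]; exact T.orderEmbOfFin_mem hn _
  have τmono : ∀ i j, i < j → j ≤ n → τ i < τ j := by
    intro i j hij hj
    rw [τe i (by omega), τe j (by omega)]
    exact e.strictMono (by simpa using hij)
  have τsurj : ∀ t, t ∈ T → ∃ i ≤ n, τ i = t := by
    intro t ht
    have : t ∈ Set.range e := by rw [Finset.range_orderEmbOfFin]; exact ht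
    obtain ⟨i, rfl⟩ := this
    exact ⟨i, by omega, τe i i.2⟩
  choose! idx hidx using τsurj
  set y : ℕ → E := fun i => Nat.rec ξ (fun i y => F (τ i) (τ (i + 1)) y) i with hy
  have hidx0 : idx a = 0 := by
    by_contra h0
    have h1 := τmono 0 (idx a) (Nat.pos_of_ne_zero h0) (hidx a haT).1
    have h2 := (Finset.mem_filter.1 (τmem 0 (by omega))).2.1
    rw [(hidx a haT).2] at h1
    linarith
  refine ⟨fun t => y (idx t), congrArg y hidx0, fun s hs t ht has hst htb hlen => ?_⟩
  have hsT : s ∈ T := Finset.mem_filter.2 ⟨hs, has, hst.trans htb⟩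
  have htT : t ∈ T := Finset.mem_filter.2 ⟨ht, has.trans hst, htb⟩
  obtain ⟨is, es⟩ := hidx s hsT
  obtain ⟨it, et⟩ := hidx t htT
  have hij : idx s ≤ idx t := by
    by_contra h
    have := τmono _ _ (not_le.1 h) is
    rw [es, et] at this
    linarith
  have := H n τ y (fun i hi => (Finset.mem_filter.1 (τmem i hi)).2) τmono (fun i _ => rfl)
    (idx s) (idx t) hij it (by rwa [es, et])
  rwa [es, et] at this

open Filter Topology in
-- Limit of the discrete trajectories along an ultrafilter on the finite sets of times. Any two
-- given times eventually lie in the set, so the uniform estimate survives at every pair of times.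
theorem exists_path_local [ProperSpace E] (hF : IsAlmostFlow a b α κ D θ F) (hα : 0 < α)
    (hθ : 1 < θ) (hκ : 0 ≤ κ) (hD : 0 ≤ D) (hab : a ≤ b) (ξ : E) :
    ∃ δ K : ℝ, 0 < δ ∧ 0 ≤ K ∧ ∃ φ : ℝ → E, φ a = ξ ∧
      ∀ s t, a ≤ s → s ≤ t → t ≤ b → t - s ≤ δ → ‖φ t - F s t (φ s)‖ ≤ K * (t - s) ^ θ := by
  obtain ⟨δ, K, hδ, hK, H⟩ := hF.exists_finset_path hα hθ hκ hD hab ξ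
  refine ⟨δ, K, hδ, hK, ?_⟩
  choose y hya hy using H
  obtain ⟨B, hB⟩ := hF.bounded
  have hmem : ∀ t : ℝ, ∀ᶠ S : Finset ℝ in atTop, t ∈ S := fun t =>
    (eventually_ge_atTop {t}).mono fun S hS => Finset.singleton_subset_iff.1 hS
  -- Trajectories stay bounded at each time: go back by δ, or to a if that is later, where the
  -- induction hypothesis applies; that earlier time eventually belongs to S.
  have bdd : ∀ k : ℕ, ∀ t, a ≤ t → t ≤ b → t - a ≤ k * δ →
      ∃ R, ∀ᶠ S : Finset ℝ in atTop, ‖y S t‖ ≤ R := by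
    intro k
    induction k with
    | zero =>
      intro t hat htb h
      have : t = a := by norm_num at h; linarith
      subst this
      exact ⟨‖ξ‖, Eventually.of_forall fun S => by rw [hya]⟩
    | succ k ih =>
      intro t hat htb h
      push_cast at h
      obtain ⟨R, hR⟩ := ih (max a (t - δ)) (le_max_left _ _) (max_le (hat.trans htb) (by linarith))
        (by
          rcases max_cases a (t - δ) with ⟨e, _⟩ | ⟨e, _⟩ <;> rw [e]
          · simp only [sub_self]; positivity
          · linarith)
      set s := max a (t - δ)
      have hst : s ≤ t := max_le hat (by linarith)
      refine ⟨K * (t - s) ^ θ + B + R, ?_⟩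
      filter_upwards [hR, hmem s, hmem t] with S hS hs ht
      have h1 := hy S s (Finset.mem_insert_of_mem hs) t (Finset.mem_insert_of_mem ht)
        (le_max_left _ _) hst htb (by linarith [le_max_right a (t - δ)])
      have h2 := hB s t (y S s) (le_max_left _ _) hst htb
      have e : y S t = (y S t - F s t (y S s)) + (F s t (y S s) - y S s) + y S s := by abel
      rw [e]
      exact norm_add₃_le.trans (add_le_add (add_le_add h1 h2) hS)
  set U : Ultrafilter (Finset ℝ) := Ultrafilter.of atTop
  have hU : (U : Filter (Finset ℝ)) ≤ atTop := Ultrafilter.of_le _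
  have lim : ∀ t, ∃ z : E, a ≤ t → t ≤ b → Tendsto (fun S => y S t) U (𝓝 z) := by
    intro t
    by_cases ht : a ≤ t ∧ t ≤ b
    · obtain ⟨R, hR⟩ := bdd ⌈(t - a) / δ⌉₊ t ht.1 ht.2 (by
        have := Nat.le_ceil ((t - a) / δ)
        rwa [div_le_iff₀ hδ] at this)
      obtain ⟨z, -, hz⟩ := (isCompact_closedBall (0 : E) R).ultrafilter_le_nhds
        (U.map fun S => y S t) (by
          rw [Ultrafilter.coe_map, le_principal_iff, mem_map]
          exact hU (hR.mono fun S hS => by simpa using hS))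
      exact ⟨z, fun _ _ => hz⟩
    · exact ⟨0, fun h1 h2 => absurd ⟨h1, h2⟩ ht⟩
  choose φ hφ using lim
  refine ⟨φ, ?_, fun s t has hst htb hlen => ?_⟩
  · refine tendsto_nhds_unique (hφ a le_rfl hab) ?_
    simp only [hya]
    exact tendsto_const_nhds
  · have hcont : Continuous (F s t) := by
      refine (LipschitzWith.of_dist_le_mul (K := (1 + κ * (t - s) ^ α).toNNReal)
        fun y z => ?_).continuous
      rw [dist_eq_norm, dist_eq_norm, Real.coe_toNNReal _ (by
        have := mul_nonneg hκ (Real.rpow_nonneg (sub_nonneg.2 hst) α)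
        linarith)]
      exact hF.lipschitz s t y z has hst htb
    have hs := hφ s has (hst.trans htb)
    have ht := hφ t (has.trans hst) htb
    refine le_of_tendsto (ht.sub ((hcont.tendsto _).comp hs)).norm ?_
    filter_upwards [hU (hmem s), hU (hmem t)] with S h1 h2
    exact hy S s (Finset.mem_insert_of_mem h1) t (Finset.mem_insert_of_mem h2) has hst htb hlen

/-- Doubling the admissible length by splitting at the midpoint enlarges the constant; finitely many
doublings reach b - a. -/
theorem extend_estimate (hF : IsAlmostFlow a b α κ D θ F) (hα : 0 < α) (hθ : 1 < θ) (hκ : 0 ≤ κ)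
    (hab : a ≤ b) {δ K : ℝ} (hδ : 0 < δ) (hK : 0 ≤ K) {φ : ℝ → E}
    (h : ∀ s t, a ≤ s → s ≤ t → t ≤ b → t - s ≤ δ → ‖φ t - F s t (φ s)‖ ≤ K * (t - s) ^ θ) :
    ∃ K', ∀ s t, a ≤ s → s ≤ t → t ≤ b → ‖φ t - F s t (φ s)‖ ≤ K' * (t - s) ^ θ := by
  have key : ∀ n : ℕ, ∃ K', 0 ≤ K' ∧ ∀ s t, a ≤ s → s ≤ t → t ≤ b → t - s ≤ 2 ^ n * δ →
      ‖φ t - F s t (φ s)‖ ≤ K' * (t - s) ^ θ := by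
    intro n
    induction n with
    | zero => exact ⟨K, hK, by simpa using h⟩
    | succ n ih =>
      obtain ⟨K', hK', ih⟩ := ih
      refine ⟨K' + (1 + κ * (b - a) ^ α) * K' + |D|, ?_, fun s t has hst htb hlen => ?_⟩
      · have := mul_nonneg hκ (Real.rpow_nonneg (sub_nonneg.2 hab) α)
        positivity
      have hsum : ∀ s' t', s ≤ s' → s' ≤ t' → t' ≤ t → (t' - s') ^ θ ≤ (t - s) ^ θ :=
        fun s' t' h1 h2 h3 => Real.rpow_le_rpow (by linarith) (by linarith) (by linarith)
      set u := (s + t) / 2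
      have hsu : s ≤ u := by simp only [u]; linarith
      have hut : u ≤ t := by simp only [u]; linarith
      rw [pow_succ] at hlen
      have l1 : u - s ≤ 2 ^ n * δ := by simp only [u]; linarith
      have l2 : t - u ≤ 2 ^ n * δ := by simp only [u]; linarith
      have p1 := (ih s u has hsu (hut.trans htb) l1).trans
        (mul_le_mul_of_nonneg_left (hsum s u le_rfl hsu hut) hK')
      have p2 := (ih u t (has.trans hsu) hut htb l2).trans
        (mul_le_mul_of_nonneg_left (hsum u t hsu hut le_rfl) hK')
      have p3 := hF.lipschitz u t (φ u) (F s u (φ s)) (has.trans hsu) hut htb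
      have p4 := hF.flow s u t (φ s) has hsu hut htb
      have p5 : (1 + κ * (t - u) ^ α) * ‖φ u - F s u (φ s)‖ ≤
          (1 + κ * (b - a) ^ α) * (K' * (t - s) ^ θ) := by
        have h1 := Real.rpow_le_rpow (sub_nonneg.2 hut) (by linarith : t - u ≤ b - a) hα.le
        have h0 := Real.rpow_nonneg (sub_nonneg.2 hut) α
        have h2 := mul_le_mul_of_nonneg_left h1 hκ
        have h3 := mul_nonneg hκ h0
        exact mul_le_mul (by linarith) p1 (norm_nonneg _) (by linarith)
      have p6 : D * (t - s) ^ θ ≤ |D| * (t - s) ^ θ :=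
        mul_le_mul_of_nonneg_right (le_abs_self D) (Real.rpow_nonneg (sub_nonneg.2 hst) _)
      have e : φ t - F s t (φ s) = (φ t - F u t (φ u)) + (F u t (φ u) - F u t (F s u (φ s))) +
          (F u t (F s u (φ s)) - F s t (φ s)) := by abel
      rw [e]
      refine norm_add₃_le.trans ?_
      linarith
  obtain ⟨n, hn⟩ := pow_unbounded_of_one_lt ((b - a) / δ) (one_lt_two (α := ℝ))
  rw [div_lt_iff₀ hδ] at hn
  obtain ⟨K', -, h'⟩ := key n
  exact ⟨K', fun s t has hst htb => h' s t has hst htb (by linarith)⟩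

theorem exists_path [ProperSpace E] (hF : IsAlmostFlow a b α κ D θ F) (hα : 0 < α)
    (hθ : 1 < θ) (hκ : 0 ≤ κ) (hD : 0 ≤ D) (hab : a ≤ b) (ξ : E) :
    ∃ (φ : ℝ → E) (K : ℝ), φ a = ξ ∧
      ∀ s t, a ≤ s → s ≤ t → t ≤ b → ‖φ t - F s t (φ s)‖ ≤ K * (t - s) ^ θ := by
  obtain ⟨δ, K, hδ, hK, φ, hφ, h⟩ := hF.exists_path_local hα hθ hκ hD hab ξ
  obtain ⟨K', h'⟩ := hF.extend_estimate hα hθ hκ hab hδ hK h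
  exact ⟨φ, K', hφ, h'⟩

end IsAlmostFlow

/-! ### Existence of solutions -/

theorem rpow_add_le_mul {l T β γ : ℝ} (h0 : 0 ≤ l) (hT : l ≤ T) (hβ : 0 ≤ β) (hγ : 0 ≤ γ) :
    l ^ (β + γ) ≤ T ^ γ * l ^ β := by
  rw [Real.rpow_add_of_nonneg h0 hβ hγ, mul_comm]
  exact mul_le_mul_of_nonneg_right (Real.rpow_le_rpow h0 hT hγ) (Real.rpow_nonneg h0 _)

theorem HolderOnSimplex.of_exponent_add {β γ a b : ℝ} {N : ℝ → ℝ → ℝ} (hβ : 0 ≤ β) (hγ : 0 ≤ γ)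
    (h : HolderOnSimplex (β + γ) N a b) : HolderOnSimplex β N a b := by
  obtain ⟨C, hC, h⟩ := h.exists_pos
  refine ⟨C * (b - a) ^ γ, fun s t has hst htb => (h s t has hst htb).trans ?_⟩
  rw [mul_assoc]
  exact mul_le_mul_of_nonneg_left (rpow_add_le_mul (by linarith) (by linarith) hβ hγ) hC.le

section existence

variable {m d : ℕ} {α a b : ℝ} {x : ℝ → Euc m} {X : ℝ → ℝ → Euc m ⊗[ℝ] Euc m}
  {g : Euc d → Euc m →L[ℝ] Euc d}

/-- A path with an increment of higher order is integrated by its local increments. -/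
theorem hasRoughIntegral_of_norm_sub_le {W : Type*} [NormedAddCommGroup W] [NormedSpace ℝ W]
    {y : ℝ → Euc m →L[ℝ] W} {y' : ℝ → Euc m →L[ℝ] Euc m →L[ℝ] W} {z : ℝ → W} {θ : ℝ} (hθ : 1 < θ)
    (h : HolderOnSimplex θ (fun s t => ‖z t - z s - localIncrement x X y y' s t‖) a b)
    {t : ℝ} (hat : a ≤ t) (htb : t ≤ b) : HasRoughIntegral x X y y' a t (z t - z a) := by
  obtain ⟨C, hC, h⟩ := h.exists_pos
  intro ε hε
  have hden : 0 < C * (t - a + 1) := by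
    have : 0 ≤ t - a := by linarith
    positivity
  -- This mesh makes C δ^(θ-1) (t - a + 1) equal to ε; the added 1 covers t = a.
  refine ⟨(ε / (C * (t - a + 1))) ^ (1 / (θ - 1)), by positivity, fun n τ hτ hm => ?_⟩
  set δ := (ε / (C * (t - a + 1))) ^ (1 / (θ - 1)) with hδ
  have hδθ : δ ^ (θ - 1) = ε / (C * (t - a + 1)) := by
    rw [hδ, ← Real.rpow_mul (by positivity), one_div_mul_cancel (by linarith), Real.rpow_one]
  have e : ∑ i ∈ Finset.range n, localIncrement x X y y' (τ i) (τ (i + 1)) - (z t - z a) =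
      -∑ i ∈ Finset.range n, (z (τ (i + 1)) - z (τ i) -
        localIncrement x X y y' (τ i) (τ (i + 1))) := by
    rw [Finset.sum_sub_distrib, Finset.sum_range_sub (fun i => z (τ i)), hτ.1, hτ.2.1]
    abel
  rw [e, norm_neg]
  calc _ ≤ ∑ i ∈ Finset.range n, C * δ ^ (θ - 1) * (τ (i + 1) - τ i) := by
        refine (norm_sum_le _ _).trans (Finset.sum_le_sum fun i hi => ?_)
        rw [Finset.mem_range] at hi
        have hlt := hτ.2.2 i hi
        have h0 := sub_nonneg.2 hlt.le
        refine (h _ _ (hτ.mem i hi.le).1 hlt.le ((hτ.mem (i + 1) hi).2.trans htb)).trans ?_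
        rw [mul_assoc]
        refine mul_le_mul_of_nonneg_left ?_ hC.le
        have := rpow_add_le_mul h0 (hm i hi) zero_le_one (by linarith : 0 ≤ θ - 1)
        rwa [add_sub_cancel, Real.rpow_one] at this
    _ = C * δ ^ (θ - 1) * (t - a) := by
        rw [← Finset.mul_sum, Finset.sum_range_sub, hτ.1, hτ.2.1]
    _ ≤ C * δ ^ (θ - 1) * (t - a + 1) := by
        refine mul_le_mul_of_nonneg_left (by linarith) ?_
        rw [hδθ]; positivity
    _ = ε := by
        have : t - a + 1 ≠ 0 := by linarith
        rw [hδθ]; field_simp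

/-- Davie's criterion: an expansion of order 3α yields first the 2α-bound on the remainder, then the
Hölder bound on the path, and since 3α > 1 also the integral equation. -/
theorem isPureSolution_of_norm_sub_le (hα : 1 / 3 < α) (hX : IsRoughPath α a b x X) (hg : IsCb3 g)
    {φ : ℝ → Euc d} (h : HolderOnSimplex (3 * α) (fun s t =>
      ‖φ t - φ s - localIncrement x X (fun u => g (φ u)) (gDeriv g φ) s t‖) a b) :
    IsPureSolution α a b x X g φ := by
  have hα0 : 0 < α := by linarith
  have n1 := supD_nonneg g 1
  have n2 := supD_nonneg g 2
  have n0 := supD_nonneg g 0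
  have hrem : HolderOnSimplex (2 * α) (fun s t => ‖remainder x φ (fun u => g (φ u)) s t‖) a b := by
    have h2 : HolderOnSimplex (2 * α + α) (fun s t =>
        ‖φ t - φ s - localIncrement x X (fun u => g (φ u)) (gDeriv g φ) s t‖) a b := by
      rwa [show 2 * α + α = 3 * α by ring]
    refine ((hX.holder_area.const_mul (mul_nonneg n1 n0)).add
      (h2.of_exponent_add (by linarith) hα0.le)).mono fun s t _ _ _ => ?_
    have e : remainder x φ (fun u => g (φ u)) s t = contract (gDeriv g φ s) (X s t) +
        (φ t - φ s - localIncrement x X (fun u => g (φ u)) (gDeriv g φ) s t) := by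
      simp only [remainder, localIncrement]; abel
    rw [e]
    exact (norm_add_le _ _).trans (add_le_add ((norm_contract_le _ _).trans
      (mul_le_mul_of_nonneg_right (hg.norm_fieldDeriv_le' _) (tensorNorm_nonneg _))) le_rfl)
  have hpath : HolderOnSimplex α (fun s t => ‖φ t - φ s‖) a b := by
    have h2 : HolderOnSimplex (α + α) (fun s t =>
        ‖remainder x φ (fun u => g (φ u)) s t‖) a b := by rwa [← two_mul]
    exact ((hX.holder_path.const_mul n0).add (h2.of_exponent_add hα0.le hα0.le)).mono
      fun s t _ _ _ => (norm_increment_le (x := x) φ (fun u => g (φ u)) s t).trans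
        (add_le_add (mul_le_mul_of_nonneg_right (hg.norm_le _) (norm_nonneg _)) le_rfl)
  exact ⟨⟨hpath, (hpath.const_mul n1).mono fun s t _ _ _ => hg.lipschitz _ _, hrem⟩,
    fun t ht => hasRoughIntegral_of_norm_sub_le (by linarith) h ht.1 ht.2⟩

/-- One step of the second order Euler scheme. -/
noncomputable def eulerStep (x : ℝ → Euc m) (X : ℝ → ℝ → Euc m ⊗[ℝ] Euc m)
    (g : Euc d → Euc m →L[ℝ] Euc d) (s t : ℝ) (y : Euc d) : Euc d :=
  y + (g y (x t - x s) + contract (fieldDeriv g y) (X s t))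

/-- The cross term in Chen's relation supplies the linear Taylor term of g. What remains pairs
orders 2α and α in the first summand, α and 2α in the second. -/
theorem eulerStep_eulerStep_sub (hX : IsRoughPath α a b x X) {s u t : ℝ} (has : a ≤ s)
    (hsu : s ≤ u) (hut : u ≤ t) (htb : t ≤ b) (y : Euc d) :
    eulerStep x X g u t (eulerStep x X g s u y) - eulerStep x X g s t y =
      (g (eulerStep x X g s u y) - g y - fderiv ℝ g y (g y (x u - x s))) (x t - x u) +
      contract (fieldDeriv g (eulerStep x X g s u y) - fieldDeriv g y) (X u t) := by
  set y' := eulerStep x X g s u y with hy'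
  have e : y' = y + (g y (x u - x s) + contract (fieldDeriv g y) (X s u)) := rfl
  have hx : x t - x s = (x t - x u) + (x u - x s) := by abel
  have hD : fieldDeriv g y (x u - x s) (x t - x u) =
      fderiv ℝ g y (g y (x u - x s)) (x t - x u) := rfl
  simp only [eulerStep, hX.area_eq has hsu hut htb, contract_add_right, contract_tmul,
    contract_sub_left, sub_apply]
  rw [hx, map_add, hD]
  nth_rewrite 1 [e]
  abel

theorem isAlmostFlow_eulerStep (hα : 0 < α) (hab : a ≤ b) (hX : IsRoughPath α a b x X)
    (hg : IsCb3 g) : ∃ κ D : ℝ, 0 ≤ κ ∧ 0 ≤ D ∧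
      IsAlmostFlow a b α κ D (3 * α) (eulerStep x X g) := by
  have n1 := supD_nonneg g 1
  have n2 := supD_nonneg g 2
  have n0 := supD_nonneg g 0
  obtain ⟨c₁, hc₁, h₁⟩ := hX.holder_path.exists_pos
  obtain ⟨c₂, hc₂, h₂⟩ := hX.holder_area.exists_pos
  set T := (b - a) ^ α with hT
  have hT0 : 0 ≤ T := Real.rpow_nonneg (sub_nonneg.2 hab) _
  set H := supD g 2 * supD g 0 + supD g 1 ^ 2 with hH
  have hH0 : 0 ≤ H := by positivity
  have h2T : ∀ s t, a ≤ s → s ≤ t → t ≤ b → (t - s) ^ (2 * α) ≤ T * (t - s) ^ α := by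
    intro s t has hst htb
    have := rpow_add_le_mul (l := t - s) (T := b - a) (by linarith) (by linarith) hα.le hα.le
    rwa [← two_mul] at this
  have hstep : ∀ s t y, a ≤ s → s ≤ t → t ≤ b → ‖eulerStep x X g s t y - y‖ ≤
      (supD g 0 * c₁ + supD g 1 * supD g 0 * (c₂ * T)) * (t - s) ^ α := by
    intro s t y has hst htb
    have a1 := norm_apply_le (hg.norm_le y) (x t - x s)
    have a2 := (norm_contract_le (fieldDeriv g y) (X s t)).trans
      (mul_le_mul_of_nonneg_right (hg.norm_fieldDeriv_le' y) (tensorNorm_nonneg _))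
    have a3 := mul_le_mul_of_nonneg_left (h₁ s t has hst htb) n0
    have a4 := mul_le_mul_of_nonneg_left ((h₂ s t has hst htb).trans
      (mul_le_mul_of_nonneg_left (h2T s t has hst htb) hc₂.le)) (mul_nonneg n1 n0)
    rw [eulerStep, add_sub_cancel_left]
    refine (norm_add_le _ _).trans ?_
    linarith
  set B := supD g 0 * c₁ + supD g 1 * supD g 0 * (c₂ * T) with hB
  have hB0 : 0 ≤ B := by positivity
  refine ⟨supD g 1 * c₁ + H * (c₂ * T),
    (supD g 1 * (supD g 1 * supD g 0 * c₂) + supD g 2 * B * (supD g 0 * c₁)) * c₁ + H * B * c₂,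
    by positivity, by positivity, ?_, ?_, ?_, ?_⟩
  · intro s y has hsb
    simp [eulerStep, hX.area_self has hsb, contract]
  · intro s t y z has hst htb
    have a1 : ‖(g y - g z) (x t - x s)‖ ≤ supD g 1 * ‖y - z‖ * (c₁ * (t - s) ^ α) :=
      (norm_apply_le (hg.lipschitz y z) _).trans
        (mul_le_mul_of_nonneg_left (h₁ s t has hst htb) (by positivity))
    have a2 : ‖contract (fieldDeriv g y - fieldDeriv g z) (X s t)‖ ≤
        H * ‖y - z‖ * (c₂ * (T * (t - s) ^ α)) :=
      (norm_contract_le _ _).trans (mul_le_mul (hg.lipschitz_fieldDeriv y z)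
        ((h₂ s t has hst htb).trans (mul_le_mul_of_nonneg_left (h2T s t has hst htb) hc₂.le))
        (tensorNorm_nonneg _) (by positivity))
    have e : eulerStep x X g s t y - eulerStep x X g s t z = (y - z) +
        (g y - g z) (x t - x s) + contract (fieldDeriv g y - fieldDeriv g z) (X s t) := by
      simp only [eulerStep, sub_apply, contract_sub_left]; abel
    rw [e]
    refine norm_add₃_le.trans ?_
    linarith
  · intro s u t y has hsu hut htb
    have l1 : (u - s) ^ α ≤ (t - s) ^ α :=
      Real.rpow_le_rpow (by linarith) (by linarith) hα.le
    have l2 : (u - s) ^ (2 * α) ≤ (t - s) ^ (2 * α) :=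
      Real.rpow_le_rpow (by linarith) (by linarith) (by linarith)
    have l3 : (t - u) ^ α ≤ (t - s) ^ α :=
      Real.rpow_le_rpow (by linarith) (by linarith) hα.le
    have l4 : (t - u) ^ (2 * α) ≤ (t - s) ^ (2 * α) :=
      Real.rpow_le_rpow (by linarith) (by linarith) (by linarith)
    have hst0 : 0 ≤ t - s := by linarith
    have p1 := Real.rpow_nonneg hst0 α
    have p2 := Real.rpow_nonneg hst0 (2 * α)
    set y' := eulerStep x X g s u y with hy'
    have b1 : ‖x u - x s‖ ≤ c₁ * (t - s) ^ α :=
      (h₁ s u has hsu (hut.trans htb)).trans (mul_le_mul_of_nonneg_left l1 hc₁.le)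
    have b2 : tensorNorm (X s u) ≤ c₂ * (t - s) ^ (2 * α) :=
      (h₂ s u has hsu (hut.trans htb)).trans (mul_le_mul_of_nonneg_left l2 hc₂.le)
    have b3 : ‖x t - x u‖ ≤ c₁ * (t - s) ^ α :=
      (h₁ u t (has.trans hsu) hut htb).trans (mul_le_mul_of_nonneg_left l3 hc₁.le)
    have b4 : tensorNorm (X u t) ≤ c₂ * (t - s) ^ (2 * α) :=
      (h₂ u t (has.trans hsu) hut htb).trans (mul_le_mul_of_nonneg_left l4 hc₂.le)
    have b5 : ‖y' - y‖ ≤ B * (t - s) ^ α :=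
      (hstep s u y has hsu (hut.trans htb)).trans (mul_le_mul_of_nonneg_left l1 hB0)
    have tay := norm_taylor_le hg.differentiable hg.norm_fderiv_le hg.lipschitz_fderiv n2 y
      (y' - y) (g y (x u - x s))
    have e : y' - y - g y (x u - x s) = contract (fieldDeriv g y) (X s u) := by
      rw [hy', eulerStep]; abel
    rw [add_sub_cancel, e] at tay
    have q1 : ‖contract (fieldDeriv g y) (X s u)‖ ≤
        supD g 1 * supD g 0 * (c₂ * (t - s) ^ (2 * α)) :=
      (norm_contract_le _ _).trans (mul_le_mul (hg.norm_fieldDeriv_le' y) b2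
        (tensorNorm_nonneg _) (by positivity))
    have q2 : ‖g y (x u - x s)‖ ≤ supD g 0 * (c₁ * (t - s) ^ α) :=
      (norm_apply_le (hg.norm_le y) _).trans (mul_le_mul_of_nonneg_left b1 n0)
    have pp : (t - s) ^ (2 * α) = (t - s) ^ α * (t - s) ^ α := by
      rw [two_mul, Real.rpow_add_of_nonneg hst0 hα.le hα.le]
    have ppp : (t - s) ^ (3 * α) = (t - s) ^ α * (t - s) ^ α * (t - s) ^ α := by
      rw [show 3 * α = α + α + α by ring, Real.rpow_add_of_nonneg hst0 (by linarith) hα.le,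
        Real.rpow_add_of_nonneg hst0 hα.le hα.le]
    have q3 := mul_le_mul (mul_le_mul_of_nonneg_left b5 n2) q2 (norm_nonneg _) (by positivity)
    have q4 : ‖g y' - g y - fderiv ℝ g y (g y (x u - x s))‖ ≤
        (supD g 1 * (supD g 1 * supD g 0 * c₂) + supD g 2 * B * (supD g 0 * c₁)) *
          (t - s) ^ (2 * α) := by
      have := mul_le_mul_of_nonneg_left q1 n1
      rw [pp] at this ⊢
      linarith
    have r1 := (ContinuousLinearMap.le_opNorm (g y' - g y - fderiv ℝ g y (g y (x u - x s)))
      (x t - x u)).trans (mul_le_mul q4 b3 (norm_nonneg _) (by positivity))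
    have r2 := (norm_contract_le (fieldDeriv g y' - fieldDeriv g y) (X u t)).trans
      (mul_le_mul ((hg.lipschitz_fieldDeriv y' y).trans (mul_le_mul_of_nonneg_left b5 hH0)) b4
        (tensorNorm_nonneg _) (by positivity))
    rw [eulerStep_eulerStep_sub hX has hsu hut htb, ← hy']
    refine ((norm_add_le _ _).trans (add_le_add r1 r2)).trans (le_of_eq ?_)
    rw [ppp, pp]; ring
  · refine ⟨B * T, fun s t y has hst htb => (hstep s t y has hst htb).trans
      (mul_le_mul_of_nonneg_left ?_ hB0)⟩
    exact Real.rpow_le_rpow (by linarith) (by linarith) hα.le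

theorem exists_isPureSolution (hα : 1 / 3 < α) (hab : a ≤ b) (hX : IsRoughPath α a b x X)
    (hg : IsCb3 g) (ξ : Euc d) : ∃ φ, IsPureSolution α a b x X g φ ∧ φ a = ξ := by
  obtain ⟨κ, D, hκ, hD, hF⟩ := isAlmostFlow_eulerStep (by linarith : 0 < α) hab hX hg
  obtain ⟨φ, K, hφ, h⟩ := hF.exists_path (by linarith) (by linarith) hκ hD hab ξ
  refine ⟨φ, isPureSolution_of_norm_sub_le hα hX hg ⟨K, fun s t has hst htb => ?_⟩, hφ⟩
  have := h s t has hst htb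
  rw [eulerStep, ← sub_sub] at this
  exact this

end existence

/-! ### The linearized equation -/

/-- The constant K need not be proportional to the size of ζ. Bisection replaces it by a multiple of
the supremum of ‖ζ‖; on a short interval starting at a zero of ζ this forces the supremum to halve.
-/
theorem eq_zero_of_linear_almost_flow {E : Type*} [NormedAddCommGroup E] {a b α κ D θ : ℝ}
    {F : ℝ → ℝ → E → E} (hα : 0 < α) (hθ : 1 < θ) (hκ : 0 ≤ κ) (hD : 0 ≤ D)
    (zero : ∀ s t, F s t 0 = 0)
    (lip : ∀ s t y z, a ≤ s → s ≤ t → t ≤ b →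
      ‖F s t y - F s t z‖ ≤ (1 + κ * (t - s) ^ α) * ‖y - z‖)
    (flow : ∀ s u t y, a ≤ s → s ≤ u → u ≤ t → t ≤ b →
      ‖F u t (F s u y) - F s t y‖ ≤ D * ‖y‖ * (t - s) ^ θ)
    {ζ : ℝ → E} {K M : ℝ}
    (hζ : ∀ s t, a ≤ s → s ≤ t → t ≤ b → ‖ζ t - F s t (ζ s)‖ ≤ K * (t - s) ^ θ)
    (hM : ∀ s, a ≤ s → s ≤ b → ‖ζ s‖ ≤ M) (ha : ζ a = 0) {t : ℝ} (hat : a ≤ t) (htb : t ≤ b) :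
    ζ t = 0 := by
  obtain ⟨δ₁, hδ₁, hc⟩ := exists_small_contraction hα hθ κ
  set L := 1 + κ * δ₁ ^ α with hL
  have hL1 : 1 ≤ L := by
    have := mul_nonneg hκ (Real.rpow_nonneg hδ₁.le α)
    linarith
  set r := (2⁻¹ : ℝ) ^ θ with hr
  have hr0 : 0 < r := by positivity
  have hρ1 : (L + 1) * r < 1 := by
    refine lt_of_le_of_lt (mul_le_mul_of_nonneg_right ?_ hr0.le) hc
    nlinarith
  have hρ0 : 0 ≤ (L + 1) * r := by positivity
  set ρ := (L + 1) * r with hρ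
  -- If N bounds ζ, one bisection maps a constant P to ρP + DN, with fixed point QN.
  set Q := D / (1 - ρ) with hQ
  have hden : 0 < 1 - ρ := by linarith
  have hQ0 : 0 ≤ Q := div_nonneg hD hden.le
  have hQe : ρ * Q + D = Q := by rw [hQ]; field_simp; ring
  -- choice of the step
  set δ := min δ₁ ((1 / (2 * (Q + 1))) ^ (1 / θ)) with hδ
  have hδ0 : 0 < δ := lt_min hδ₁ (by positivity)
  have hδQ : Q * δ ^ θ ≤ 1 / 2 := by
    have h1 : δ ^ θ ≤ 1 / (2 * (Q + 1)) := by
      refine (Real.rpow_le_rpow hδ0.le (min_le_right _ _) (by linarith)).trans ?_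
      rw [← Real.rpow_mul (by positivity), one_div_mul_cancel (by linarith), Real.rpow_one]
    have h2 := mul_le_mul_of_nonneg_left h1 hQ0
    refine h2.trans ?_
    rw [mul_one_div, div_le_div_iff₀ (by positivity) (by norm_num)]
    linarith
  have local_zero : ∀ s₀, a ≤ s₀ → s₀ ≤ b → ζ s₀ = 0 → ∀ t, s₀ ≤ t → t ≤ b → t - s₀ ≤ δ →
      ζ t = 0 := by
    intro s₀ has₀ hs₀b h0
    have improve : ∀ N : ℝ, 0 ≤ N → (∀ t, s₀ ≤ t → t ≤ b → t - s₀ ≤ δ → ‖ζ t‖ ≤ N) →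
        ∀ t, s₀ ≤ t → t ≤ b → t - s₀ ≤ δ → ‖ζ t‖ ≤ 1 / 2 * N := by
      intro N hN0 hN
      have iter : ∀ n : ℕ, ∀ s t, s₀ ≤ s → s ≤ t → t ≤ b → t - s₀ ≤ δ →
          ‖ζ t - F s t (ζ s)‖ ≤ (ρ ^ n * |K| + Q * N) * (t - s) ^ θ := by
        intro n
        induction n with
        | zero =>
          intro s t hs hst htb _
          refine (hζ s t (has₀.trans hs) hst htb).trans (mul_le_mul_of_nonneg_right ?_
            (Real.rpow_nonneg (sub_nonneg.2 hst) _))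
          have := le_abs_self K
          have := mul_nonneg hQ0 hN0
          linarith
        | succ n ih =>
          intro s t hs hst htb hlen
          set u := (s + t) / 2 with hu
          have hsu : s ≤ u := by rw [hu]; linarith
          have hut : u ≤ t := by rw [hu]; linarith
          have r1 := IsAlmostFlow.half_rpow_le (θ := θ) (l := t - s) (l' := u - s) (by linarith)
            (by rw [hu]; linarith) (by linarith)
          have r2 := IsAlmostFlow.half_rpow_le (θ := θ) (l := t - s) (l' := t - u) (by linarith)
            (by rw [hu]; linarith) (by linarith)
          rw [← hr] at r1 r2
          set P := ρ ^ n * |K| + Q * N with hP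
          have hP0 : 0 ≤ P := by positivity
          have p1 := (ih s u hs hsu (hut.trans htb) (by linarith)).trans
            (mul_le_mul_of_nonneg_left r1 hP0)
          have p2 := (ih u t (hs.trans hsu) hut htb hlen).trans
            (mul_le_mul_of_nonneg_left r2 hP0)
          have hLu : 1 + κ * (t - u) ^ α ≤ L := by
            have := mul_le_mul_of_nonneg_left (Real.rpow_le_rpow (sub_nonneg.2 hut)
              (by linarith [min_le_left δ₁ ((1 / (2 * (Q + 1))) ^ (1 / θ))] : t - u ≤ δ₁) hα.le) hκ
            linarith
          have p3 := (lip u t (ζ u) (F s u (ζ s)) (by linarith) hut htb).trans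
            (mul_le_mul hLu p1 (norm_nonneg _) (by linarith))
          have p4 := (flow s u t (ζ s) (has₀.trans hs) hsu hut htb).trans
            (mul_le_mul_of_nonneg_right (mul_le_mul_of_nonneg_left
              (hN s hs (hst.trans htb) (by linarith)) hD) (Real.rpow_nonneg (sub_nonneg.2 hst) _))
          have e : ζ t - F s t (ζ s) = (ζ t - F u t (ζ u)) +
              (F u t (ζ u) - F u t (F s u (ζ s))) + (F u t (F s u (ζ s)) - F s t (ζ s)) := by abel
          rw [e]
          refine norm_add₃_le.trans ((add_le_add (add_le_add p2 p3) p4).trans (le_of_eq ?_))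
          have e2 : ρ ^ (n + 1) * |K| + Q * N = ρ * P + D * N := by
            rw [hP]; linear_combination (-N) * hQe
          rw [e2, hρ]; ring
      -- After infinitely many bisections K has disappeared, and the step from s₀ starts at zero.
      have lim : ∀ t, s₀ ≤ t → t ≤ b → t - s₀ ≤ δ → ‖ζ t‖ ≤ Q * N * (t - s₀) ^ θ := by
        intro t hst htb hlen
        have h1 : Filter.Tendsto (fun n : ℕ => (ρ ^ n * |K| + Q * N) * (t - s₀) ^ θ) Filter.atTop
            (nhds ((0 * |K| + Q * N) * (t - s₀) ^ θ)) :=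
          (((tendsto_pow_atTop_nhds_zero_of_lt_one hρ0 hρ1).mul_const _).add_const _).mul_const _
        rw [zero_mul, zero_add] at h1
        refine ge_of_tendsto' h1 fun n => ?_
        have := iter n s₀ t le_rfl hst htb hlen
        rwa [h0, zero, sub_zero] at this
      intro t hst htb hlen
      refine (lim t hst htb hlen).trans ?_
      have h1 := Real.rpow_le_rpow (sub_nonneg.2 hst) hlen (by linarith : 0 ≤ θ)
      have h2 := mul_le_mul_of_nonneg_left h1 (mul_nonneg hQ0 hN0)
      have h3 := mul_le_mul_of_nonneg_right hδQ hN0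
      linarith
    have hM0 : 0 ≤ M := (norm_nonneg _).trans (hM s₀ has₀ hs₀b)
    have all : ∀ n : ℕ, ∀ t, s₀ ≤ t → t ≤ b → t - s₀ ≤ δ → ‖ζ t‖ ≤ (1 / 2 : ℝ) ^ n * M := by
      intro n
      induction n with
      | zero => intro t hst htb _; simpa using hM t (has₀.trans hst) htb
      | succ n ih =>
        intro t hst htb hlen
        have := improve _ (by positivity) ih t hst htb hlen
        rwa [pow_succ', mul_assoc]
    intro t hst htb hlen
    have h1 : Filter.Tendsto (fun n : ℕ => (1 / 2 : ℝ) ^ n * M) Filter.atTop (nhds (0 * M)) :=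
      (tendsto_pow_atTop_nhds_zero_of_lt_one (by norm_num) (by norm_num)).mul_const _
    rw [zero_mul] at h1
    exact norm_le_zero_iff.1 (ge_of_tendsto' h1 fun n => all n t hst htb hlen)
  have steps : ∀ k : ℕ, ∀ t, a ≤ t → t ≤ b → t - a ≤ k * δ → ζ t = 0 := by
    intro k
    induction k with
    | zero =>
      intro t hat htb h
      have : t = a := by norm_num at h; linarith
      rw [this, ha]
    | succ k ih =>
      intro t hat htb h
      push_cast at h
      have hs : ζ (max a (t - δ)) = 0 := by
        refine ih _ (le_max_left _ _) (max_le (hat.trans htb) (by linarith)) ?_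
        rcases max_cases a (t - δ) with ⟨e, _⟩ | ⟨e, _⟩ <;> rw [e]
        · simp only [sub_self]; positivity
        · linarith
      exact local_zero _ (le_max_left _ _) (max_le (hat.trans htb) (by linarith)) hs t
        (max_le hat (by linarith)) htb (by linarith [le_max_right a (t - δ)])
  refine steps ⌈(t - a) / δ⌉₊ t hat htb ?_
  have := Nat.le_ceil ((t - a) / δ)
  rwa [div_le_iff₀ hδ0] at this

namespace IsCb3

variable {m d : ℕ} {g : Euc d → Euc m →L[ℝ] Euc d}

theorem hasFDerivAt_fieldDeriv (hg : IsCb3 g) (y : Euc d) :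
    HasFDerivAt (fieldDeriv g) (fderiv ℝ (fieldDeriv g) y) y ∧
    ∀ ζ, fderiv ℝ (fieldDeriv g) y ζ = (fderiv ℝ g y).comp (fderiv ℝ g y ζ) +
      (fderiv ℝ (fderiv ℝ g) y ζ).comp (g y) := by
  have h := (hg.differentiable_fderiv y).hasFDerivAt.clm_comp (hg.differentiable y).hasFDerivAt
  have h2 : HasFDerivAt (fieldDeriv g) _ y := h
  refine ⟨h2.differentiableAt.hasFDerivAt, fun ζ => ?_⟩
  rw [h2.fderiv]
  ext v w
  simp

theorem symm_fderiv_fderiv (hg : IsCb3 g) (y v w : Euc d) :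
    fderiv ℝ (fderiv ℝ g) y v w = fderiv ℝ (fderiv ℝ g) y w v := by
  have h : IsSymmSndFDerivAt ℝ g y :=
    (hg.1.contDiffAt (x := y)).isSymmSndFDerivAt (by simp; norm_num)
  exact h v w

end IsCb3

section linearized

variable {m d : ℕ} {α a b : ℝ} {x : ℝ → Euc m} {X : ℝ → ℝ → Euc m ⊗[ℝ] Euc m}
  {g : Euc d → Euc m →L[ℝ] Euc d} {φ : ℝ → Euc d}

/-- One step of the second order Euler scheme for the equation linearized along `φ`. -/
noncomputable def linearStep (x : ℝ → Euc m) (X : ℝ → ℝ → Euc m ⊗[ℝ] Euc m)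
    (g : Euc d → Euc m →L[ℝ] Euc d) (φ : ℝ → Euc d) (s t : ℝ) (ζ : Euc d) : Euc d :=
  ζ + (fderiv ℝ g (φ s) ζ (x t - x s) + contract (fderiv ℝ (fieldDeriv g) (φ s) ζ) (X s t))

theorem linearStep_add (s t : ℝ) (ζ η : Euc d) :
    linearStep x X g φ s t (ζ + η) = linearStep x X g φ s t ζ + linearStep x X g φ s t η := by
  simp only [linearStep, map_add, add_apply, contract_add_left]
  abel

theorem linearStep_smul (s t c : ℝ) (ζ : Euc d) :
    linearStep x X g φ s t (c • ζ) = c • linearStep x X g φ s t ζ := by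
  simp only [linearStep, map_smul, smul_apply, contract_smul_left, smul_add]

theorem linearStep_zero (s t : ℝ) : linearStep x X g φ s t 0 = 0 := by
  have := linearStep_smul (x := x) (X := X) (g := g) (φ := φ) s t 0 0
  simpa using this

theorem linearStep_sub (s t : ℝ) (ζ η : Euc d) :
    linearStep x X g φ s t (ζ - η) = linearStep x X g φ s t ζ - linearStep x X g φ s t η := by
  rw [eq_sub_iff_add_eq, ← linearStep_add, sub_add_cancel]

theorem IsCb3.norm_fderiv_fieldDeriv_apply_le (hg : IsCb3 g) (y ζ : Euc d) :
    ‖fderiv ℝ (fieldDeriv g) y ζ‖ ≤ (supD g 1 ^ 2 + supD g 2 * supD g 0) * ‖ζ‖ := by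
  have n1 := supD_nonneg g 1
  have n2 := supD_nonneg g 2
  rw [(hg.hasFDerivAt_fieldDeriv y).2 ζ]
  have a1 := (ContinuousLinearMap.opNorm_comp_le (fderiv ℝ g y) (fderiv ℝ g y ζ)).trans
    (mul_le_mul (hg.norm_fderiv_le y) (norm_apply_le (hg.norm_fderiv_le y) ζ) (norm_nonneg _) n1)
  have a2 := (ContinuousLinearMap.opNorm_comp_le (fderiv ℝ (fderiv ℝ g) y ζ) (g y)).trans
    (mul_le_mul (norm_apply_le (hg.norm_fderiv_fderiv_le y) ζ) (hg.norm_le y) (norm_nonneg _)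
      (by positivity))
  refine (norm_add_le _ _).trans ((add_le_add a1 a2).trans (le_of_eq (by ring)))

theorem IsCb3.norm_fderiv_fieldDeriv_sub_le (hg : IsCb3 g) (y z ζ : Euc d) :
    ‖fderiv ℝ (fieldDeriv g) y ζ - fderiv ℝ (fieldDeriv g) z ζ‖ ≤
      (3 * supD g 2 * supD g 1 + supD g 3 * supD g 0) * ‖y - z‖ * ‖ζ‖ := by
  have n1 := supD_nonneg g 1
  have n2 := supD_nonneg g 2
  have n3 := supD_nonneg g 3
  rw [(hg.hasFDerivAt_fieldDeriv y).2 ζ, (hg.hasFDerivAt_fieldDeriv z).2 ζ]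
  have e : (fderiv ℝ g y).comp (fderiv ℝ g y ζ) + (fderiv ℝ (fderiv ℝ g) y ζ).comp (g y) -
      ((fderiv ℝ g z).comp (fderiv ℝ g z ζ) + (fderiv ℝ (fderiv ℝ g) z ζ).comp (g z)) =
      ((fderiv ℝ g y - fderiv ℝ g z).comp (fderiv ℝ g y ζ) +
        (fderiv ℝ g z).comp ((fderiv ℝ g y - fderiv ℝ g z) ζ)) +
      (((fderiv ℝ (fderiv ℝ g) y - fderiv ℝ (fderiv ℝ g) z) ζ).comp (g y) +
        (fderiv ℝ (fderiv ℝ g) z ζ).comp (g y - g z)) := by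
    ext v w
    simp
    ring
  have a1 := (ContinuousLinearMap.opNorm_comp_le (fderiv ℝ g y - fderiv ℝ g z)
    (fderiv ℝ g y ζ)).trans (mul_le_mul (hg.lipschitz_fderiv y z)
      (norm_apply_le (hg.norm_fderiv_le y) ζ) (norm_nonneg _) (by positivity))
  have a2 := (ContinuousLinearMap.opNorm_comp_le (fderiv ℝ g z)
    ((fderiv ℝ g y - fderiv ℝ g z) ζ)).trans (mul_le_mul (hg.norm_fderiv_le z)
      (norm_apply_le (hg.lipschitz_fderiv y z) ζ) (norm_nonneg _) (by positivity))
  have a3 := (ContinuousLinearMap.opNorm_comp_le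
    ((fderiv ℝ (fderiv ℝ g) y - fderiv ℝ (fderiv ℝ g) z) ζ) (g y)).trans
      (mul_le_mul (norm_apply_le (hg.lipschitz_fderiv_fderiv y z) ζ) (hg.norm_le y)
        (norm_nonneg _) (by positivity))
  have a4 := (ContinuousLinearMap.opNorm_comp_le
    (fderiv ℝ (fderiv ℝ g) z ζ) (g y - g z)).trans
      (mul_le_mul (norm_apply_le (hg.norm_fderiv_fderiv_le z) ζ) (hg.lipschitz y z)
        (norm_nonneg _) (by positivity))
  rw [e]
  refine (norm_add_le _ _).trans ((add_le_add ((norm_add_le _ _).trans (add_le_add a1 a2))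
    ((norm_add_le _ _).trans (add_le_add a3 a4))).trans (le_of_eq (by ring)))

/-- The cross term in Chen's relation now cancels the linear Taylor term of Dg along φ as well;
matching the two requires the symmetry of D²g. -/
theorem linearStep_linearStep_sub (hX : IsRoughPath α a b x X) (hg : IsCb3 g) {s u t : ℝ}
    (has : a ≤ s) (hsu : s ≤ u) (hut : u ≤ t) (htb : t ≤ b) (ζ : Euc d) :
    linearStep x X g φ u t (linearStep x X g φ s u ζ) - linearStep x X g φ s t ζ =
      ((fderiv ℝ g (φ u) - fderiv ℝ g (φ s)) (linearStep x X g φ s u ζ - ζ) +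
        fderiv ℝ g (φ s) (contract (fderiv ℝ (fieldDeriv g) (φ s) ζ) (X s u)) +
        (fderiv ℝ g (φ u) - fderiv ℝ g (φ s) -
          fderiv ℝ (fderiv ℝ g) (φ s) (g (φ s) (x u - x s))) ζ) (x t - x u) +
      contract (fderiv ℝ (fieldDeriv g) (φ u) (linearStep x X g φ s u ζ - ζ) +
        (fderiv ℝ (fieldDeriv g) (φ u) ζ - fderiv ℝ (fieldDeriv g) (φ s) ζ)) (X u t) := by
  set η := linearStep x X g φ s u ζ with hη
  have e : η = ζ + (fderiv ℝ g (φ s) ζ (x u - x s) +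
    contract (fderiv ℝ (fieldDeriv g) (φ s) ζ) (X s u)) := rfl
  have hx : x t - x s = (x t - x u) + (x u - x s) := by abel
  have hB : fderiv ℝ (fieldDeriv g) (φ s) ζ (x u - x s) (x t - x u) =
      fderiv ℝ g (φ s) (fderiv ℝ g (φ s) ζ (x u - x s)) (x t - x u) +
        fderiv ℝ (fderiv ℝ g) (φ s) (g (φ s) (x u - x s)) ζ (x t - x u) := by
    rw [(hg.hasFDerivAt_fieldDeriv (φ s)).2 ζ, hg.symm_fderiv_fderiv (φ s) _ ζ]
    simp
  have hw : contract (fderiv ℝ (fieldDeriv g) (φ s) ζ) (X s u) =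
      η - ζ - fderiv ℝ g (φ s) ζ (x u - x s) := by rw [e]; abel
  simp only [linearStep, hX.area_eq has hsu hut htb, contract_add_right, contract_tmul,
    contract_sub_left, contract_add_left, sub_apply, add_apply]
  rw [hx, map_add, hB, hw]
  simp only [map_sub, sub_apply, contract_sub_left]
  abel

/-- The linearized Euler scheme along a solution is an almost flow. -/
theorem exists_linearStep_bounds (hα : 0 < α) (hab : a ≤ b) (hX : IsRoughPath α a b x X)
    (hg : IsCb3 g) (hφ : IsPureSolution α a b x X g φ) : ∃ κ D : ℝ, 0 ≤ κ ∧ 0 ≤ D ∧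
      (∀ s t y z, a ≤ s → s ≤ t → t ≤ b →
        ‖linearStep x X g φ s t y - linearStep x X g φ s t z‖ ≤
          (1 + κ * (t - s) ^ α) * ‖y - z‖) ∧
      ∀ s u t y, a ≤ s → s ≤ u → u ≤ t → t ≤ b →
        ‖linearStep x X g φ u t (linearStep x X g φ s u y) - linearStep x X g φ s t y‖ ≤
          D * ‖y‖ * (t - s) ^ (3 * α) := by
  have n1 := supD_nonneg g 1
  have n2 := supD_nonneg g 2
  have n0 := supD_nonneg g 0
  have n3 := supD_nonneg g 3
  obtain ⟨c₁, hc₁, h₁⟩ := hX.holder_path.exists_pos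
  obtain ⟨c₂, hc₂, h₂⟩ := hX.holder_area.exists_pos
  obtain ⟨c₃, hc₃, h₃⟩ := hφ.controlled.holder_path.exists_pos
  obtain ⟨c₄, hc₄, h₄⟩ := hφ.controlled.holder_remainder.exists_pos
  set T := (b - a) ^ α with hT
  have hT0 : 0 ≤ T := Real.rpow_nonneg (sub_nonneg.2 hab) _
  set H := supD g 1 ^ 2 + supD g 2 * supD g 0 with hH
  have hH0 : 0 ≤ H := by positivity
  set G := 3 * supD g 2 * supD g 1 + supD g 3 * supD g 0 with hG
  have hG0 : 0 ≤ G := by positivity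
  set κ := supD g 1 * c₁ + H * (c₂ * T) with hκ
  have hκ0 : 0 ≤ κ := by positivity
  have hstep : ∀ s t y, a ≤ s → s ≤ t → t ≤ b → ‖linearStep x X g φ s t y - y‖ ≤
      κ * (t - s) ^ α * ‖y‖ := by
    intro s t y has hst htb
    have l2 : (t - s) ^ (2 * α) ≤ T * (t - s) ^ α := by
      have := rpow_add_le_mul (l := t - s) (T := b - a) (by linarith) (by linarith) hα.le hα.le
      rwa [← two_mul] at this
    have a1 : ‖fderiv ℝ g (φ s) y (x t - x s)‖ ≤ supD g 1 * ‖y‖ * (c₁ * (t - s) ^ α) :=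
      (norm_apply_le (norm_apply_le (hg.norm_fderiv_le (φ s)) y) _).trans
        (mul_le_mul_of_nonneg_left (h₁ s t has hst htb) (by positivity))
    have a2 : ‖contract (fderiv ℝ (fieldDeriv g) (φ s) y) (X s t)‖ ≤
        H * ‖y‖ * (c₂ * (T * (t - s) ^ α)) :=
      (norm_contract_le _ _).trans (mul_le_mul (hg.norm_fderiv_fieldDeriv_apply_le _ _)
        ((h₂ s t has hst htb).trans (mul_le_mul_of_nonneg_left l2 hc₂.le))
        (tensorNorm_nonneg _) (by positivity))
    rw [linearStep, add_sub_cancel_left]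
    refine (norm_add_le _ _).trans ((add_le_add a1 a2).trans (le_of_eq ?_))
    rw [hκ]; ring
  refine ⟨κ, (supD g 2 * c₃ * κ + supD g 1 * (H * c₂) +
    (supD g 2 * c₄ + supD g 3 * c₃ * (supD g 0 * c₁))) * c₁ + (H * κ + G * c₃) * c₂,
    hκ0, by positivity, ?_, ?_⟩
  · intro s t y z has hst htb
    rw [← linearStep_sub]
    have e : linearStep x X g φ s t (y - z) =
        (y - z) + (linearStep x X g φ s t (y - z) - (y - z)) := by abel
    rw [e]
    refine (norm_add_le _ _).trans ?_
    have := hstep s t (y - z) has hst htb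
    linarith
  · intro s u t y has hsu hut htb
    have l1 : (u - s) ^ α ≤ (t - s) ^ α :=
      Real.rpow_le_rpow (by linarith) (by linarith) hα.le
    have l2 : (u - s) ^ (2 * α) ≤ (t - s) ^ (2 * α) :=
      Real.rpow_le_rpow (by linarith) (by linarith) (by linarith)
    have l3 : (t - u) ^ α ≤ (t - s) ^ α :=
      Real.rpow_le_rpow (by linarith) (by linarith) hα.le
    have l4 : (t - u) ^ (2 * α) ≤ (t - s) ^ (2 * α) :=
      Real.rpow_le_rpow (by linarith) (by linarith) (by linarith)
    have hst0 : 0 ≤ t - s := by linarith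
    have hub := hut.trans htb
    have p1 := Real.rpow_nonneg hst0 α
    have p2 := Real.rpow_nonneg hst0 (2 * α)
    have pp : (t - s) ^ (2 * α) = (t - s) ^ α * (t - s) ^ α := by
      rw [two_mul, Real.rpow_add_of_nonneg hst0 hα.le hα.le]
    have ppp : (t - s) ^ (3 * α) = (t - s) ^ α * (t - s) ^ α * (t - s) ^ α := by
      rw [show 3 * α = α + α + α by ring, Real.rpow_add_of_nonneg hst0 (by linarith) hα.le,
        Real.rpow_add_of_nonneg hst0 hα.le hα.le]
    set w := linearStep x X g φ s u y - y with hw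
    have b1 : ‖x u - x s‖ ≤ c₁ * (t - s) ^ α :=
      (h₁ s u has hsu hub).trans (mul_le_mul_of_nonneg_left l1 hc₁.le)
    have b2 : tensorNorm (X s u) ≤ c₂ * (t - s) ^ (2 * α) :=
      (h₂ s u has hsu hub).trans (mul_le_mul_of_nonneg_left l2 hc₂.le)
    have b3 : ‖x t - x u‖ ≤ c₁ * (t - s) ^ α :=
      (h₁ u t (has.trans hsu) hut htb).trans (mul_le_mul_of_nonneg_left l3 hc₁.le)
    have b4 : tensorNorm (X u t) ≤ c₂ * (t - s) ^ (2 * α) :=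
      (h₂ u t (has.trans hsu) hut htb).trans (mul_le_mul_of_nonneg_left l4 hc₂.le)
    have b5 : ‖φ u - φ s‖ ≤ c₃ * (t - s) ^ α :=
      (h₃ s u has hsu hub).trans (mul_le_mul_of_nonneg_left l1 hc₃.le)
    have b6 : ‖remainder x φ (fun u => g (φ u)) s u‖ ≤ c₄ * (t - s) ^ (2 * α) :=
      (h₄ s u has hsu hub).trans (mul_le_mul_of_nonneg_left l2 hc₄.le)
    have b7 : ‖w‖ ≤ κ * (t - s) ^ α * ‖y‖ := (hstep s u y has hsu hub).trans
      (mul_le_mul_of_nonneg_right (mul_le_mul_of_nonneg_left l1 hκ0) (norm_nonneg _))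
    have q1 : ‖(fderiv ℝ g (φ u) - fderiv ℝ g (φ s)) w‖ ≤
        supD g 2 * c₃ * κ * (t - s) ^ (2 * α) * ‖y‖ := by
      have := (ContinuousLinearMap.le_opNorm (fderiv ℝ g (φ u) - fderiv ℝ g (φ s)) w).trans
        (mul_le_mul ((hg.lipschitz_fderiv _ _).trans (mul_le_mul_of_nonneg_left b5 n2)) b7
          (norm_nonneg _) (by positivity))
      rw [pp]; linarith
    have q2 : ‖fderiv ℝ g (φ s) (contract (fderiv ℝ (fieldDeriv g) (φ s) y) (X s u))‖ ≤
        supD g 1 * (H * c₂) * (t - s) ^ (2 * α) * ‖y‖ := by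
      have h1 := (norm_contract_le (fderiv ℝ (fieldDeriv g) (φ s) y) (X s u)).trans
        (mul_le_mul (hg.norm_fderiv_fieldDeriv_apply_le (φ s) y) b2 (tensorNorm_nonneg _)
          (by positivity))
      have h2 := (norm_apply_le (hg.norm_fderiv_le (φ s))
        (contract (fderiv ℝ (fieldDeriv g) (φ s) y) (X s u))).trans
          (mul_le_mul_of_nonneg_left h1 n1)
      linarith
    have q3 : ‖(fderiv ℝ g (φ u) - fderiv ℝ g (φ s) -
        fderiv ℝ (fderiv ℝ g) (φ s) (g (φ s) (x u - x s))) y‖ ≤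
        (supD g 2 * c₄ + supD g 3 * c₃ * (supD g 0 * c₁)) * (t - s) ^ (2 * α) * ‖y‖ := by
      have tay := norm_taylor_le hg.differentiable_fderiv hg.norm_fderiv_fderiv_le
        hg.lipschitz_fderiv_fderiv n3 (φ s) (φ u - φ s) (g (φ s) (x u - x s))
      rw [add_sub_cancel] at tay
      have h1 := (norm_apply_le (hg.norm_le (φ s)) (x u - x s)).trans
        (mul_le_mul_of_nonneg_left b1 n0)
      have h2 := mul_le_mul (mul_le_mul_of_nonneg_left b5 n3) h1 (norm_nonneg _) (by positivity)
      have h3 := mul_le_mul_of_nonneg_left b6 n2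
      simp only [remainder] at h3
      refine norm_apply_le (tay.trans ((add_le_add h3 h2).trans (le_of_eq ?_))) y
      rw [pp]; ring
    have r1 := (ContinuousLinearMap.le_opNorm ((fderiv ℝ g (φ u) - fderiv ℝ g (φ s)) w +
        fderiv ℝ g (φ s) (contract (fderiv ℝ (fieldDeriv g) (φ s) y) (X s u)) +
        (fderiv ℝ g (φ u) - fderiv ℝ g (φ s) -
          fderiv ℝ (fderiv ℝ g) (φ s) (g (φ s) (x u - x s))) y) (x t - x u)).trans
      (mul_le_mul (norm_add₃_le.trans (add_le_add (add_le_add q1 q2) q3)) b3 (norm_nonneg _)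
        (by positivity))
    have q4 : ‖fderiv ℝ (fieldDeriv g) (φ u) w +
        (fderiv ℝ (fieldDeriv g) (φ u) y - fderiv ℝ (fieldDeriv g) (φ s) y)‖ ≤
        (H * κ + G * c₃) * (t - s) ^ α * ‖y‖ := by
      have h1 := (hg.norm_fderiv_fieldDeriv_apply_le (φ u) w).trans
        (mul_le_mul_of_nonneg_left b7 hH0)
      have h2 := (hg.norm_fderiv_fieldDeriv_sub_le (φ u) (φ s) y).trans
        (mul_le_mul_of_nonneg_right (mul_le_mul_of_nonneg_left b5 hG0) (norm_nonneg _))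
      refine (norm_add_le _ _).trans ((add_le_add h1 h2).trans (le_of_eq ?_))
      ring
    have r2 := (norm_contract_le (fderiv ℝ (fieldDeriv g) (φ u) w +
      (fderiv ℝ (fieldDeriv g) (φ u) y - fderiv ℝ (fieldDeriv g) (φ s) y)) (X u t)).trans
      (mul_le_mul q4 b4 (tensorNorm_nonneg _) (by positivity))
    rw [linearStep_linearStep_sub hX hg has hsu hut htb, ← hw]
    refine ((norm_add_le _ _).trans (add_le_add r1 r2)).trans (le_of_eq ?_)
    rw [ppp, pp]; ring

/-- `ζ` solves the equation linearized along `φ`, in the form of an expansion of order `3α`. -/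
structure IsLinearizedSolution (α a b : ℝ) (x : ℝ → Euc m) (X : ℝ → ℝ → Euc m ⊗[ℝ] Euc m)
    (g : Euc d → Euc m →L[ℝ] Euc d) (φ ζ : ℝ → Euc d) : Prop where
  bounded : ∃ M, ∀ s, a ≤ s → s ≤ b → ‖ζ s‖ ≤ M
  expansion : ∃ K, ∀ s t, a ≤ s → s ≤ t → t ≤ b →
    ‖ζ t - linearStep x X g φ s t (ζ s)‖ ≤ K * (t - s) ^ (3 * α)

namespace IsLinearizedSolution

variable {ζ η : ℝ → Euc d}

theorem add (hζ : IsLinearizedSolution α a b x X g φ ζ)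
    (hη : IsLinearizedSolution α a b x X g φ η) :
    IsLinearizedSolution α a b x X g φ (fun t => ζ t + η t) := by
  obtain ⟨⟨M, hM⟩, K, hK⟩ := hζ
  obtain ⟨⟨M', hM'⟩, K', hK'⟩ := hη
  refine ⟨⟨M + M', fun s has hsb => (norm_add_le _ _).trans
    (add_le_add (hM s has hsb) (hM' s has hsb))⟩, K + K', fun s t has hst htb => ?_⟩
  rw [linearStep_add, add_sub_add_comm, add_mul]
  exact (norm_add_le _ _).trans (add_le_add (hK s t has hst htb) (hK' s t has hst htb))

theorem smul (hζ : IsLinearizedSolution α a b x X g φ ζ) (c : ℝ) :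
    IsLinearizedSolution α a b x X g φ (fun t => c • ζ t) := by
  obtain ⟨⟨M, hM⟩, K, hK⟩ := hζ
  refine ⟨⟨|c| * M, fun s has hsb => ?_⟩, |c| * K, fun s t has hst htb => ?_⟩
  · rw [norm_smul, Real.norm_eq_abs]
    exact mul_le_mul_of_nonneg_left (hM s has hsb) (abs_nonneg c)
  · rw [linearStep_smul, ← smul_sub, norm_smul, Real.norm_eq_abs, mul_assoc]
    exact mul_le_mul_of_nonneg_left (hK s t has hst htb) (abs_nonneg c)

theorem eq_of_eq (hα : 1 / 3 < α) (hX : IsRoughPath α a b x X) (hg : IsCb3 g)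
    (hφ : IsPureSolution α a b x X g φ) (hζ : IsLinearizedSolution α a b x X g φ ζ)
    (hη : IsLinearizedSolution α a b x X g φ η) (h : ζ a = η a) {t : ℝ} (hat : a ≤ t)
    (htb : t ≤ b) : ζ t = η t := by
  obtain ⟨κ, D, hκ, hD, lip, flow⟩ :=
    exists_linearStep_bounds (by linarith : 0 < α) (hat.trans htb) hX hg hφ
  obtain ⟨⟨M, hM⟩, K, hK⟩ := hζ.add (hη.smul (-1))
  have := eq_zero_of_linear_almost_flow (by linarith : 0 < α) (by linarith) hκ hD
    (fun s t => linearStep_zero s t) lip flow hK hM (by simp [h]) hat htb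
  simpa [add_neg_eq_zero] using this

end IsLinearizedSolution

end linearized

/-! ### Differentiability with respect to the initial value -/

section differentiability

variable {m d : ℕ} {α a b C : ℝ} {x : ℝ → Euc m} {X : ℝ → ℝ → Euc m ⊗[ℝ] Euc m}
  {g : Euc d → Euc m →L[ℝ] Euc d} {φ ψ : ℝ → Euc d} {Xp v : ℝ}

/-- On a subinterval take the smaller of v and the Hölder bound: the smallness of λ persists, and
cubic errors in v' become errors of order 3α. -/
theorem RoughBound.exists_holder (hα : 0 < α) (hX : IsRoughPath α a b x X)
    (hv : RoughBound α a b x X Xp v) : ∃ V, 0 ≤ V ∧ ∀ s t, a ≤ s → s ≤ t → t ≤ b →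
      ∃ v', RoughBound α s t x X v' v' ∧ v' ≤ v ∧ v' ≤ V * (t - s) ^ α := by
  have hp : 0 < 1 / α := by positivity
  have hq : 0 < 1 / α / 2 := by positivity
  obtain ⟨c₁, hc₁, h₁⟩ := hX.holder_path.exists_pos
  obtain ⟨c₂, hc₂, h₂⟩ := hX.holder_area.exists_pos
  refine ⟨c₁ + c₂ + 1, by positivity, fun s t has hst htb => ?_⟩
  rcases le_total v ((c₁ + c₂ + 1) * (t - s) ^ α) with h | h
  · exact ⟨v, ⟨(hv.path.restrict has htb).mono_bound hp hv.path_le, hv.area.restrict has htb,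
      le_rfl⟩, le_rfl, h⟩
  have h0 := Real.rpow_nonneg (sub_nonneg.2 hst) α
  refine ⟨_, ⟨?_, ?_, le_rfl⟩, h, le_rfl⟩
  · have := VarLE.of_holder hp (N := fun s t => ‖x t - x s‖) (fun _ _ => norm_nonneg _) hc₁.le hst
      (fun u w hu huw hw => by
        rw [one_div_one_div]; exact h₁ u w (has.trans hu) huw (hw.trans htb))
    rw [one_div_one_div] at this
    exact this.mono_bound hp (mul_le_mul_of_nonneg_right (by linarith) h0)
  · have := VarLE.of_holder hq (N := fun s t => tensorNorm (X s t)) (fun _ _ => tensorNorm_nonneg _)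
      hc₂.le hst (fun u w hu huw hw => by
        rw [one_div_half_inv]; exact h₂ u w (has.trans hu) huw (hw.trans htb))
    rw [one_div_half_inv, two_mul, Real.rpow_add_of_nonneg (sub_nonneg.2 hst) hα.le hα.le] at this
    refine this.mono_bound hq ?_
    rw [mul_pow, sq ((t - s) ^ α)]
    refine mul_le_mul_of_nonneg_right ?_ (mul_nonneg h0 h0)
    nlinarith

/-- The factor is 1 + 8/3·λ ≤ 4/3. Equal initial values give uniqueness. -/
theorem IsPureSolution.norm_sub_le (hα : 0 < α) (hα' : α < 1 / 2) (hC1 : 1 < C)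
    (hC : IsRoughIntegralConstant α m d C) (hX : IsRoughPath α a b x X)
    (hg : IsCb3 g) (hφ : IsPureSolution α a b x X g φ) (hψ : IsPureSolution α a b x X g ψ)
    (hv : RoughBound α a b x X Xp v) (hlam : C * Cg g * v ≤ 1 / 8) {t : ℝ} (hat : a ≤ t)
    (htb : t ≤ b) : ‖ψ t - φ t‖ ≤ 2 * ‖ψ a - φ a‖ := by
  have h := (hφ.norm_sub_sub_le hα hα' hC1 hC (hat.trans htb) hX hg hψ hv hlam).1
  have h2 := VarLE.norm_le_add (z := fun u => ψ u - φ u) (by positivity) h hat htb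
  have h3 := mul_le_mul_of_nonneg_right hlam (norm_nonneg (ψ a - φ a))
  linarith [norm_nonneg (ψ a - φ a)]

theorem IsPureSolution.exists_norm_expansion_le (hα : 0 < α) (hα' : α < 1 / 2) (hC1 : 1 < C)
    (hC : IsRoughIntegralConstant α m d C) (hX : IsRoughPath α a b x X)
    (hg : IsCb3 g) (hφ : IsPureSolution α a b x X g φ) (hv : RoughBound α a b x X Xp v)
    (hlam : C * Cg g * v ≤ 1 / 8) :
    ∃ K, ∀ ψ, IsPureSolution α a b x X g ψ → ∀ s t, a ≤ s → s ≤ t → t ≤ b →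
      ‖(ψ t - φ t) - (ψ s - φ s) - localIncrement x X (fun u => g (ψ u) - g (φ u))
        (fun u => gDeriv g ψ u - gDeriv g φ u) s t‖ ≤
        K * ‖ψ a - φ a‖ * (t - s) ^ (3 * α) := by
  obtain ⟨V, hV, H⟩ := hv.exists_holder hα hX
  have hCc : 0 ≤ C * Cg g := mul_nonneg (by linarith) (Cg_nonneg g)
  -- The comparison on [s,t] gives the cubic error relative to the distance at s; the factor 2
  -- returns to the distance at a.
  refine ⟨40 * (C * Cg g * V) ^ 3 * 2, fun ψ hψ s t has hst htb => ?_⟩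
  obtain ⟨v', hv', hle, hle'⟩ := H s t has hst htb
  have h := ((hφ.restrict has htb).norm_sub_sub_le hα hα' hC1 hC hst (hX.restrict has htb) hg
    (hψ.restrict has htb) hv' ((mul_le_mul_of_nonneg_left hle hCc).trans hlam)).2
  have hs := hφ.norm_sub_le hα hα' hC1 hC hX hg hψ hv hlam has (hst.trans htb)
  have hst0 := sub_nonneg.2 hst
  have h0 := Real.rpow_nonneg hst0 α
  have ppp : (t - s) ^ (3 * α) = ((t - s) ^ α) ^ 3 := by
    rw [← Real.rpow_natCast, ← Real.rpow_mul hst0]; norm_num [mul_comm]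
  have hv'0 : 0 ≤ v' := hv'.path.bound_nonneg
  have h3 := pow_le_pow_left₀ (mul_nonneg hCc hv'0) (mul_le_mul_of_nonneg_left hle' hCc) 3
  refine h.trans ((mul_le_mul (mul_le_mul_of_nonneg_left h3 (by norm_num : (0 : ℝ) ≤ 40)) hs
    (norm_nonneg _) (by positivity)).trans (le_of_eq ?_))
  rw [ppp]; ring

open Filter Topology

/-- Along an ultrafilter, rescaled differences of solutions converge to solutions of the linearized
equation. -/
theorem IsPureSolution.exists_linearized_limit (hα : 0 < α) (hα' : α < 1 / 2) (hC1 : 1 < C)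
    (hC : IsRoughIntegralConstant α m d C) (hab : a ≤ b) (hX : IsRoughPath α a b x X)
    (hg : IsCb3 g) (hφ : IsPureSolution α a b x X g φ) (hv : RoughBound α a b x X Xp v)
    (hlam : C * Cg g * v ≤ 1 / 8) {ι : Type*} (U : Ultrafilter ι) {ψ : ι → ℝ → Euc d}
    (hψ : ∀ i, IsPureSolution α a b x X g (ψ i)) {c : ι → ℝ} {w : Euc d}
    (h0 : Tendsto (fun i => ψ i a) U (𝓝 (φ a)))
    (hw : Tendsto (fun i => c i • (ψ i a - φ a)) U (𝓝 w)) :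
    ∃ ζ, IsLinearizedSolution α a b x X g φ ζ ∧ ζ a = w ∧
      ∀ t, a ≤ t → t ≤ b → Tendsto (fun i => c i • (ψ i t - φ t)) U (𝓝 (ζ t)) := by
  have hnorm : ∀ᶠ i in (U : Filter ι), ‖c i • (ψ i a - φ a)‖ ≤ ‖w‖ + 1 :=
    (hw.norm.eventually_lt_const (by linarith : ‖w‖ < ‖w‖ + 1)).mono fun _ h => h.le
  have hle : ∀ i t, a ≤ t → t ≤ b →
      ‖c i • (ψ i t - φ t)‖ ≤ 2 * ‖c i • (ψ i a - φ a)‖ := by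
    intro i t hat htb
    have h := mul_le_mul_of_nonneg_left
      (hφ.norm_sub_le hα hα' hC1 hC hX hg (hψ i) hv hlam hat htb) (norm_nonneg (c i))
    rw [norm_smul, norm_smul]
    linarith
  have lim : ∀ t, ∃ z, a ≤ t → t ≤ b →
      ‖z‖ ≤ 2 * (‖w‖ + 1) ∧ Tendsto (fun i => c i • (ψ i t - φ t)) U (𝓝 z) := by
    intro t
    by_cases ht : a ≤ t ∧ t ≤ b
    · obtain ⟨z, hz, hz'⟩ := (isCompact_closedBall (0 : Euc d) (2 * (‖w‖ + 1))).ultrafilter_le_nhds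
        (U.map fun i => c i • (ψ i t - φ t)) (by
          rw [Ultrafilter.coe_map, le_principal_iff, mem_map]
          refine hnorm.mono fun i hi => ?_
          have := hle i t ht.1 ht.2
          simp only [mem_closedBall_zero_iff]
          linarith)
      exact ⟨z, fun _ _ => ⟨by simpa using hz, hz'⟩⟩
    · exact ⟨0, fun h1 h2 => absurd ⟨h1, h2⟩ ht⟩
  choose ζ hζ using lim
  obtain ⟨K, hK⟩ := hφ.exists_norm_expansion_le hα hα' hC1 hC hX hg hv hlam
  have hK' : ∀ i s t, a ≤ s → s ≤ t → t ≤ b →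
      ‖c i • ((ψ i t - φ t) - (ψ i s - φ s) - localIncrement x X (fun u => g (ψ i u) - g (φ u))
        (fun u => gDeriv g (ψ i) u - gDeriv g φ u) s t)‖ ≤
        K * ‖c i • (ψ i a - φ a)‖ * (t - s) ^ (3 * α) := by
    intro i s t has hst htb
    have h := mul_le_mul_of_nonneg_left (hK (ψ i) (hψ i) s t has hst htb) (norm_nonneg (c i))
    rw [norm_smul, norm_smul]
    linarith
  refine ⟨ζ, ⟨⟨_, fun s has hsb => (hζ s has hsb).1⟩, K * ‖w‖, fun s t has hst htb => ?_⟩,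
    tendsto_nhds_unique (hζ a le_rfl hab).2 hw, fun t hat htb => (hζ t hat htb).2⟩
  have zs := (hζ s has (hst.trans htb)).2
  have zt := (hζ t (has.trans hst) htb).2
  have z0 : Tendsto (fun i => ψ i s - φ s) U (𝓝 0) := by
    have h1 : Tendsto (fun i => 2 * ‖ψ i a - φ a‖) U (𝓝 0) := by
      have := ((h0.sub_const (φ a)).norm).const_mul 2
      simpa using this
    exact squeeze_zero_norm (fun i => hφ.norm_sub_le hα hα' hC1 hC hX hg (hψ i) hv hlam has
      (hst.trans htb)) h1
  -- The increments tend to zero and their rescalings to ζ_s, so the rescaled differences of g and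
  -- of Dg·g converge to the derivatives in direction ζ_s.
  have lg := (hasFDerivWithinAt_univ.2 (hg.differentiable (φ s)).hasFDerivAt).lim z0
    (Eventually.of_forall fun _ => Set.mem_univ _) zs
  have lh := (hasFDerivWithinAt_univ.2 (hg.hasFDerivAt_fieldDeriv (φ s)).1).lim z0
    (Eventually.of_forall fun _ => Set.mem_univ _) zs
  have cont : Continuous fun A : Euc m →L[ℝ] Euc m →L[ℝ] Euc d => contract A (X s t) := by
    let Λ : (Euc m →L[ℝ] Euc m →L[ℝ] Euc d) →ₗ[ℝ] Euc d :=
      { toFun := fun A => contract A (X s t)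
        map_add' := fun A B => contract_add_left A B _
        map_smul' := fun r A => contract_smul_left r A _ }
    exact Λ.continuous_of_finiteDimensional
  have l1 : Tendsto (fun i => (c i • (g (φ s + (ψ i s - φ s)) - g (φ s))) (x t - x s)) U
      (𝓝 (fderiv ℝ g (φ s) (ζ s) (x t - x s))) :=
    ((ContinuousLinearMap.apply ℝ (Euc d) (x t - x s)).continuous.tendsto _).comp lg
  have l2 := (cont.tendsto _).comp lh
  have l3 := ((zt.sub zs).sub (l1.add l2)).norm
  have l4 := (hw.norm.const_mul K).mul_const ((t - s) ^ (3 * α))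
  have e : ζ t - linearStep x X g φ s t (ζ s) = ζ t - ζ s - (fderiv ℝ g (φ s) (ζ s) (x t - x s) +
      contract (fderiv ℝ (fieldDeriv g) (φ s) (ζ s)) (X s t)) := by
    rw [linearStep]; abel
  rw [e]
  refine le_of_tendsto_of_tendsto l3 l4 (Eventually.of_forall fun i => ?_)
  refine le_trans (le_of_eq ?_) (hK' i s t has hst htb)
  simp only [Function.comp_apply, add_sub_cancel, localIncrement]
  congr 1
  have e2 : contract (c i • (fieldDeriv g (ψ i s) - fieldDeriv g (φ s))) (X s t) =
      c i • contract (gDeriv g (ψ i) s - gDeriv g φ s) (X s t) := contract_smul_left _ _ _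
  rw [e2, smul_apply, sub_apply]
  module

/-- Limits of difference quotients exist along ultrafilters by compactness. Uniqueness for the
linearized equation makes them independent of the ultrafilter and linear in the direction. -/
theorem exists_hasFDerivAt_initial (hα : 1 / 3 < α) (hα' : α < 1 / 2) (hC1 : 1 < C)
    (hC : IsRoughIntegralConstant α m d C) (hab : a ≤ b) (hX : IsRoughPath α a b x X)
    (hg : IsCb3 g) (hv : RoughBound α a b x X Xp v) (hlam : C * Cg g * v ≤ 1 / 8)
    {Φ : Euc d → ℝ → Euc d} (hΦ : ∀ ξ, IsPureSolution α a b x X g (Φ ξ) ∧ Φ ξ a = ξ)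
    (ξ : Euc d) {t : ℝ} (hat : a ≤ t) (htb : t ≤ b) :
    ∃ J : Euc d →L[ℝ] Euc d, HasFDerivAt (fun η => Φ η t) J ξ := by
  have hα0 : 0 < α := by linarith
  have hφ := (hΦ ξ).1
  set U₀ : Ultrafilter ℝ := Ultrafilter.of (𝓝[≠] (0 : ℝ))
  have hU₀ : (U₀ : Filter ℝ) ≤ 𝓝[≠] 0 := Ultrafilter.of_le _
  have exists_dir : ∀ w : Euc d, ∃ ζ, IsLinearizedSolution α a b x X g (Φ ξ) ζ ∧ ζ a = w := by
    intro w
    obtain ⟨ζ, h1, h2, -⟩ := hφ.exists_linearized_limit hα0 hα' hC1 hC hab hX hg hv hlam U₀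
      (ψ := fun ε => Φ (ξ + ε • w)) (fun ε => (hΦ _).1) (c := fun ε => ε⁻¹) (w := w) (by
        simp only [(hΦ _).2]
        have : Tendsto (fun ε : ℝ => ξ + ε • w) (𝓝 0) (𝓝 (ξ + (0 : ℝ) • w)) :=
          (Continuous.tendsto (by fun_prop) 0)
        rw [zero_smul, add_zero] at this
        exact this.mono_left (hU₀.trans nhdsWithin_le_nhds)) (by
        refine tendsto_const_nhds.congr' ?_
        filter_upwards [hU₀ self_mem_nhdsWithin] with ε hε
        rw [(hΦ _).2, (hΦ _).2, add_sub_cancel_left, smul_smul, inv_mul_cancel₀ hε, one_smul])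
    exact ⟨ζ, h1, h2⟩
  choose ζ hζ hζa using exists_dir
  have uniq : ∀ {η : ℝ → Euc d} {w : Euc d}, IsLinearizedSolution α a b x X g (Φ ξ) η → η a = w →
      η t = ζ w t := fun h1 h2 =>
    h1.eq_of_eq hα hX hg hφ (hζ _) (h2.trans (hζa _).symm) hat htb
  let J : Euc d →ₗ[ℝ] Euc d :=
    { toFun := fun w => ζ w t
      map_add' := fun w w' => (uniq ((hζ w).add (hζ w')) (by rw [hζa, hζa])).symm
      map_smul' := fun r w => (uniq ((hζ w).smul r) (by rw [hζa])).symm }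
  refine ⟨LinearMap.toContinuousLinearMap J, ?_⟩
  rw [hasFDerivAt_iff_tendsto, tendsto_iff_ultrafilter]
  intro U hU
  have hbd : ∀ η : Euc d, ‖‖η - ξ‖⁻¹ • (η - ξ)‖ ≤ 1 := by
    intro η
    rw [norm_smul, norm_inv, norm_norm]
    exact inv_mul_le_one
  -- Along an ultrafilter at ξ the normalized directions converge as well, so one limit direction w
  -- suffices for the Fréchet quotient. At η = ξ the convention 0⁻¹ = 0 is harmless.
  obtain ⟨w, -, hw⟩ := (isCompact_closedBall (0 : Euc d) 1).ultrafilter_le_nhds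
    (U.map fun η => ‖η - ξ‖⁻¹ • (η - ξ)) (by
      rw [Ultrafilter.coe_map, le_principal_iff, mem_map]
      exact Eventually.of_forall fun η => by simpa using hbd η)
  have hw' : Tendsto (fun η => ‖η - ξ‖⁻¹ • (η - ξ)) U (𝓝 w) := hw
  obtain ⟨η, h1, h2, h3⟩ := hφ.exists_linearized_limit hα0 hα' hC1 hC hab hX hg hv hlam U
    (ψ := Φ) (fun η => (hΦ η).1) (c := fun η => ‖η - ξ‖⁻¹) (w := w)
    (by simp only [(hΦ _).2]; exact hU)
    (by simpa only [(hΦ _).2] using hw')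
  have h4 := h3 t hat htb
  rw [uniq h1 h2] at h4
  have h5 : Tendsto (fun η => J (‖η - ξ‖⁻¹ • (η - ξ))) U (𝓝 (ζ w t)) :=
    ((LinearMap.toContinuousLinearMap J).continuous.tendsto w).comp hw'
  have h6 := (h4.sub h5).norm
  rw [sub_self, norm_zero] at h6
  refine h6.congr fun η => ?_
  rw [map_smul, ← smul_sub, norm_smul, norm_inv, norm_norm]
  rfl

/-- Since 8/3·λ ≤ 1/3, J is bounded below by 2/3, hence injective and in finite dimension
invertible. Moreover J⁻¹w - w = -(J - I)J⁻¹w, which gives 8/3·λ · 3/2. -/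
theorem exists_equiv_of_norm_sub_id_le {J : Euc d →L[ℝ] Euc d} {lam : ℝ} (h0 : 0 ≤ lam)
    (h8 : lam ≤ 1 / 8) (hJ : ‖J - ContinuousLinearMap.id ℝ (Euc d)‖ ≤ 8 / 3 * lam) :
    ∃ L : Euc d ≃L[ℝ] Euc d, (L : Euc d →L[ℝ] Euc d) = J ∧
      ‖(L.symm : Euc d →L[ℝ] Euc d) - ContinuousLinearMap.id ℝ (Euc d)‖ ≤ 4 * lam := by
  have hv : ∀ v, ‖J v - v‖ ≤ 8 / 3 * lam * ‖v‖ := fun v => by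
    simpa using norm_apply_le hJ v
  have hinv : ∀ v, ‖v‖ ≤ 3 / 2 * ‖J v‖ := by
    intro v
    have h1 := hv v
    have h2 := norm_sub_norm_le v (J v)
    rw [norm_sub_rev] at h2
    have h3 := mul_le_mul_of_nonneg_right h8 (norm_nonneg v)
    linarith
  have hinj : Function.Injective (J : Euc d →ₗ[ℝ] Euc d) := by
    rw [← LinearMap.ker_eq_bot, LinearMap.ker_eq_bot']
    intro v hv0
    have h1 := hinv v
    have h2 : J v = 0 := hv0
    rw [h2, norm_zero, mul_zero] at h1
    exact norm_le_zero_iff.1 h1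
  set L := (LinearEquiv.ofInjectiveEndo (J : Euc d →ₗ[ℝ] Euc d) hinj).toContinuousLinearEquiv
  have hL : ∀ v, L v = J v := fun v => rfl
  refine ⟨L, by ext v; simp [hL], ?_⟩
  refine ContinuousLinearMap.opNorm_le_bound _ (by linarith) fun w => ?_
  have h1 := hv (L.symm w)
  have h2 := hinv (L.symm w)
  rw [← hL, ContinuousLinearEquiv.apply_symm_apply] at h1 h2
  rw [norm_sub_rev] at h1
  have h3 := mul_le_mul_of_nonneg_left h2 (by linarith : 0 ≤ 8 / 3 * lam)
  simp only [sub_apply, ContinuousLinearEquiv.coe_coe, ContinuousLinearMap.id_apply]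
  linarith

/-- Because q = p/2, the q-th power of the area variation is at most the p-th power of the rough
seminorm, hence the area variation at most its square. -/
theorem roughBound_roughVar (hα : 0 < α) (hab : a ≤ b) (hX : IsRoughPath α a b x X) :
    RoughBound α a b x X (pathVar (1 / α) x a b) (roughVar (1 / α) x X a b) := by
  have hp : 0 < 1 / α := by positivity
  have hq : 0 < 1 / α / 2 := by positivity
  obtain ⟨_, v1⟩ := hX.holder_path.exists_varLE hα (fun _ _ => norm_nonneg _) hab
  obtain ⟨_, v2⟩ := hX.holder_area.exists_varLE_half hα (fun _ _ => tensorNorm_nonneg _) hab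
  have w1 := v1.self hp
  have w2 := v2.self hq
  have h1 : 0 ≤ pathVar (1 / α) x a b := w1.bound_nonneg
  have h2 : 0 ≤ areaVar (1 / α / 2) X a b := w2.bound_nonneg
  have p1 := Real.rpow_nonneg h1 (1 / α)
  have p2 := Real.rpow_nonneg h2 (1 / α / 2)
  have h0 : 0 ≤ roughVar (1 / α) x X a b := Real.rpow_nonneg (add_nonneg p1 p2) _
  have hpow : roughVar (1 / α) x X a b ^ (1 / α) =
      pathVar (1 / α) x a b ^ (1 / α) + areaVar (1 / α / 2) X a b ^ (1 / α / 2) := by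
    rw [roughVar, ← Real.rpow_mul (add_nonneg p1 p2), one_div_mul_cancel hp.ne', Real.rpow_one]
  refine ⟨w1, w2.mono_bound hq ?_, ?_⟩
  · change areaVar (1 / α / 2) X a b ≤ _
    rw [← Real.rpow_le_rpow_iff h2 (sq_nonneg _) hq, ← Real.rpow_natCast, ← Real.rpow_mul h0,
      show ((2 : ℕ) : ℝ) * (1 / α / 2) = 1 / α by push_cast; ring, hpow]
    linarith
  · rw [← Real.rpow_le_rpow_iff h1 h0 hp, hpow]
    linarith

end differentiability

end

/-! ### The main theorem -/

theorem mainTheorem8 (α p q : ℝ) (hα : 1 / 3 < α) (hα' : α < 1 / 2)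
    (hp : p = 1 / α) (hq : q = p / 2) :
    -- admissible constants exist, and can be chosen to depend only on `α`
    (∃ C : ℝ, 1 < C ∧ ∀ m d : ℕ, IsRoughIntegralConstant α m d C) ∧
    -- the estimates, for every admissible constant `Cp`
    ∀ (m d : ℕ) (Cp : ℝ), 1 < Cp → IsRoughIntegralConstant α m d Cp →
    ∀ (a b : ℝ), a ≤ b →
    ∀ (x : ℝ → Euc m) (X : ℝ → ℝ → Euc m ⊗[ℝ] Euc m), IsRoughPath α a b x X →
    ∀ g : Euc d → Euc m →L[ℝ] Euc d, IsCb3 g →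
    ∀ lam : ℝ, lam = Cp * Cg g * roughVar p x X a b → lam ≤ 1 / 8 →
      -- (i)
      (∀ φ : ℝ → Euc d, IsPureSolution α a b x X g φ →
        (pathVar p φ a b ≤ 2 * (supD g 0 * pathVar p x a b + lam ^ 2) ∧
          twoVar p (remainder x φ (fun u => g (φ u))) a b ≤ 2 * lam ^ 2 ∧
          twoVar q (remainder x φ (fun u => g (φ u))) a b ≤ 2 * lam ^ 2) ∧
        (g 0 = 0 →
          pathVar p φ a b ≤ 2 * lam * ‖φ a‖ ∧
          twoVar p (remainder x φ (fun u => g (φ u))) a b ≤ 2 * lam ^ 2 * ‖φ a‖ ∧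
          twoVar q (remainder x φ (fun u => g (φ u))) a b ≤ 2 * lam ^ 2 * ‖φ a‖)) ∧
      -- the solution map is well defined
      (∀ ξ : Euc d, ∃ φ : ℝ → Euc d, IsPureSolution α a b x X g φ ∧ φ a = ξ ∧
        ∀ ψ : ℝ → Euc d, IsPureSolution α a b x X g ψ → ψ a = ξ →
          Set.EqOn ψ φ (Set.Icc a b)) ∧
      -- (ii)
      (∀ Φ : Euc d → ℝ → Euc d,
        (∀ ξ, IsPureSolution α a b x X g (Φ ξ) ∧ Φ ξ a = ξ) →
        ∀ ξ : Euc d, ∀ t ∈ Set.Icc a b, ∃ J : Euc d ≃L[ℝ] Euc d,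
          HasFDerivAt (fun η => Φ η t) (J : Euc d →L[ℝ] Euc d) ξ ∧
          ‖(J : Euc d →L[ℝ] Euc d) - ContinuousLinearMap.id ℝ (Euc d)‖ ≤ 4 * lam ∧
          ‖(J.symm : Euc d →L[ℝ] Euc d) - ContinuousLinearMap.id ℝ (Euc d)‖ ≤ 4 * lam) := by
  subst hp hq
  have hα0 : 0 < α := by linarith
  have hp : 0 < 1 / α := by positivity
  have hq : 0 < 1 / α / 2 := by positivity
  have hqp : 1 / α / 2 ≤ 1 / α := by linarith
  refine ⟨exists_isRoughIntegralConstant hα, ?_⟩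
  intro m d Cp hC1 hC a b hab x X hX g hg lam hlam h8
  have hv := roughBound_roughVar hα0 hab hX
  have hlam' : Cp * Cg g * roughVar (1 / α) x X a b ≤ 1 / 8 := hlam ▸ h8
  have h0 : 0 ≤ lam := hlam ▸ mul_nonneg (mul_nonneg (by linarith) (Cg_nonneg g))
    (hv.path.bound_nonneg.trans hv.path_le)
  refine ⟨fun φ hφ => ⟨?_, fun hg0 => ?_⟩, fun ξ => ?_, fun Φ hΦ ξ t ht => ?_⟩
  · have hR := hφ.varLE_remainder hα0 hα' hC1 hC hab hX hg hv hlam'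
    rw [← hlam] at hR
    have hpath := (varLE_path_of_remainder hα0 hα' (supD_nonneg g 0)
      (fun s _ _ => hg.norm_le (φ s)) hv.path hR).variation_le hp
    refine ⟨hpath.trans ?_, (hR.exponent hq hqp).variation_le hp, hR.variation_le hq⟩
    linarith [mul_nonneg (supD_nonneg g 0) hv.path.bound_nonneg]
  · obtain ⟨h1, h2⟩ := hφ.pathVar_le_of_zero hα0 hα' hC1 hC hab hX hg hv hlam' hg0
    rw [← hlam] at h1 h2
    obtain ⟨_, hR⟩ := hφ.exists_varLE_remainder hα0 hab
    exact ⟨h1, (((hR.self hq).mono_bound hq h2).exponent hq hqp).variation_le hp, h2⟩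
  · obtain ⟨φ, hφ, hφa⟩ := exists_isPureSolution hα hab hX hg ξ
    refine ⟨φ, hφ, hφa, fun ψ hψ hψa t ht => ?_⟩
    have h := hφ.norm_sub_le hα0 hα' hC1 hC hX hg hψ hv hlam' ht.1 ht.2
    rw [hφa, hψa, sub_self, norm_zero, mul_zero] at h
    exact sub_eq_zero.1 (norm_le_zero_iff.1 h)
  · obtain ⟨J, hJ⟩ := exists_hasFDerivAt_initial hα hα' hC1 hC hab hX hg hv hlam' hΦ ξ ht.1 ht.2
    -- The increment over [a,t] of the difference of two solutions is at most its p-variation. This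
    -- bounds the derivative of η ↦ Φ_t(η) - η at ξ.
    have hsub : ∀ η, ‖(Φ η t - η) - (Φ ξ t - ξ)‖ ≤ 8 / 3 * lam * ‖η - ξ‖ := by
      intro η
      have h := ((hΦ ξ).1.norm_sub_sub_le hα0 hα' hC1 hC hab hX hg (hΦ η).1 hv hlam').1
      rw [(hΦ η).2, (hΦ ξ).2, ← hlam] at h
      rcases ht.1.eq_or_lt with rfl | hat
      · rw [(hΦ η).2, (hΦ ξ).2, sub_self, sub_self, sub_self, norm_zero]
        positivity
      · have h' := h.le hp le_rfl hat ht.2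
        rw [(hΦ η).2, (hΦ ξ).2] at h'
        rwa [sub_sub_sub_comm]
    have hJ' : ‖J - ContinuousLinearMap.id ℝ (Euc d)‖ ≤ 8 / 3 * lam :=
      (hJ.sub (hasFDerivAt_id ξ)).le_of_lip' (by positivity) (Filter.Eventually.of_forall hsub)
    obtain ⟨L, rfl, hL⟩ := exists_equiv_of_norm_sub_id_le h0 h8 hJ'
    exact ⟨L, hJ, hJ'.trans (by linarith), hL⟩
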